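/- A \emph{measure} $H$ assigns to every finite simple graph a real number depending only on its isomorphism class. It is \emph{additive} if $H(G_1\oplus G_2)=H(G_1)+H(G_2)$ for vertex-disjoint graphs. An instance of \textsc{MinH} is a triple $(G,k,\tau)$ of a finite graph $G$, a non-negative integer $k$ and a real $\tau$; it is a Yes-instance if it has a \emph{witness}, i.e. a set $S$ of exactly $k$ vertices with $H(G-S)\le\tau$. A measure $H$ is \emph{balanced on trees} with constants $c_H,t_H>0$ if every Yes-instance $(T,k,\tau)$ in which $T$ is a tree with $n$ vertices and $k\ge 1$ has a witness $S$ such that every connected component of $T-S$ has at most $c_H\,(n/k)^{t_H}$ vertices. The model of computation is the real RAM: each memory word holds a real number; arithmetic operations $+,-,\times,/$, comparisons, loading of real constants of the program, and indirect memory access (at addresses that are natural numbers) take unit time; there is no rounding. Space is measured by the largest memory address accessed. Graphs are given by their adjacency matrices. \textbf{Corollary.} Let $H$ be a measure on graphs that is additive, balanced on trees with constants $c_H,t_H>0$, and such that the value of $H$ on a tree with $n$ vertices is computable on a real RAM in time and space polynomial in $n$. Then there is a real RAM algorithm which decides, for every instance $(T,k,\tau)$ of \textsc{MinH} with $T$ a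 tree, whether it is a Yes-instance, in time $2^{O\left((n\log n)^{t_H/(t_H+1)}\right)}$ and in space polynomial in $n$, where $n$ is the number of vertices of $T$. That is, there are a program and constants $A,B,d$, independent of the instance, such that on all these instances its time is at most $A\cdot 2^{A (n\log n)^{t_H/(t_H+1)}}$ and its space is at most $B n^d$. -/

import Mathlib

/-! ### Measures on graphs and the problem MinH -/

/-- A measure on finite (unlabelled) graphs: a real number attached to every finite graph,
depending only on its isomorphism class. -/
structure GraphMeasure where
  val : {V : Type} → [Finite V] → SimpleGraph V → ℝ
  iso_inv : ∀ {V W : Type} [Finite V] [Finite W] (G : SimpleGraph V) (G' : SimpleGraph W),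
    Nonempty (G ≃g G') → val G = val G'

/-- `H(G₁ ⊕ G₂) = H(G₁) + H(G₂)` for disjoint unions. -/
def GraphMeasure.Additive (H : GraphMeasure) : Prop :=
  ∀ {V W : Type} [Finite V] [Finite W] (G : SimpleGraph V) (G' : SimpleGraph W),
    H.val (SimpleGraph.sum G G') = H.val G + H.val G'

/-- `S` is a witness for the instance `(G, k, τ)` of MinH: it has exactly `k` vertices and
`H(G - S) ≤ τ`. -/
def GraphMeasure.IsWitness (H : GraphMeasure) {V : Type} [Finite V] (G : SimpleGraph V)
    (k : ℕ) (τ : ℝ) (S : Set V) : Prop :=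
  S.ncard = k ∧ H.val (G.induce Sᶜ) ≤ τ

/-- `(G, k, τ)` is a yes-instance of MinH. -/
def GraphMeasure.IsYes (H : GraphMeasure) {V : Type} [Finite V] (G : SimpleGraph V)
    (k : ℕ) (τ : ℝ) : Prop :=
  ∃ S : Set V, H.IsWitness G k τ S

/-- Deleting `S` leaves components with at most `L` vertices each. -/
def IsTrimming {V : Type} (G : SimpleGraph V) (L : ℝ) (S : Set V) : Prop :=
  ∀ C : (G.induce Sᶜ).ConnectedComponent, (C.supp.ncard : ℝ) ≤ L

/-- `H` is balanced on trees with the positive constants `c` and `t`: every yes-instance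
`(G, k, τ)` of MinH on a tree with `n` vertices has a `c (n/k)^t`-trimming witness.
For `k = 0` the bound `c (n/k)^t` is infinite, that is, no condition, so `1 ≤ k` is required. -/
def GraphMeasure.BalancedOnTrees (H : GraphMeasure) (c t : ℝ) : Prop :=
  0 < c ∧ 0 < t ∧
    ∀ {V : Type} [Finite V] (G : SimpleGraph V), G.IsTree → ∀ (k : ℕ) (τ : ℝ), 1 ≤ k →
      H.IsYes G k τ →
        ∃ S : Set V, H.IsWitness G k τ S ∧ IsTrimming G (c * ((Nat.card V : ℝ) / k) ^ t) S

/-! ### The real RAM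

Programs use finitely many scalar variables and finitely many arrays (both named by natural
numbers); every scalar and every array cell holds one real number. Addition, subtraction,
multiplication, division, comparison, loading a constant, and reading or writing the array cell
whose index is held by a scalar variable take one step each. There is no rounding: an access whose
index is not a natural number is an error, and so is a division by zero. -/

namespace RealRAM

/-- Contents of the memory. -/
structure State where
  scalar : ℕ → ℝ
  array : ℕ → ℕ → ℝ

def State.setScalar (σ : State) (x : ℕ) (v : ℝ) : State :=
  ⟨Function.update σ.scalar x v, σ.array⟩

def State.setCell (σ : State) (a i : ℕ) (v : ℝ) : State :=
  ⟨σ.scalar, Function.update σ.array a (Function.update (σ.array a) i v)⟩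

/-- Comparisons of two scalar variables. -/
inductive Test where
  | lt (x y : ℕ)
  | le (x y : ℕ)
  | eq (x y : ℕ)
  | ne (x y : ℕ)

def Test.Holds (σ : State) : Test → Prop
  | .lt x y => σ.scalar x < σ.scalar y
  | .le x y => σ.scalar x ≤ σ.scalar y
  | .eq x y => σ.scalar x = σ.scalar y
  | .ne x y => σ.scalar x ≠ σ.scalar y

/-- Programs. In `add x y z` and the like, `x` receives the result; `load x a y` sets the scalar `x`
to the cell of array `a` whose index is the value of the scalar `y`; `store a y x` writes the scalar
`x` to that cell. -/
inductive Program where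
  | skip
  | const (x : ℕ) (r : ℝ)
  | copy (x y : ℕ)
  | add (x y z : ℕ)
  | sub (x y z : ℕ)
  | mul (x y z : ℕ)
  | div (x y z : ℕ)
  | load (x a y : ℕ)
  | store (a y x : ℕ)
  | seq (P Q : Program)
  | ite (b : Test) (P Q : Program)
  | loop (b : Test) (P : Program)

/-- `Exec s P σ T σ'`: started in `σ`, the program `P` halts without error in `σ'` after exactly `T`
steps, and accesses only array cells with index less than `s` (so that it uses at most `s` cells
of each of the finitely many arrays that it mentions). -/
inductive Exec (s : ℕ) : Program → State → ℕ → State → Prop where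
  | skip (σ : State) : Exec s .skip σ 1 σ
  | const (σ : State) (x : ℕ) (r : ℝ) : Exec s (.const x r) σ 1 (σ.setScalar x r)
  | copy (σ : State) (x y : ℕ) : Exec s (.copy x y) σ 1 (σ.setScalar x (σ.scalar y))
  | add (σ : State) (x y z : ℕ) :
      Exec s (.add x y z) σ 1 (σ.setScalar x (σ.scalar y + σ.scalar z))
  | sub (σ : State) (x y z : ℕ) :
      Exec s (.sub x y z) σ 1 (σ.setScalar x (σ.scalar y - σ.scalar z))
  | mul (σ : State) (x y z : ℕ) :
      Exec s (.mul x y z) σ 1 (σ.setScalar x (σ.scalar y * σ.scalar z))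
  | div (σ : State) (x y z : ℕ) (hz : σ.scalar z ≠ 0) :
      Exec s (.div x y z) σ 1 (σ.setScalar x (σ.scalar y / σ.scalar z))
  | load (σ : State) (x a y i : ℕ) (hi : σ.scalar y = (i : ℝ)) (his : i < s) :
      Exec s (.load x a y) σ 1 (σ.setScalar x (σ.array a i))
  | store (σ : State) (a y x i : ℕ) (hi : σ.scalar y = (i : ℝ)) (his : i < s) :
      Exec s (.store a y x) σ 1 (σ.setCell a i (σ.scalar x))
  | seq {P Q : Program} {σ σ' σ'' : State} {T T' : ℕ} (hP : Exec s P σ T σ')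
      (hQ : Exec s Q σ' T' σ'') : Exec s (.seq P Q) σ (T + T') σ''
  | iteTrue {b : Test} {P Q : Program} {σ σ' : State} {T : ℕ} (hb : b.Holds σ)
      (hP : Exec s P σ T σ') : Exec s (.ite b P Q) σ (T + 1) σ'
  | iteFalse {b : Test} {P Q : Program} {σ σ' : State} {T : ℕ} (hb : ¬ b.Holds σ)
      (hQ : Exec s Q σ T σ') : Exec s (.ite b P Q) σ (T + 1) σ'
  | loopFalse {b : Test} {P : Program} {σ : State} (hb : ¬ b.Holds σ) :
      Exec s (.loop b P) σ 1 σ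
  | loopTrue {b : Test} {P : Program} {σ σ' σ'' : State} {T T' : ℕ} (hb : b.Holds σ)
      (hP : Exec s P σ T σ') (hL : Exec s (.loop b P) σ' T' σ'') :
      Exec s (.loop b P) σ (T + T' + 1) σ''

/-- On input `σ`, the program `P` halts with the value `out` in the scalar variable `0`, within the
given time and space. -/
def Outputs (P : Program) (σ : State) (out time space : ℝ) : Prop :=
  ∃ (T s : ℕ) (σ' : State),
    Exec s P σ T σ' ∧ σ'.scalar 0 = out ∧ (T : ℝ) ≤ time ∧ (s : ℝ) ≤ space

open Classical in
/-- The adjacency matrix of a graph on `{0, …, n-1}`, stored row by row: cell `i * n + j` holds `1`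
if `i` and `j` are adjacent; all other cells hold `0`. -/
noncomputable def adjCells {n : ℕ} (G : SimpleGraph (Fin n)) (a : ℕ) : ℝ :=
  if ∃ i j : Fin n, a = (i : ℕ) * n + (j : ℕ) ∧ G.Adj i j then 1 else 0

/-- The initial memory for a graph and two further numbers: the scalars `0, 1, 2` hold `n, p, q`,
the array `0` holds the adjacency matrix, and everything else is `0`. -/
noncomputable def input {n : ℕ} (G : SimpleGraph (Fin n)) (p q : ℝ) : State where
  scalar := fun x => if x = 0 then (n : ℝ) else if x = 1 then p else if x = 2 then q else 0
  array := fun a => if a = 0 then adjCells G else fun _ => 0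

end RealRAM

/-- The value of `H` on trees is computed by a real RAM program in polynomial time and space. -/
def GraphMeasure.PolyComputableOnTrees (H : GraphMeasure) : Prop :=
  ∃ (P : RealRAM.Program) (A d : ℕ), ∀ (n : ℕ) (G : SimpleGraph (Fin n)), G.IsTree →
    RealRAM.Outputs P (RealRAM.input G 0 0) (H.val G) (A * (n : ℝ) ^ d) (A * (n : ℝ) ^ d)

open Classical in
/-- `1` for yes-instances of MinH and `0` for no-instances. -/
noncomputable def GraphMeasure.answer (H : GraphMeasure) {n : ℕ} (G : SimpleGraph (Fin n))
    (k : ℕ) (τ : ℝ) : ℝ :=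
  if H.IsYes G k τ then 1 else 0

/-- The program `P` decides MinH on trees: on every instance `(G, k, τ)` where `G` is a tree with
`n` vertices, it gives the right answer within `time n` steps and `space n` memory. -/
def GraphMeasure.DecidesOnTrees (H : GraphMeasure) (P : RealRAM.Program)
    (time space : ℕ → ℝ) : Prop :=
  ∀ (n : ℕ) (G : SimpleGraph (Fin n)), G.IsTree → ∀ (k : ℕ) (τ : ℝ),
    RealRAM.Outputs P (RealRAM.input G k τ) (H.answer G k τ) (time n) (space n)

/-! The tree is numbered in preorder by depth-first search. Depths `d` and subtree ends `nx` then
describe it completely, and subtrees become intervals. A dynamic program runs through the vertices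
from right to left and keeps, for each vertex `x` and each number `j` of deletions, a value of `H`
on what remains of the subtree at `x`.

If `x` is deleted, its subtree falls apart into the subtrees of its children, and additivity turns
this into min-plus convolutions (`valD_succ`, `valI_split`). If `x` stays, its component is guessed
as a list `R` of relative depths in preorder. This list determines the component up to isomorphism
(`valOn_comp`), so the given program can evaluate `H` on it. The deletion sets that leave exactly
this component are found by aligning `R` with the subtree: each vertex is either the next entry of
`R`, or deleted, in which case its subtree is skipped and contributes a value already tabulated
(`valV_cases`, `valV_of_match`, `valV_of_conv`).

There are too many possible components to try all of them, so the guesses come from one of two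
codes. A component can be given by `k` vertices, as what lies below `x` but not below any of them.
This takes `n ^ k` codes and reaches every witness (`dlist_mem_codeFam_cut`). Or it can be given by
a walk of `2 * L` bits that traces its depth list. This reaches all components with at most `L`
vertices (`WalkList.mem_codeFam`), and by balancedness some witness has only components with at most
`c * (n / k) ^ t` vertices. The program uses whichever code needs fewer bits. Up to constants this
number of bits is at most both `k * log n` and `c * (n / k) ^ t`; in the geometric mean with weights
`t / (t + 1)` and `1 / (t + 1)` the `k` cancels, and `(n * log n) ^ (t / (t + 1))` is left
(`Choice.count_le`). The codes are enumerated and not stored, so space stays polynomial.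

As only a family of components is tried, a table entry need not be an optimum. The invariant
`Between` is weaker: a finite entry is attained by some deletion set, and no deletion set whose
components belong to the family does better. The first half makes a positive answer correct, the
second a negative one, because some witness is in reach of the codes (`Choice.exists_mem`).

The program is written in a small typed language with bounded loops, verified by weakest
preconditions (`wp`), and compiled to the real RAM (`Cmd.run`). Its running time is a fixed
polynomial in a bound `M` for the rounds of all loops and the time of a call (`Cmd.bound_le`); only
the number of codes makes `M` exponential (`exists_time`). The program for `H` runs as a subroutine
on renamed variables (`Exec.rename`). -/

/-! ### Running programs -/

namespace RealRAM

/-- From `σ`, the program `P` halts within `C` steps and space `s` in a state satisfying `Φ`. -/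
def Run (s : ℕ) (P : Program) (σ : State) (C : ℕ) (Φ : State → Prop) : Prop :=
  ∃ (T : ℕ) (σ' : State), Exec s P σ T σ' ∧ T ≤ C ∧ Φ σ'

theorem Run.mono {s : ℕ} {P : Program} {σ : State} {C C' : ℕ} {Φ Ψ : State → Prop}
    (h : Run s P σ C Φ) (hC : C ≤ C') (hΦ : ∀ σ', Φ σ' → Ψ σ') : Run s P σ C' Ψ := by
  obtain ⟨T, σ', h1, h2, h3⟩ := h
  exact ⟨T, σ', h1, h2.trans hC, hΦ _ h3⟩

theorem Run.seq {s : ℕ} {P Q : Program} {σ : State} {C C' : ℕ} {Φ : State → Prop}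
    (h : Run s P σ C (fun σ' => Run s Q σ' C' Φ)) : Run s (.seq P Q) σ (C + C') Φ := by
  obtain ⟨T, σ', h1, h2, T', σ'', h3, h4, h5⟩ := h
  exact ⟨T + T', σ'', .seq h1 h3, by omega, h5⟩

theorem Run.seq' {s : ℕ} {P Q : Program} {σ : State} {C C' : ℕ} {Φ Ψ : State → Prop}
    (h : Run s P σ C Ψ) (h' : ∀ σ', Ψ σ' → Run s Q σ' C' Φ) : Run s (.seq P Q) σ (C + C') Φ :=
  Run.seq (h.mono le_rfl h')

theorem Run.const {s x : ℕ} {r : ℝ} {σ : State} {Φ : State → Prop}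
    (h : Φ (σ.setScalar x r)) : Run s (.const x r) σ 1 Φ := ⟨1, _, .const σ x r, le_rfl, h⟩

theorem Run.copy {s x y : ℕ} {σ : State} {Φ : State → Prop}
    (h : Φ (σ.setScalar x (σ.scalar y))) : Run s (.copy x y) σ 1 Φ :=
  ⟨1, _, .copy σ x y, le_rfl, h⟩

theorem Run.add {s x y z : ℕ} {σ : State} {Φ : State → Prop}
    (h : Φ (σ.setScalar x (σ.scalar y + σ.scalar z))) : Run s (.add x y z) σ 1 Φ :=
  ⟨1, _, .add σ x y z, le_rfl, h⟩

theorem Run.sub {s x y z : ℕ} {σ : State} {Φ : State → Prop}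
    (h : Φ (σ.setScalar x (σ.scalar y - σ.scalar z))) : Run s (.sub x y z) σ 1 Φ :=
  ⟨1, _, .sub σ x y z, le_rfl, h⟩

theorem Run.mul {s x y z : ℕ} {σ : State} {Φ : State → Prop}
    (h : Φ (σ.setScalar x (σ.scalar y * σ.scalar z))) : Run s (.mul x y z) σ 1 Φ :=
  ⟨1, _, .mul σ x y z, le_rfl, h⟩

theorem Run.load {s x a y i : ℕ} {σ : State} {Φ : State → Prop} (hi : σ.scalar y = (i : ℝ))
    (his : i < s) (h : Φ (σ.setScalar x (σ.array a i))) : Run s (.load x a y) σ 1 Φ :=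
  ⟨1, _, .load σ x a y i hi his, le_rfl, h⟩

theorem Run.store {s x a y i : ℕ} {σ : State} {Φ : State → Prop} (hi : σ.scalar y = (i : ℝ))
    (his : i < s) (h : Φ (σ.setCell a i (σ.scalar x))) : Run s (.store a y x) σ 1 Φ :=
  ⟨1, _, .store σ a y x i hi his, le_rfl, h⟩

theorem Run.ite {s : ℕ} {b : Test} {P Q : Program} {σ : State} {C : ℕ} {Φ : State → Prop}
    (hP : b.Holds σ → Run s P σ C Φ) (hQ : ¬ b.Holds σ → Run s Q σ C Φ) :
    Run s (.ite b P Q) σ (C + 1) Φ := by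
  by_cases hb : b.Holds σ
  · obtain ⟨T, σ', h1, h2, h3⟩ := hP hb
    exact ⟨T + 1, σ', .iteTrue hb h1, by omega, h3⟩
  · obtain ⟨T, σ', h1, h2, h3⟩ := hQ hb
    exact ⟨T + 1, σ', .iteFalse hb h1, by omega, h3⟩

/-- The parameter `s` is only a cap on the indices accessed. The subroutine is analysed with its own
cap and then run inside a larger one. -/
theorem Exec.mono_space {s s' : ℕ} (hs : s ≤ s') {P : Program} {σ σ' : State} {T : ℕ}
    (h : Exec s P σ T σ') : Exec s' P σ T σ' := by
  induction h with
  | skip σ => exact .skip σ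
  | const σ x r => exact .const σ x r
  | copy σ x y => exact .copy σ x y
  | add σ x y z => exact .add σ x y z
  | sub σ x y z => exact .sub σ x y z
  | mul σ x y z => exact .mul σ x y z
  | div σ x y z hz => exact .div σ x y z hz
  | load σ x a y i hi his => exact .load σ x a y i hi (his.trans_le hs)
  | store σ a y x i hi his => exact .store σ a y x i hi (his.trans_le hs)
  | seq _ _ h1 h2 => exact .seq h1 h2
  | iteTrue hb _ h1 => exact .iteTrue hb h1
  | iteFalse hb _ h1 => exact .iteFalse hb h1
  | loopFalse hb => exact .loopFalse hb
  | loopTrue hb _ _ h1 h2 => exact .loopTrue hb h1 h2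

/-! ### Running a program as a subroutine on renamed variables -/

/-- The residue 4 modulo 5 for scalars, and 3 modulo 4 for arrays, are reserved for the subroutine;
the other residues hold the data of the calling program. -/
def Test.rename : Test → Test
  | .lt x y => .lt (5 * x + 4) (5 * y + 4)
  | .le x y => .le (5 * x + 4) (5 * y + 4)
  | .eq x y => .eq (5 * x + 4) (5 * y + 4)
  | .ne x y => .ne (5 * x + 4) (5 * y + 4)

/-- The program with scalars `x` renamed to `5 * x + 4` and arrays `a` to `4 * a + 3`. -/
def Program.rename : Program → Program
  | .skip => .skip
  | .const x r => .const (5 * x + 4) r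
  | .copy x y => .copy (5 * x + 4) (5 * y + 4)
  | .add x y z => .add (5 * x + 4) (5 * y + 4) (5 * z + 4)
  | .sub x y z => .sub (5 * x + 4) (5 * y + 4) (5 * z + 4)
  | .mul x y z => .mul (5 * x + 4) (5 * y + 4) (5 * z + 4)
  | .div x y z => .div (5 * x + 4) (5 * y + 4) (5 * z + 4)
  | .load x a y => .load (5 * x + 4) (4 * a + 3) (5 * y + 4)
  | .store a y x => .store (4 * a + 3) (5 * y + 4) (5 * x + 4)
  | .seq P Q => .seq P.rename Q.rename
  | .ite b P Q => .ite b.rename P.rename Q.rename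
  | .loop b P => .loop b.rename P.rename

/-- Only an upper bound for the variable names matters, and a sum is as good as a maximum. -/
def Test.width : Test → ℕ
  | .lt x y => x + y + 1
  | .le x y => x + y + 1
  | .eq x y => x + y + 1
  | .ne x y => x + y + 1

/-- All variables of the program are below its width. -/
def Program.width : Program → ℕ
  | .skip => 0
  | .const x _ => x + 1
  | .copy x y => x + y + 1
  | .add x y z => x + y + z + 1
  | .sub x y z => x + y + z + 1
  | .mul x y z => x + y + z + 1
  | .div x y z => x + y + z + 1
  | .load x a y => x + a + y + 1
  | .store a y x => x + a + y + 1
  | .seq P Q => P.width + Q.width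
  | .ite b P Q => b.width + P.width + Q.width
  | .loop b P => b.width + P.width

/-- The renamed variables of `τ` hold the contents of the variables below `N` of `σ`. -/
structure Embeds (N s : ℕ) (σ τ : State) : Prop where
  scalar : ∀ x < N, τ.scalar (5 * x + 4) = σ.scalar x
  array : ∀ a < N, ∀ i < s, τ.array (4 * a + 3) i = σ.array a i

structure SameOutside (τ τ' : State) : Prop where
  scalar : ∀ y, y % 5 ≠ 4 → τ'.scalar y = τ.scalar y
  array : ∀ a, a % 4 ≠ 3 → τ'.array a = τ.array a

theorem SameOutside.refl (τ : State) : SameOutside τ τ := ⟨fun _ _ => rfl, fun _ _ => rfl⟩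

theorem SameOutside.trans {τ τ' τ'' : State} (h : SameOutside τ τ') (h' : SameOutside τ' τ'') :
    SameOutside τ τ'' :=
  ⟨fun y hy => (h'.scalar y hy).trans (h.scalar y hy),
    fun a ha => (h'.array a ha).trans (h.array a ha)⟩

theorem Embeds.setScalar {N s : ℕ} {σ τ : State} (h : Embeds N s σ τ) (x : ℕ) (v : ℝ) :
    Embeds N s (σ.setScalar x v) (τ.setScalar (5 * x + 4) v) := by
  refine ⟨fun y hy => ?_, h.array⟩
  simp only [State.setScalar, Function.update_apply]
  by_cases hxy : y = x
  · simp [hxy]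
  · rw [if_neg (by omega), if_neg hxy, h.scalar y hy]

theorem SameOutside.setScalar (τ : State) (x : ℕ) (v : ℝ) :
    SameOutside τ (τ.setScalar (5 * x + 4) v) := by
  refine ⟨fun y hy => ?_, fun _ _ => rfl⟩
  simp only [State.setScalar, Function.update_apply]
  rw [if_neg (by omega)]

theorem Embeds.setCell {N s : ℕ} {σ τ : State} (h : Embeds N s σ τ) (a i : ℕ) (v : ℝ) :
    Embeds N s (σ.setCell a i v) (τ.setCell (4 * a + 3) i v) := by
  refine ⟨h.scalar, fun b hb j hj => ?_⟩
  simp only [State.setCell, Function.update_apply]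
  by_cases hab : b = a
  · subst hab
    simp only [if_true, Function.update_apply]
    rw [h.array b hb j hj]
  · rw [if_neg (by omega), if_neg hab, h.array b hb j hj]

theorem SameOutside.setCell (τ : State) (a i : ℕ) (v : ℝ) :
    SameOutside τ (τ.setCell (4 * a + 3) i v) := by
  refine ⟨fun _ _ => rfl, fun b hb => ?_⟩
  simp only [State.setCell, Function.update_apply]
  rw [if_neg (by omega)]

theorem Embeds.holds_iff {N s : ℕ} {σ τ : State} (h : Embeds N s σ τ) {b : Test}
    (hb : b.width ≤ N) : b.rename.Holds τ ↔ b.Holds σ := by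
  cases b <;> simp only [Test.width] at hb <;> simp only [Test.rename, Test.Holds] <;>
    rw [h.scalar _ (by omega), h.scalar _ (by omega)]

/-- A run reads only variables below the width and cells below `s`, so agreement on this finite part
is enough to replay it step by step. Hence finitely many assignments can prepare a call, although
`input` prescribes the whole memory. -/
theorem Exec.rename {s N : ℕ} {P : Program} {σ σ' : State} {T : ℕ} (h : Exec s P σ T σ')
    (hP : P.width ≤ N) (τ : State) (hτ : Embeds N s σ τ) :
    ∃ τ', Exec s P.rename τ T τ' ∧ Embeds N s σ' τ' ∧ SameOutside τ τ' := by
  induction h generalizing τ with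
  | skip σ => exact ⟨τ, .skip τ, hτ, .refl τ⟩
  | const σ x r => exact ⟨_, .const τ _ r, hτ.setScalar x r, .setScalar τ x r⟩
  | copy σ x y =>
    simp only [Program.width] at hP
    refine ⟨_, .copy τ _ _, ?_, .setScalar τ x _⟩
    rw [hτ.scalar y (by omega)]
    exact hτ.setScalar x _
  | add σ x y z =>
    simp only [Program.width] at hP
    refine ⟨_, .add τ _ _ _, ?_, .setScalar τ x _⟩
    rw [hτ.scalar y (by omega), hτ.scalar z (by omega)]
    exact hτ.setScalar x _
  | sub σ x y z =>
    simp only [Program.width] at hP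
    refine ⟨_, .sub τ _ _ _, ?_, .setScalar τ x _⟩
    rw [hτ.scalar y (by omega), hτ.scalar z (by omega)]
    exact hτ.setScalar x _
  | mul σ x y z =>
    simp only [Program.width] at hP
    refine ⟨_, .mul τ _ _ _, ?_, .setScalar τ x _⟩
    rw [hτ.scalar y (by omega), hτ.scalar z (by omega)]
    exact hτ.setScalar x _
  | div σ x y z hz =>
    simp only [Program.width] at hP
    refine ⟨_, .div τ _ _ _ (by rwa [hτ.scalar z (by omega)]), ?_, .setScalar τ x _⟩
    rw [hτ.scalar y (by omega), hτ.scalar z (by omega)]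
    exact hτ.setScalar x _
  | load σ x a y i hi his =>
    simp only [Program.width] at hP
    refine ⟨_, .load τ _ _ _ i (by rwa [hτ.scalar y (by omega)]) his, ?_, .setScalar τ x _⟩
    rw [hτ.array a (by omega) i his]
    exact hτ.setScalar x _
  | store σ a y x i hi his =>
    simp only [Program.width] at hP
    refine ⟨_, .store τ _ _ _ i (by rwa [hτ.scalar y (by omega)]) his, ?_, .setCell τ a i _⟩
    rw [hτ.scalar x (by omega)]
    exact hτ.setCell a i _
  | seq _ _ h1 h2 =>
    simp only [Program.width] at hP
    obtain ⟨τ1, e1, r1, o1⟩ := h1 (by omega) τ hτ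
    obtain ⟨τ2, e2, r2, o2⟩ := h2 (by omega) τ1 r1
    exact ⟨τ2, .seq e1 e2, r2, o1.trans o2⟩
  | iteTrue hb _ h1 =>
    simp only [Program.width] at hP
    obtain ⟨τ1, e1, r1, o1⟩ := h1 (by omega) τ hτ
    exact ⟨τ1, .iteTrue ((hτ.holds_iff (by omega)).2 hb) e1, r1, o1⟩
  | iteFalse hb _ h1 =>
    simp only [Program.width] at hP
    obtain ⟨τ1, e1, r1, o1⟩ := h1 (by omega) τ hτ
    exact ⟨τ1, .iteFalse (fun h => hb ((hτ.holds_iff (by omega)).1 h)) e1, r1, o1⟩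
  | loopFalse hb =>
    simp only [Program.width] at hP
    exact ⟨τ, .loopFalse (fun h => hb ((hτ.holds_iff (by omega)).1 h)), hτ, .refl τ⟩
  | loopTrue hb _ _ h1 h2 =>
    have hP' := hP
    simp only [Program.width] at hP
    obtain ⟨τ1, e1, r1, o1⟩ := h1 (by omega) τ hτ
    obtain ⟨τ2, e2, r2, o2⟩ := h2 hP' τ1 r1
    exact ⟨τ2, .loopTrue ((hτ.holds_iff (by omega)).2 hb) e1 e2, r2, o1.trans o2⟩

end RealRAM

/-! ### A structured language on top of the real RAM

Its variables and arrays are typed: natural numbers (`n`, `A`), extended reals (`w`, `W`), and the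
memory of a subroutine (`p`, `pa`). All loops are bounded. -/

namespace TreeDP

open RealRAM

structure Store where
  n : ℕ → ℕ
  w : ℕ → WithTop ℝ
  A : ℕ → ℕ → ℕ
  W : ℕ → ℕ → WithTop ℝ
  p : ℕ → ℝ
  pa : ℕ → ℕ → ℝ

def Store.setN (h : Store) (x v : ℕ) : Store := { h with n := Function.update h.n x v }
def Store.setW (h : Store) (x : ℕ) (v : WithTop ℝ) : Store :=
  { h with w := Function.update h.w x v }
def Store.stN (h : Store) (a i v : ℕ) : Store :=
  { h with A := Function.update h.A a (Function.update (h.A a) i v) }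
def Store.stW (h : Store) (a i : ℕ) (v : WithTop ℝ) : Store :=
  { h with W := Function.update h.W a (Function.update (h.W a) i v) }
def Store.setP (h : Store) (x : ℕ) (v : ℝ) : Store := { h with p := Function.update h.p x v }
def Store.stP (h : Store) (a i : ℕ) (v : ℝ) : Store :=
  { h with pa := Function.update h.pa a (Function.update (h.pa a) i v) }

inductive NExp where
  | c (k : ℕ)
  | v (x : ℕ)
  | ld (a : ℕ) (e : NExp)
  | add (e f : NExp)
  | sub (e f : NExp)
  | mul (e f : NExp)

def NExp.eval (h : Store) : NExp → ℕ
  | .c k => k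
  | .v x => h.n x
  | .ld a e => h.A a (e.eval h)
  | .add e f => e.eval h + f.eval h
  | .sub e f => e.eval h - f.eval h
  | .mul e f => e.eval h * f.eval h

def NExp.ok (s : ℕ) (h : Store) : NExp → Prop
  | .c _ => True
  | .v _ => True
  | .ld _ e => e.ok s h ∧ e.eval h < s
  | .add e f => e.ok s h ∧ f.ok s h
  | .sub e f => e.ok s h ∧ f.ok s h
  | .mul e f => e.ok s h ∧ f.ok s h

/-- Subtraction is truncated, which costs an extra comparison. -/
def NExp.cost : NExp → ℕ
  | .c _ => 1
  | .v _ => 1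
  | .ld _ e => e.cost + 1
  | .add e f => e.cost + f.cost + 1
  | .sub e f => e.cost + f.cost + 2
  | .mul e f => e.cost + f.cost + 1

/-- The scalar variable for the `t`-th intermediate result. -/
abbrev tmp (t : ℕ) : ℕ := 5 * t + 3

/-- The second argument is a stack height: the result is left in `tmp t`, and only temporaries from
height `t` on are overwritten. -/
def NExp.comp : NExp → ℕ → Program
  | .c k, t => .const (tmp t) k
  | .v x, t => .copy (tmp t) (5 * x)
  | .ld a e, t => .seq (e.comp t) (.load (tmp t) (4 * a) (tmp t))
  | .add e f, t => .seq (e.comp t) (.seq (f.comp (t + 1)) (.add (tmp t) (tmp t) (tmp (t + 1))))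
  | .sub e f, t => .seq (e.comp t) (.seq (f.comp (t + 1))
      (.ite (.le (tmp (t + 1)) (tmp t)) (.sub (tmp t) (tmp t) (tmp (t + 1))) (.const (tmp t) 0)))
  | .mul e f, t => .seq (e.comp t) (.seq (f.comp (t + 1)) (.mul (tmp t) (tmp t) (tmp (t + 1))))

/-- `f` and `v` represent the extended real `w`. -/
def Enc (f v : ℝ) (w : WithTop ℝ) : Prop := (f = 0 ∧ w = ⊤) ∨ (f = 1 ∧ w = (v : WithTop ℝ))

/-- The state `σ` represents the store `h`. -/
structure Rel (h : Store) (σ : State) : Prop where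
  n : ∀ x, σ.scalar (5 * x) = h.n x
  w : ∀ x, Enc (σ.scalar (5 * x + 1)) (σ.scalar (5 * x + 2)) (h.w x)
  p : ∀ x, σ.scalar (5 * x + 4) = h.p x
  A : ∀ a i, σ.array (4 * a) i = h.A a i
  W : ∀ a i, Enc (σ.array (4 * a + 1) i) (σ.array (4 * a + 2) i) (h.W a i)
  pa : ∀ a i, σ.array (4 * a + 3) i = h.pa a i

/-- `σ` and `σ'` differ at most in the intermediate results from `t` on. -/
structure TmpEq (t : ℕ) (σ σ' : State) : Prop where
  array : σ'.array = σ.array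
  scalar : ∀ y, (y % 5 = 3 → y < 5 * t + 3) → σ'.scalar y = σ.scalar y

theorem TmpEq.refl (t : ℕ) (σ : State) : TmpEq t σ σ := ⟨rfl, fun _ _ => rfl⟩

theorem TmpEq.trans {t t' : ℕ} {σ σ' σ'' : State} (h : TmpEq t σ σ') (h' : TmpEq t' σ' σ'')
    (ht : t ≤ t') : TmpEq t σ σ'' :=
  ⟨h'.array.trans h.array, fun y hy =>
    (h'.scalar y (fun e => by have := hy e; omega)).trans (h.scalar y hy)⟩

theorem TmpEq.set {t u : ℕ} {σ σ' : State} (h : TmpEq t σ σ') (htu : t ≤ u) (v : ℝ) :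
    TmpEq t σ (σ'.setScalar (tmp u) v) := by
  refine ⟨h.array, fun y hy => ?_⟩
  rw [← h.scalar y hy]
  simp only [State.setScalar, Function.update_apply]
  rw [if_neg (fun e => by unfold tmp at e; have := hy (by omega); omega)]

theorem TmpEq.tmp {t u : ℕ} {σ σ' : State} (h : TmpEq t σ σ') (hu : u < t) :
    σ'.scalar (tmp u) = σ.scalar (tmp u) := h.scalar _ (fun _ => by unfold TreeDP.tmp; omega)

theorem TmpEq.rel {t : ℕ} {σ σ' : State} {h : Store} (h1 : TmpEq t σ σ') (hr : Rel h σ) :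
    Rel h σ' := by
  obtain ⟨e1, e2⟩ := h1
  refine ⟨fun x => ?_, fun x => ?_, fun x => ?_, ?_, ?_, ?_⟩
  · rw [e2 _ (by omega)]; exact hr.n x
  · rw [e2 _ (by omega), e2 _ (by omega)]; exact hr.w x
  · rw [e2 _ (by omega)]; exact hr.p x
  · rw [e1]; exact hr.A
  · rw [e1]; exact hr.W
  · rw [e1]; exact hr.pa

@[simp] theorem setScalar_self (σ : State) (x : ℕ) (v : ℝ) : (σ.setScalar x v).scalar x = v := by
  simp [State.setScalar]

theorem setScalar_ne (σ : State) {x y : ℕ} (v : ℝ) (h : y ≠ x) :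
    (σ.setScalar x v).scalar y = σ.scalar y := by
  simp [State.setScalar, h]

@[simp] theorem setScalar_array (σ : State) (x : ℕ) (v : ℝ) :
    (σ.setScalar x v).array = σ.array := rfl

@[simp] theorem setCell_scalar (σ : State) (a i : ℕ) (v : ℝ) :
    (σ.setCell a i v).scalar = σ.scalar := rfl

theorem NExp.run {s : ℕ} {h : Store} (e : NExp) (t : ℕ) {σ : State} (hr : Rel h σ)
    (hok : e.ok s h) :
    Run s (e.comp t) σ e.cost (fun σ' => TmpEq t σ σ' ∧ σ'.scalar (tmp t) = e.eval h) := by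
  induction e generalizing t σ with
  | c k => exact Run.const ⟨(TmpEq.refl t σ).set le_rfl _, by simp [NExp.eval]⟩
  | v x => exact Run.copy ⟨(TmpEq.refl t σ).set le_rfl _, by simp [NExp.eval, hr.n]⟩
  | ld a e ih =>
    refine Run.seq' (ih t hr hok.1) fun σ1 ⟨h1, h2⟩ => ?_
    exact Run.load h2 hok.2 ⟨h1.set le_rfl _, by simp [NExp.eval, (h1.rel hr).A]⟩
  | add e f ihe ihf =>
    refine (Run.seq' (ihe t hr hok.1) fun σ1 ⟨h1, h2⟩ => Run.seq' (ihf (t + 1) (h1.rel hr) hok.2)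
      fun σ2 ⟨h3, h4⟩ => Run.add ?_).mono (by simp only [NExp.cost]; omega) fun _ h => h
    refine ⟨(h1.trans h3 (by omega)).set le_rfl _, ?_⟩
    rw [setScalar_self, h4, h3.tmp (by omega), h2]
    simp [NExp.eval]
  | mul e f ihe ihf =>
    refine (Run.seq' (ihe t hr hok.1) fun σ1 ⟨h1, h2⟩ => Run.seq' (ihf (t + 1) (h1.rel hr) hok.2)
      fun σ2 ⟨h3, h4⟩ => Run.mul ?_).mono (by simp only [NExp.cost]; omega) fun _ h => h
    refine ⟨(h1.trans h3 (by omega)).set le_rfl _, ?_⟩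
    rw [setScalar_self, h4, h3.tmp (by omega), h2]
    simp [NExp.eval]
  | sub e f ihe ihf =>
    refine (Run.seq' (ihe t hr hok.1) fun σ1 ⟨h1, h2⟩ => Run.seq' (ihf (t + 1) (h1.rel hr) hok.2)
      fun σ2 ⟨h3, h4⟩ => Run.ite (C := 1) (fun hb => Run.sub ?_) (fun hb => Run.const ?_)).mono
      (by simp only [NExp.cost]; omega) fun _ h => h
    all_goals
      refine ⟨(h1.trans h3 (by omega)).set le_rfl _, ?_⟩
      simp only [Test.Holds] at hb
      rw [h4, h3.tmp (by omega), h2] at hb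
      rw [setScalar_self]
    · rw [h4, h3.tmp (by omega), h2]
      rw [NExp.eval, Nat.cast_sub (by exact_mod_cast hb)]
    · rw [NExp.eval, Nat.sub_eq_zero_of_le (by have : _ ≤ _ := not_lt.1 (fun h => hb (le_of_lt h)); exact_mod_cast this)]
      simp

/-! ### Expressions for extended reals -/

inductive WExp where
  | real (r : ℝ)
  | top
  | v (x : ℕ)
  | ld (a : ℕ) (e : NExp)
  | add (e f : WExp)
  | scale (r : ℝ) (e : WExp)
  | ofN (e : NExp)

noncomputable def WExp.eval (h : Store) : WExp → WithTop ℝ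
  | .real r => r
  | .top => ⊤
  | .v x => h.w x
  | .ld a e => h.W a (e.eval h)
  | .add e f => e.eval h + f.eval h
  | .scale r e => (e.eval h).map (fun x => r * x)
  | .ofN e => ((e.eval h : ℝ) : WithTop ℝ)

def WExp.ok (s : ℕ) (h : Store) : WExp → Prop
  | .real _ => True
  | .top => True
  | .v _ => True
  | .ld _ e => e.ok s h ∧ e.eval h < s
  | .add e f => e.ok s h ∧ f.ok s h
  | .scale _ e => e.ok s h
  | .ofN e => e.ok s h

def WExp.cost : WExp → ℕ
  | .real _ => 2
  | .top => 2
  | .v _ => 2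
  | .ld _ e => e.cost + 2
  | .add e f => e.cost + f.cost + 2
  | .scale _ e => e.cost + 2
  | .ofN e => e.cost + 1

/-- An extended real occupies two consecutive temporaries, a flag for finiteness and a value.
Addition multiplies the flags, so that `⊤` absorbs. A load fetches the value before the flag,
because the flag overwrites the index. -/
noncomputable def WExp.comp : WExp → ℕ → Program
  | .real r, t => .seq (.const (tmp t) 1) (.const (tmp (t + 1)) r)
  | .top, t => .seq (.const (tmp t) 0) (.const (tmp (t + 1)) 0)
  | .v x, t => .seq (.copy (tmp t) (5 * x + 1)) (.copy (tmp (t + 1)) (5 * x + 2))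
  | .ld a e, t => .seq (e.comp t) (.seq (.load (tmp (t + 1)) (4 * a + 2) (tmp t))
      (.load (tmp t) (4 * a + 1) (tmp t)))
  | .add e f, t => .seq (e.comp t) (.seq (f.comp (t + 2))
      (.seq (.mul (tmp t) (tmp t) (tmp (t + 2)))
        (.add (tmp (t + 1)) (tmp (t + 1)) (tmp (t + 2 + 1)))))
  | .scale r e, t => .seq (e.comp t) (.seq (.const (tmp (t + 2)) r)
      (.mul (tmp (t + 1)) (tmp (t + 2)) (tmp (t + 1))))
  | .ofN e, t => .seq (e.comp (t + 1)) (.const (tmp t) 1)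

theorem WExp.run {s : ℕ} {h : Store} (e : WExp) (t : ℕ) {σ : State} (hr : Rel h σ)
    (hok : e.ok s h) :
    Run s (e.comp t) σ e.cost (fun σ' => TmpEq t σ σ' ∧
      Enc (σ'.scalar (tmp t)) (σ'.scalar (tmp (t + 1))) (e.eval h)) := by
  induction e generalizing t σ with
  | real r =>
    refine Run.seq (Run.const (Run.const ⟨((TmpEq.refl t σ).set le_rfl _).set (by omega) _, ?_⟩))
    rw [setScalar_self, setScalar_ne _ _ (by unfold tmp; omega), setScalar_self]
    exact Or.inr ⟨rfl, rfl⟩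
  | top =>
    refine Run.seq (Run.const (Run.const ⟨((TmpEq.refl t σ).set le_rfl _).set (by omega) _, ?_⟩))
    rw [setScalar_self, setScalar_ne _ _ (by unfold tmp; omega), setScalar_self]
    exact Or.inl ⟨rfl, rfl⟩
  | v x =>
    refine Run.seq (Run.copy (Run.copy ⟨((TmpEq.refl t σ).set le_rfl _).set (by omega) _, ?_⟩))
    rw [setScalar_self, setScalar_ne _ _ (by unfold tmp; omega), setScalar_self,
      setScalar_ne _ _ (by unfold tmp; omega)]
    exact hr.w x
  | ld a e =>
    refine Run.seq' (e.run t hr hok.1) fun σ1 ⟨h1, h2⟩ => Run.seq (Run.load h2 hok.2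
      (Run.load (i := e.eval h) ?_ hok.2 ⟨(h1.set (by omega) _).set le_rfl _, ?_⟩))
    · rw [setScalar_ne _ _ (by unfold tmp; omega), h2]
    · rw [setScalar_self, setScalar_ne _ _ (by unfold tmp; omega), setScalar_self]
      exact (h1.rel hr).W a _
  | add e f ihe ihf =>
    refine (Run.seq' (ihe t hr hok.1) fun σ1 ⟨h1, h2⟩ => Run.seq' (ihf (t + 2) (h1.rel hr) hok.2)
      fun σ2 ⟨h3, h4⟩ => Run.seq (Run.mul (Run.add ⟨?_, ?_⟩))).mono
      (by simp only [WExp.cost]; omega) fun _ h => h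
    · exact ((h1.trans h3 (by omega)).set le_rfl _).set (by omega) _
    · rw [setScalar_self, setScalar_ne _ _ (by unfold tmp; omega), setScalar_self,
        setScalar_ne _ _ (by unfold tmp; omega), setScalar_ne _ _ (by unfold tmp; omega),
        h3.tmp (u := t) (by omega), h3.tmp (u := t + 1) (by omega)]
      rcases h2 with ⟨a1, a2⟩ | ⟨a1, a2⟩
      · exact Or.inl ⟨by rw [a1, zero_mul], by rw [WExp.eval, a2, top_add]⟩
      · rcases h4 with ⟨b1, b2⟩ | ⟨b1, b2⟩
        · exact Or.inl ⟨by rw [b1, mul_zero], by rw [WExp.eval, b2, add_top]⟩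
        · exact Or.inr ⟨by rw [a1, b1, mul_one], by rw [WExp.eval, a2, b2, WithTop.coe_add]⟩
  | scale r e ih =>
    refine (Run.seq' (ih t hr hok) fun σ1 ⟨h1, h2⟩ => Run.seq (Run.const (Run.mul ⟨?_, ?_⟩))).mono
      (by simp only [WExp.cost]; omega) fun _ h => h
    · exact (h1.set (by omega) _).set (by omega) _
    · rw [setScalar_self, setScalar_ne _ _ (by unfold tmp; omega), setScalar_self,
        setScalar_ne _ _ (by unfold tmp; omega), setScalar_ne _ _ (by unfold tmp; omega)]
      rcases h2 with ⟨a1, a2⟩ | ⟨a1, a2⟩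
      · exact Or.inl ⟨a1, by rw [WExp.eval, a2]; rfl⟩
      · exact Or.inr ⟨a1, by rw [WExp.eval, a2]; rfl⟩
  | ofN e =>
    refine Run.seq' (e.run (t + 1) hr hok) fun σ1 ⟨h1, h2⟩ => Run.const ⟨?_, ?_⟩
    · exact ((TmpEq.refl t σ).trans h1 (by omega)).set le_rfl _
    · rw [setScalar_self, setScalar_ne _ _ (by unfold tmp; omega), h2]
      exact Or.inr ⟨rfl, rfl⟩

/-! ### Tests -/

inductive BExp where
  | lt (e f : NExp)
  | eq (e f : NExp)
  | wle (e f : WExp)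
  | and (b c : BExp)
  | not (b : BExp)

def BExp.eval (h : Store) : BExp → Prop
  | .lt e f => e.eval h < f.eval h
  | .eq e f => e.eval h = f.eval h
  | .wle e f => e.eval h ≤ f.eval h
  | .and b c => b.eval h ∧ c.eval h
  | .not b => ¬ b.eval h

def BExp.ok (s : ℕ) (h : Store) : BExp → Prop
  | .lt e f => e.ok s h ∧ f.ok s h
  | .eq e f => e.ok s h ∧ f.ok s h
  | .wle e f => e.ok s h ∧ f.ok s h
  | .and b c => b.ok s h ∧ c.ok s h
  | .not b => b.ok s h

def BExp.cost : BExp → ℕ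
  | .lt e f => e.cost + f.cost + 2
  | .eq e f => e.cost + f.cost + 2
  | .wle e f => e.cost + f.cost + 5
  | .and b c => b.cost + c.cost + 1
  | .not b => b.cost + 2

/-- Truth values are the numbers 0 and 1, conjunction is a product and negation is subtraction from
1. In `wle` both flags are inspected before the values, since the value stored with `⊤` is
arbitrary. -/
noncomputable def BExp.comp : BExp → ℕ → Program
  | .lt e f, t => .seq (e.comp t) (.seq (f.comp (t + 1))
      (.ite (.lt (tmp t) (tmp (t + 1))) (.const (tmp t) 1) (.const (tmp t) 0)))
  | .eq e f, t => .seq (e.comp t) (.seq (f.comp (t + 1))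
      (.ite (.eq (tmp t) (tmp (t + 1))) (.const (tmp t) 1) (.const (tmp t) 0)))
  | .wle e f, t => .seq (e.comp t) (.seq (f.comp (t + 2)) (.seq (.const (tmp (t + 4)) 0)
      (.ite (.eq (tmp (t + 2)) (tmp (t + 4))) (.const (tmp t) 1)
        (.ite (.eq (tmp t) (tmp (t + 4))) (.const (tmp t) 0)
          (.ite (.le (tmp (t + 1)) (tmp (t + 2 + 1))) (.const (tmp t) 1) (.const (tmp t) 0))))))
  | .and b c, t => .seq (b.comp t) (.seq (c.comp (t + 1)) (.mul (tmp t) (tmp t) (tmp (t + 1))))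
  | .not b, t => .seq (b.comp t) (.seq (.const (tmp (t + 1)) 1)
      (.sub (tmp t) (tmp (t + 1)) (tmp t)))

open Classical in
theorem BExp.run {s : ℕ} {h : Store} (b : BExp) (t : ℕ) {σ : State} (hr : Rel h σ)
    (hok : b.ok s h) :
    Run s (b.comp t) σ b.cost (fun σ' => TmpEq t σ σ' ∧
      σ'.scalar (tmp t) = if b.eval h then 1 else 0) := by
  induction b generalizing t σ with
  | lt e f =>
    refine (Run.seq' (e.run t hr hok.1) fun σ1 ⟨h1, h2⟩ =>
      Run.seq' (f.run (t + 1) (h1.rel hr) hok.2) fun σ2 ⟨h3, h4⟩ =>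
      Run.ite (C := 1) (fun hb => Run.const ?_) (fun hb => Run.const ?_)).mono
      (by simp only [BExp.cost]; omega) fun _ h => h
    all_goals
      simp only [Test.Holds] at hb
      rw [h4, h3.tmp (by omega), h2, Nat.cast_lt] at hb
      exact ⟨(h1.trans h3 (by omega)).set le_rfl _, by simp [BExp.eval, hb]⟩
  | eq e f =>
    refine (Run.seq' (e.run t hr hok.1) fun σ1 ⟨h1, h2⟩ =>
      Run.seq' (f.run (t + 1) (h1.rel hr) hok.2) fun σ2 ⟨h3, h4⟩ =>
      Run.ite (C := 1) (fun hb => Run.const ?_) (fun hb => Run.const ?_)).mono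
      (by simp only [BExp.cost]; omega) fun _ h => h
    all_goals
      simp only [Test.Holds] at hb
      rw [h4, h3.tmp (by omega), h2, Nat.cast_inj] at hb
      exact ⟨(h1.trans h3 (by omega)).set le_rfl _, by simp [BExp.eval, hb]⟩
  | wle e f =>
    refine (Run.seq' (e.run t hr hok.1) fun σ1 ⟨h1, h2⟩ =>
      Run.seq' (f.run (t + 2) (h1.rel hr) hok.2) fun σ2 ⟨h3, h4⟩ => Run.seq (Run.const
      (Run.ite (C := 3) (fun hb => (Run.const ?_).mono (by omega : 1 ≤ 3) fun _ h => h)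
        (fun hb => Run.ite (C := 2) (fun hb' => (Run.const ?_).mono (by omega : 1 ≤ 2) fun _ h => h)
          (fun hb' => Run.ite (C := 1) (fun hb'' => Run.const ?_) (fun hb'' => Run.const ?_)))))).mono
      (by simp only [BExp.cost]; omega) fun _ h => h
    all_goals
      refine ⟨((h1.trans h3 (by omega)).set (by omega) _).set le_rfl _, ?_⟩
      rw [setScalar_self]
      simp only [BExp.eval]
      simp only [Test.Holds] at hb
      try simp only [Test.Holds] at hb'
      try simp only [Test.Holds] at hb''
      rw [setScalar_self, setScalar_ne _ _ (by unfold tmp; omega)] at hb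
      try rw [setScalar_self, setScalar_ne _ _ (by unfold tmp; omega), h3.tmp (by omega)] at hb'
      try rw [setScalar_ne _ _ (by unfold tmp; omega), setScalar_ne _ _ (by unfold tmp; omega),
        h3.tmp (by omega)] at hb''
    · rcases h4 with ⟨b1, b2⟩ | ⟨b1, b2⟩
      · simp [b2]
      · rw [b1] at hb; norm_num at hb
    · rcases h2 with ⟨b1, b2⟩ | ⟨b1, b2⟩
      · rcases h4 with ⟨c1, c2⟩ | ⟨c1, c2⟩
        · exact absurd c1 hb
        · simp [b2, c2]
      · rw [b1] at hb'; norm_num at hb'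
    · rcases h2 with ⟨b1, b2⟩ | ⟨b1, b2⟩
      · exact absurd b1 hb'
      · rcases h4 with ⟨c1, c2⟩ | ⟨c1, c2⟩
        · exact absurd c1 hb
        · exact (if_pos (by rw [b2, c2]; exact WithTop.coe_le_coe.2 hb'')).symm
    · rcases h2 with ⟨b1, b2⟩ | ⟨b1, b2⟩
      · exact absurd b1 hb'
      · rcases h4 with ⟨c1, c2⟩ | ⟨c1, c2⟩
        · exact absurd c1 hb
        · exact (if_neg (fun h => hb'' (by rw [b2, c2] at h; exact WithTop.coe_le_coe.1 h))).symm
  | and b c ihb ihc =>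
    refine (Run.seq' (ihb t hr hok.1) fun σ1 ⟨h1, h2⟩ => Run.seq' (ihc (t + 1) (h1.rel hr) hok.2)
      fun σ2 ⟨h3, h4⟩ => Run.mul ?_).mono (by simp only [BExp.cost]; omega) fun _ h => h
    refine ⟨(h1.trans h3 (by omega)).set le_rfl _, ?_⟩
    rw [setScalar_self, h4, h3.tmp (by omega), h2]
    by_cases hb : b.eval h <;> by_cases hc : c.eval h <;> simp [BExp.eval, hb, hc]
  | not b ih =>
    refine (Run.seq' (ih t hr hok) fun σ1 ⟨h1, h2⟩ => Run.seq (Run.const (Run.sub ⟨?_, ?_⟩))).mono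
      (by simp only [BExp.cost]; omega) fun _ h => h
    · exact (h1.set (by omega) _).set (by omega) _
    · rw [setScalar_self, setScalar_self, setScalar_ne _ _ (by unfold tmp; omega), h2]
      by_cases hb : b.eval h <;> simp [BExp.eval, hb]

end TreeDP


/-! ### Commands, their compilation and their running time -/

namespace TreeDP

open RealRAM

inductive Cmd where
  | skip
  | setN (x : ℕ) (e : NExp)
  | stN (a : ℕ) (i e : NExp)
  | setW (x : ℕ) (e : WExp)
  | stW (a : ℕ) (i : NExp) (e : WExp)
  | setP (x : ℕ) (e : NExp)
  | stP (a : ℕ) (i e : NExp)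
  | call (y : ℕ)
  | seq (P Q : Cmd)
  | ite (b : BExp) (P Q : Cmd)
  | loop (x : ℕ) (e : NExp) (P : Cmd)

/-- Compilation to the real RAM; `P₀` is the subroutine run by `call`. -/
noncomputable def Cmd.comp (P₀ : Program) : Cmd → ℕ → Program
  | .skip, _ => .skip
  | .setN x e, t => .seq (e.comp t) (.copy (5 * x) (tmp t))
  | .stN a i e, t => .seq (i.comp t) (.seq (e.comp (t + 1)) (.store (4 * a) (tmp t) (tmp (t + 1))))
  | .setW x e, t => .seq (e.comp t)
      (.seq (.copy (5 * x + 1) (tmp t)) (.copy (5 * x + 2) (tmp (t + 1))))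
  | .stW a i e, t => .seq (i.comp t) (.seq (e.comp (t + 1))
      (.seq (.store (4 * a + 1) (tmp t) (tmp (t + 1)))
        (.store (4 * a + 2) (tmp t) (tmp (t + 1 + 1)))))
  | .setP x e, t => .seq (e.comp t) (.copy (5 * x + 4) (tmp t))
  | .stP a i e, t => .seq (i.comp t) (.seq (e.comp (t + 1))
      (.store (4 * a + 3) (tmp t) (tmp (t + 1))))
  -- Scalar 4 is the renamed scalar 0, where the subroutine leaves its output; the flag 1 marks the
  -- result as finite.
  | .call y, _ => .seq P₀.rename (.seq (.const (5 * y + 1) 1) (.copy (5 * y + 2) 4))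
  | .seq P Q, t => .seq (P.comp P₀ t) (Q.comp P₀ t)
  | .ite b P Q, t => .seq (b.comp t) (.seq (.const (tmp (t + 1)) 0)
      (.ite (.ne (tmp t) (tmp (t + 1))) (P.comp P₀ t) (Q.comp P₀ t)))
  -- The bound is evaluated once. Bound and counter sit below the height `t + 2` at which the body
  -- is compiled, and the variable `x` is only a copy of the counter, so the body cannot change the
  -- number of rounds.
  | .loop x e P, t => .seq (e.comp t) (.seq (.const (tmp (t + 1)) 0)
      (.loop (.lt (tmp (t + 1)) (tmp t)) (.seq (.copy (5 * x) (tmp (t + 1)))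
        (.seq (P.comp P₀ (t + 2)) (.seq (.const (tmp (t + 2)) 1)
          (.add (tmp (t + 1)) (tmp (t + 1)) (tmp (t + 2))))))))

/-- A bound for the running time if all loops and the subroutine take at most `M` rounds. -/
def Cmd.bound (M : ℕ) : Cmd → ℕ
  | .skip => 1
  | .setN _ e => e.cost + 1
  | .stN _ i e => i.cost + e.cost + 1
  | .setW _ e => e.cost + 2
  | .stW _ i e => i.cost + e.cost + 2
  | .setP _ e => e.cost + 1
  | .stP _ i e => i.cost + e.cost + 1
  | .call _ => M + 2
  | .seq P Q => P.bound M + Q.bound M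
  | .ite b P Q => b.cost + (P.bound M + Q.bound M) + 2
  -- Each round adds the test, the copy of the counter and two steps for its increment. The final 2
  -- is for resetting the counter and for the last test.
  | .loop _ e P => e.cost + M * (P.bound M + 4) + 2

/-- The bound is polynomial in `M`. -/
theorem Cmd.bound_le (P : Cmd) : ∃ C D : ℕ, ∀ M, 1 ≤ M → P.bound M ≤ C * M ^ D := by
  induction P with
  | skip => exact ⟨1, 0, fun M _ => by simp [bound]⟩
  | setN x e => exact ⟨e.cost + 1, 0, fun M _ => by simp [bound]⟩
  | stN a i e => exact ⟨i.cost + e.cost + 1, 0, fun M _ => by simp [bound]⟩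
  | setW x e => exact ⟨e.cost + 2, 0, fun M _ => by simp [bound]⟩
  | stW a i e => exact ⟨i.cost + e.cost + 2, 0, fun M _ => by simp [bound]⟩
  | setP x e => exact ⟨e.cost + 1, 0, fun M _ => by simp [bound]⟩
  | stP a i e => exact ⟨i.cost + e.cost + 1, 0, fun M _ => by simp [bound]⟩
  | call y => exact ⟨3, 1, fun M hM => by simp only [bound, pow_one]; omega⟩
  | seq P Q ihP ihQ =>
    obtain ⟨C1, D1, h1⟩ := ihP
    obtain ⟨C2, D2, h2⟩ := ihQ
    refine ⟨C1 + C2, D1 + D2, fun M hM => ?_⟩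
    have h3 : M ^ D1 ≤ M ^ (D1 + D2) := Nat.pow_le_pow_right hM (by omega)
    have h4 : M ^ D2 ≤ M ^ (D1 + D2) := Nat.pow_le_pow_right hM (by omega)
    simp only [bound]
    calc _ ≤ C1 * M ^ D1 + C2 * M ^ D2 := add_le_add (h1 M hM) (h2 M hM)
      _ ≤ C1 * M ^ (D1 + D2) + C2 * M ^ (D1 + D2) := by gcongr
      _ = _ := by ring
  | ite b P Q ihP ihQ =>
    obtain ⟨C1, D1, h1⟩ := ihP
    obtain ⟨C2, D2, h2⟩ := ihQ
    refine ⟨b.cost + (C1 + C2) + 2, D1 + D2, fun M hM => ?_⟩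
    have h3 : M ^ D1 ≤ M ^ (D1 + D2) := Nat.pow_le_pow_right hM (by omega)
    have h4 : M ^ D2 ≤ M ^ (D1 + D2) := Nat.pow_le_pow_right hM (by omega)
    have h5 : 1 ≤ M ^ (D1 + D2) := Nat.one_le_pow _ _ hM
    simp only [bound]
    calc _ ≤ b.cost * 1 + (C1 * M ^ D1 + C2 * M ^ D2) + 2 * 1 := by
          have := h1 M hM
          have := h2 M hM
          omega
      _ ≤ b.cost * M ^ (D1 + D2) + (C1 * M ^ (D1 + D2) + C2 * M ^ (D1 + D2))
          + 2 * M ^ (D1 + D2) := by gcongr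
      _ = _ := by ring
  | loop x e P ihP =>
    obtain ⟨C1, D1, h1⟩ := ihP
    refine ⟨e.cost + C1 + 6, D1 + 1, fun M hM => ?_⟩
    have h4 : M * 1 ≤ M ^ (D1 + 1) := by
      rw [pow_succ, mul_comm]
      exact Nat.mul_le_mul_right _ (Nat.one_le_pow _ _ hM)
    have h5 : 1 ≤ M ^ (D1 + 1) := Nat.one_le_pow _ _ hM
    simp only [bound]
    calc _ ≤ e.cost * 1 + M * (C1 * M ^ D1 + 4) + 2 * 1 := by
          have := h1 M hM
          gcongr; omega
      _ = e.cost * 1 + C1 * M ^ (D1 + 1) + 4 * (M * 1) + 2 * 1 := by ring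
      _ ≤ e.cost * M ^ (D1 + 1) + C1 * M ^ (D1 + 1) + 4 * M ^ (D1 + 1)
          + 2 * M ^ (D1 + 1) := by gcongr
      _ = _ := by ring

/-! ### Weakest preconditions and their soundness -/

/-- The resources: space, bound for the number of rounds of a loop, and the specification of the
subroutine, where `ret h v` says that it returns `v` when called in `h`. -/
structure Env where
  s : ℕ
  M : ℕ
  ret : Store → ℝ → Prop

/-- `rounds W x Q r i h`: the rounds `i, …, i + r - 1` of a loop with counter `x`. -/
def rounds (W : (Store → Prop) → Store → Prop) (x : ℕ) (Q : Store → Prop) :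
    ℕ → ℕ → Store → Prop
  | 0, _, h => Q h
  | r + 1, i, h => W (rounds W x Q r (i + 1)) (h.setN x i)

/-- The weakest precondition. -/
def wp (E : Env) : Cmd → (Store → Prop) → Store → Prop
  | .skip, Q, h => Q h
  | .setN x e, Q, h => e.ok E.s h ∧ Q (h.setN x (e.eval h))
  | .stN a i e, Q, h =>
      (i.ok E.s h ∧ i.eval h < E.s) ∧ e.ok E.s h ∧ Q (h.stN a (i.eval h) (e.eval h))
  | .setW x e, Q, h => e.ok E.s h ∧ Q (h.setW x (e.eval h))
  | .stW a i e, Q, h =>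
      (i.ok E.s h ∧ i.eval h < E.s) ∧ e.ok E.s h ∧ Q (h.stW a (i.eval h) (e.eval h))
  | .setP x e, Q, h => e.ok E.s h ∧ Q (h.setP x (e.eval h))
  | .stP a i e, Q, h =>
      (i.ok E.s h ∧ i.eval h < E.s) ∧ e.ok E.s h ∧ Q (h.stP a (i.eval h) (e.eval h))
  -- Nothing is assumed about the memory of the subroutine after it has returned.
  | .call y, Q, h => ∃ v, E.ret h v ∧ ∀ p pa, Q (({ h with p := p, pa := pa } : Store).setW y v)
  | .seq P P', Q, h => wp E P (wp E P' Q) h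
  | .ite b P P', Q, h => b.ok E.s h ∧ (b.eval h → wp E P Q h) ∧ (¬ b.eval h → wp E P' Q h)
  | .loop x e P, Q, h => e.ok E.s h ∧ e.eval h ≤ E.M ∧ rounds (wp E P) x Q (e.eval h) 0 h

/-- What `P₀` has to do for `wp` to be sound. -/
def Env.Sound (E : Env) (P₀ : Program) : Prop :=
  ∀ h v σ, E.ret h v → Rel h σ →
    Run E.s P₀.rename σ E.M (fun σ' => SameOutside σ σ' ∧ σ'.scalar 4 = v)

theorem Rel.setN {h : Store} {σ : State} (hr : Rel h σ) (x v : ℕ) :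
    Rel (h.setN x v) (σ.setScalar (5 * x) v) := by
  refine ⟨fun y => ?_, fun y => ?_, fun y => ?_, hr.A, hr.W, hr.pa⟩
  · simp only [Store.setN, Function.update_apply]
    split_ifs with hy
    · rw [hy, setScalar_self]
    · rw [setScalar_ne _ _ (by omega)]; exact hr.n y
  · rw [setScalar_ne _ _ (by omega), setScalar_ne _ _ (by omega)]; exact hr.w y
  · rw [setScalar_ne _ _ (by omega)]; exact hr.p y

theorem Rel.setP {h : Store} {σ : State} (hr : Rel h σ) (x : ℕ) (v : ℝ) :
    Rel (h.setP x v) (σ.setScalar (5 * x + 4) v) := by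
  refine ⟨fun y => ?_, fun y => ?_, fun y => ?_, hr.A, hr.W, hr.pa⟩
  · rw [setScalar_ne _ _ (by omega)]; exact hr.n y
  · rw [setScalar_ne _ _ (by omega), setScalar_ne _ _ (by omega)]; exact hr.w y
  · simp only [Store.setP, Function.update_apply]
    split_ifs with hy
    · rw [hy, setScalar_self]
    · rw [setScalar_ne _ _ (by omega)]; exact hr.p y

theorem Rel.setW {h : Store} {σ : State} (hr : Rel h σ) (x : ℕ) {f v : ℝ} {w : WithTop ℝ}
    (hw : Enc f v w) : Rel (h.setW x w) ((σ.setScalar (5 * x + 1) f).setScalar (5 * x + 2) v) := by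
  refine ⟨fun y => ?_, fun y => ?_, fun y => ?_, hr.A, hr.W, hr.pa⟩
  · rw [setScalar_ne _ _ (by omega), setScalar_ne _ _ (by omega)]; exact hr.n y
  · simp only [Store.setW, Function.update_apply]
    split_ifs with hy
    · rw [hy, setScalar_self, setScalar_ne _ _ (by omega), setScalar_self]; exact hw
    · rw [setScalar_ne _ _ (by omega), setScalar_ne _ _ (by omega), setScalar_ne _ _ (by omega),
        setScalar_ne _ _ (by omega)]
      exact hr.w y
  · rw [setScalar_ne _ _ (by omega), setScalar_ne _ _ (by omega)]; exact hr.p y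

theorem setCell_ne (σ : State) {a b : ℕ} (i : ℕ) (v : ℝ) (h : b ≠ a) :
    (σ.setCell a i v).array b = σ.array b := by simp [State.setCell, h]

theorem setCell_self (σ : State) (a i j : ℕ) (v : ℝ) :
    (σ.setCell a i v).array a j = if j = i then v else σ.array a j := by
  simp [State.setCell, Function.update_apply]

theorem Rel.stN {h : Store} {σ : State} (hr : Rel h σ) (a i v : ℕ) :
    Rel (h.stN a i v) (σ.setCell (4 * a) i v) := by
  refine ⟨hr.n, hr.w, hr.p, fun b j => ?_, fun b j => ?_, fun b j => ?_⟩
  · simp only [Store.stN, Function.update_apply]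
    split_ifs with hy
    · rw [hy, setCell_self, Function.update_apply]
      split_ifs
      · rfl
      · exact hr.A a j
    · rw [setCell_ne _ _ _ (by omega)]; exact hr.A b j
  · rw [setCell_ne _ _ _ (by omega), setCell_ne _ _ _ (by omega)]; exact hr.W b j
  · rw [setCell_ne _ _ _ (by omega)]; exact hr.pa b j

theorem Rel.stP {h : Store} {σ : State} (hr : Rel h σ) (a i : ℕ) (v : ℝ) :
    Rel (h.stP a i v) (σ.setCell (4 * a + 3) i v) := by
  refine ⟨hr.n, hr.w, hr.p, fun b j => ?_, fun b j => ?_, fun b j => ?_⟩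
  · rw [setCell_ne _ _ _ (by omega)]; exact hr.A b j
  · rw [setCell_ne _ _ _ (by omega), setCell_ne _ _ _ (by omega)]; exact hr.W b j
  · simp only [Store.stP, Function.update_apply]
    split_ifs with hy
    · rw [hy, setCell_self, Function.update_apply]
      split_ifs
      · rfl
      · exact hr.pa a j
    · rw [setCell_ne _ _ _ (by omega)]; exact hr.pa b j

theorem Rel.stW {h : Store} {σ : State} (hr : Rel h σ) (a i : ℕ) {f v : ℝ} {w : WithTop ℝ}
    (hw : Enc f v w) :
    Rel (h.stW a i w) ((σ.setCell (4 * a + 1) i f).setCell (4 * a + 2) i v) := by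
  refine ⟨hr.n, hr.w, hr.p, fun b j => ?_, fun b j => ?_, fun b j => ?_⟩
  · rw [setCell_ne _ _ _ (by omega), setCell_ne _ _ _ (by omega)]; exact hr.A b j
  · simp only [Store.stW, Function.update_apply]
    split_ifs with hy
    · rw [hy, setCell_self, setCell_ne _ _ _ (by omega), setCell_self, Function.update_apply,
        setCell_ne _ _ _ (by omega)]
      split_ifs
      · exact hw
      · exact hr.W a j
    · rw [setCell_ne _ _ _ (by omega), setCell_ne _ _ _ (by omega), setCell_ne _ _ _ (by omega),
        setCell_ne _ _ _ (by omega)]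
      exact hr.W b j
  · rw [setCell_ne _ _ _ (by omega), setCell_ne _ _ _ (by omega)]; exact hr.pa b j

/-- The typed part of the store sits in the residue classes that a call leaves alone; the new
contents of the subroutine's memory are read off from the state. -/
theorem exists_rel_of_sameOutside {h : Store} {σ σ' : State} (ho : SameOutside σ σ') (hr : Rel h σ) :
    ∃ p pa, Rel { h with p := p, pa := pa } σ' := by
  refine ⟨fun x => σ'.scalar (5 * x + 4), fun a => σ'.array (4 * a + 3), fun x => ?_, fun x => ?_,
    fun x => rfl, fun a i => ?_, fun a i => ?_, fun a i => rfl⟩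
  · rw [ho.scalar _ (by omega)]; exact hr.n x
  · rw [ho.scalar _ (by omega), ho.scalar _ (by omega)]; exact hr.w x
  · rw [ho.array _ (by omega)]; exact hr.A a i
  · rw [ho.array _ (by omega), ho.array _ (by omega)]; exact hr.W a i

/-- The postcondition of compiled code: the store satisfies `Q` and the intermediate results below
`t` are kept. -/
def Done (t : ℕ) (σ : State) (Q : Store → Prop) (σ' : State) : Prop :=
  (∃ h', Rel h' σ' ∧ Q h') ∧ ∀ u < t, σ'.scalar (tmp u) = σ.scalar (tmp u)

theorem Done.of_tmpEq {t : ℕ} {σ σ1 σ' : State} {Q : Store → Prop} (h1 : TmpEq t σ σ1)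
    (h : Done t σ1 Q σ') : Done t σ Q σ' :=
  ⟨h.1, fun u hu => (h.2 u hu).trans (h1.tmp hu)⟩

/-- Soundness of `wp` for compiled code, with the time bound. That lower temporaries survive is part
of the induction, because the counter and bound of an enclosing loop live there. -/
theorem Cmd.run {E : Env} {P₀ : Program} (hE : E.Sound P₀) (P : Cmd) (t : ℕ) {h : Store}
    {σ : State} {Q : Store → Prop} (hr : Rel h σ) (hw : wp E P Q h) :
    Run E.s (P.comp P₀ t) σ (P.bound E.M) (Done t σ Q) := by
  induction P generalizing t h σ Q with
  | skip => exact ⟨1, σ, .skip σ, le_rfl, ⟨h, hr, hw⟩, fun _ _ => rfl⟩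
  | setN x e =>
    refine Run.seq' (e.run t hr hw.1) fun σ1 ⟨h1, h2⟩ => Run.copy
      (Done.of_tmpEq h1 ⟨⟨_, ?_, hw.2⟩, fun u hu => ?_⟩)
    · rw [h2]; exact (h1.rel hr).setN x _
    · rw [setScalar_ne _ _ (by unfold tmp; omega)]
  | setP x e =>
    refine Run.seq' (e.run t hr hw.1) fun σ1 ⟨h1, h2⟩ => Run.copy
      (Done.of_tmpEq h1 ⟨⟨_, ?_, hw.2⟩, fun u hu => ?_⟩)
    · rw [h2]; exact (h1.rel hr).setP x _
    · rw [setScalar_ne _ _ (by unfold tmp; omega)]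
  | setW x e =>
    refine Run.seq' (e.run t hr hw.1) fun σ1 ⟨h1, h2⟩ => Run.seq (Run.copy (Run.copy
      (Done.of_tmpEq h1 ⟨⟨_, ?_, hw.2⟩, fun u hu => ?_⟩)))
    · rw [setScalar_ne _ (x := 5 * x + 1) (y := tmp (t + 1)) _ (by unfold tmp; omega)]
      exact (h1.rel hr).setW x h2
    · rw [setScalar_ne _ _ (by unfold tmp; omega), setScalar_ne _ _ (by unfold tmp; omega)]
  | stN a i e =>
    refine (Run.seq' (i.run t hr hw.1.1) fun σ1 ⟨h1, h2⟩ =>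
      Run.seq' (e.run (t + 1) (h1.rel hr) hw.2.1) fun σ2 ⟨h3, h4⟩ =>
      Run.store (i := i.eval h) (by rw [h3.tmp (by omega), h2]) hw.1.2
      (Done.of_tmpEq (h1.trans h3 (by omega)) ⟨⟨_, ?_, hw.2.2⟩, fun u hu => rfl⟩)).mono
      (by simp only [bound]; omega) fun _ h => h
    rw [h4]; exact (h3.rel (h1.rel hr)).stN a _ _
  | stP a i e =>
    refine (Run.seq' (i.run t hr hw.1.1) fun σ1 ⟨h1, h2⟩ =>
      Run.seq' (e.run (t + 1) (h1.rel hr) hw.2.1) fun σ2 ⟨h3, h4⟩ =>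
      Run.store (i := i.eval h) (by rw [h3.tmp (by omega), h2]) hw.1.2
      (Done.of_tmpEq (h1.trans h3 (by omega)) ⟨⟨_, ?_, hw.2.2⟩, fun u hu => rfl⟩)).mono
      (by simp only [bound]; omega) fun _ h => h
    rw [h4]; exact (h3.rel (h1.rel hr)).stP a _ _
  | stW a i e =>
    refine (Run.seq' (i.run t hr hw.1.1) fun σ1 ⟨h1, h2⟩ =>
      Run.seq' (e.run (t + 1) (h1.rel hr) hw.2.1) fun σ2 ⟨h3, h4⟩ =>
      Run.seq (Run.store (i := i.eval h) (by rw [h3.tmp (by omega), h2]) hw.1.2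
      (Run.store (i := i.eval h) (by rw [setCell_scalar, h3.tmp (by omega), h2]) hw.1.2
      (Done.of_tmpEq (h1.trans h3 (by omega)) ⟨⟨_, ?_, hw.2.2⟩, fun u hu => rfl⟩)))).mono
      (by simp only [bound]; omega) fun _ h => h
    exact (h3.rel (h1.rel hr)).stW a _ h4
  | call y =>
    obtain ⟨v, h1, h2⟩ := hw
    refine Run.seq' (hE h v σ h1 hr) fun σ1 ⟨ho, hv⟩ => Run.seq (Run.const (Run.copy ?_))
    obtain ⟨p, pa, hr1⟩ := exists_rel_of_sameOutside ho hr
    refine ⟨⟨_, ?_, h2 p pa⟩, fun u hu => ?_⟩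
    · rw [setScalar_ne _ (x := 5 * y + 1) _ (by omega), hv]
      exact hr1.setW y (Or.inr ⟨rfl, rfl⟩)
    · rw [setScalar_ne _ _ (by unfold tmp; omega), setScalar_ne _ _ (by unfold tmp; omega),
        ho.scalar _ (by unfold tmp; omega)]
  | seq P P' ih ih' =>
    refine Run.seq' (ih t hr hw) fun σ1 ⟨⟨h', hr', hw'⟩, h2⟩ => (ih' t hr' hw').mono le_rfl
      fun σ2 h3 => ⟨h3.1, fun u hu => (h3.2 u hu).trans (h2 u hu)⟩
  | ite b P P' ih ih' =>
    refine (Run.seq' (b.run t hr hw.1) fun σ1 ⟨h1, h2⟩ => Run.seq (Run.const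
      (Run.ite (C := P.bound E.M + P'.bound E.M) (fun hb => ?_) fun hb => ?_))).mono
      (by simp only [bound]; omega) fun _ h => h
    all_goals
      have h3 : TmpEq t σ (σ1.setScalar (tmp (t + 1)) 0) := h1.set (by omega) _
      simp only [Test.Holds] at hb
      rw [setScalar_self, setScalar_ne _ _ (by unfold tmp; omega), h2] at hb
    · have hb' : b.eval h := by by_contra hc; simp [hc] at hb
      exact (ih t (h3.rel hr) (hw.2.1 hb')).mono (by omega) fun _ h => h.of_tmpEq h3
    · have hb' : ¬ b.eval h := by intro hc; simp [hc] at hb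
      exact (ih' t (h3.rel hr) (hw.2.2 hb')).mono (by omega) fun _ h => h.of_tmpEq h3
  | loop x e P ih =>
    obtain ⟨hok, hM, hw⟩ := hw
    -- Induction on the number `r` of remaining rounds, where `i` rounds have been made.
    have key : ∀ (r i : ℕ) (h1 : Store) (σ1 : State), Rel h1 σ1 →
        σ1.scalar (tmp t) = ((i + r : ℕ) : ℝ) → σ1.scalar (tmp (t + 1)) = (i : ℝ) →
        rounds (wp E P) x Q r i h1 →
        Run E.s (.loop (.lt (tmp (t + 1)) (tmp t)) (.seq (.copy (5 * x) (tmp (t + 1)))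
          (.seq (P.comp P₀ (t + 2)) (.seq (.const (tmp (t + 2)) 1)
          (.add (tmp (t + 1)) (tmp (t + 1)) (tmp (t + 2))))))) σ1
          (r * (P.bound E.M + 4) + 1) (Done t σ1 Q) := by
      intro r
      induction r with
      | zero =>
        intro i h1 σ1 hr1 hm hi hq
        refine ⟨1, σ1, .loopFalse ?_, by omega, ⟨h1, hr1, hq⟩, fun _ _ => rfl⟩
        simp [Test.Holds, hm, hi]
      | succ r ihr =>
        intro i h1 σ1 hr1 hm hi hq
        have hbody : Run E.s (.seq (.copy (5 * x) (tmp (t + 1)))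
            (.seq (P.comp P₀ (t + 2)) (.seq (.const (tmp (t + 2)) 1)
            (.add (tmp (t + 1)) (tmp (t + 1)) (tmp (t + 2)))))) σ1
            (1 + (P.bound E.M + (1 + 1))) (fun σ2 =>
              (∃ h2, Rel h2 σ2 ∧ rounds (wp E P) x Q r (i + 1) h2) ∧
              (∀ u ≤ t, σ2.scalar (tmp u) = σ1.scalar (tmp u)) ∧
              σ2.scalar (tmp (t + 1)) = ((i + 1 : ℕ) : ℝ)) := by
          refine Run.seq (Run.copy (Run.seq' (ih (t + 2) (h := h1.setN x i)
            (by rw [hi]; exact hr1.setN x i) hq) fun σ2 ⟨⟨h2, hr2, hq2⟩, ht⟩ =>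
            Run.seq (Run.const (Run.add ⟨⟨h2, ?_, hq2⟩, ?_, ?_⟩))))
          · exact (((TmpEq.refl t σ2).set (by omega) _).set (by omega) _).rel hr2
          · intro u hu
            rw [setScalar_ne _ _ (by unfold tmp; omega), setScalar_ne _ _ (by unfold tmp; omega),
              ht u (by omega), setScalar_ne _ _ (by unfold tmp; omega)]
          · rw [setScalar_self, setScalar_self, setScalar_ne _ _ (by unfold tmp; omega),
              ht _ (by omega), setScalar_ne _ _ (by unfold tmp; omega), hi]
            push_cast; ring
        obtain ⟨T, σ2, e2, hT, ⟨h2, hr2, hq2⟩, ht, hi2⟩ := hbody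
        obtain ⟨T', σ3, e3, hT', h3⟩ := ihr (i + 1) h2 σ2 hr2
          (by rw [ht t le_rfl, hm]; congr 1; omega) hi2 hq2
        refine ⟨T + T' + 1, σ3, .loopTrue ?_ e2 e3, ?_, h3.1, fun u hu => ?_⟩
        · simp only [Test.Holds]
          rw [hm, hi]; exact_mod_cast (by omega)
        · rw [Nat.succ_mul]; omega
        · rw [h3.2 u hu, ht u hu.le]
    refine (Run.seq' (e.run t hr hok) fun σ1 ⟨h1, h2⟩ => Run.seq (Run.const
      ((key (e.eval h) 0 h _ ((h1.set (u := t + 1) (by omega) 0).rel hr) ?_ ?_ hw).mono le_rfl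
        fun σ2 hd => hd.of_tmpEq (h1.set (by omega) _)))).mono ?_ fun _ h => h
    · rw [setScalar_ne _ _ (by unfold tmp; omega), h2, zero_add]
    · rw [setScalar_self]; simp
    · simp only [bound]
      have : e.eval h * (P.bound E.M + 4) ≤ E.M * (P.bound E.M + 4) := Nat.mul_le_mul_right _ hM
      omega

/-! ### Rules -/

theorem rounds_mono {W : (Store → Prop) → Store → Prop}
    (hW : ∀ (Q Q' : Store → Prop) h, (∀ h, Q h → Q' h) → W Q h → W Q' h) {x : ℕ}
    {Q Q' : Store → Prop} (hQ : ∀ h, Q h → Q' h) (r i : ℕ) (h : Store)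
    (hr : rounds W x Q r i h) : rounds W x Q' r i h := by
  induction r generalizing i h with
  | zero => exact hQ h hr
  | succ r ih => exact hW _ _ _ (fun h' => ih (i + 1) h') hr

theorem wp_mono {E : Env} (P : Cmd) {Q Q' : Store → Prop} {h : Store} (hw : wp E P Q h)
    (hQ : ∀ h, Q h → Q' h) : wp E P Q' h := by
  induction P generalizing Q Q' h with
  | skip => exact hQ _ hw
  | setN x e => exact ⟨hw.1, hQ _ hw.2⟩
  | setP x e => exact ⟨hw.1, hQ _ hw.2⟩
  | setW x e => exact ⟨hw.1, hQ _ hw.2⟩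
  | stN a i e => exact ⟨hw.1, hw.2.1, hQ _ hw.2.2⟩
  | stP a i e => exact ⟨hw.1, hw.2.1, hQ _ hw.2.2⟩
  | stW a i e => exact ⟨hw.1, hw.2.1, hQ _ hw.2.2⟩
  | call y =>
    obtain ⟨v, h1, h2⟩ := hw
    exact ⟨v, h1, fun p pa => hQ _ (h2 p pa)⟩
  | seq P P' ih ih' => exact ih hw fun h1 h2 => ih' h2 hQ
  | ite b P P' ih ih' => exact ⟨hw.1, fun hb => ih (hw.2.1 hb) hQ, fun hb => ih' (hw.2.2 hb) hQ⟩
  | loop x e P ih =>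
    exact ⟨hw.1, hw.2.1, rounds_mono (W := wp E P) (fun Q Q' h hQ hq => ih hq hQ) hQ _ _ _ hw.2.2⟩

/-- Whether the command may change a natural scalar. -/
def Cmd.mn : Cmd → ℕ → Bool
  | .setN x _, y => y == x
  | .seq P Q, y => P.mn y || Q.mn y
  | .ite _ P Q, y => P.mn y || Q.mn y
  | .loop x _ P, y => y == x || P.mn y
  | _, _ => false

def Cmd.mw : Cmd → ℕ → Bool
  | .setW x _, y => y == x
  | .call x, y => y == x
  | .seq P Q, y => P.mw y || Q.mw y
  | .ite _ P Q, y => P.mw y || Q.mw y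
  | .loop _ _ P, y => P.mw y
  | _, _ => false

def Cmd.mA : Cmd → ℕ → Bool
  | .stN a _ _, y => y == a
  | .seq P Q, y => P.mA y || Q.mA y
  | .ite _ P Q, y => P.mA y || Q.mA y
  | .loop _ _ P, y => P.mA y
  | _, _ => false

def Cmd.mW : Cmd → ℕ → Bool
  | .stW a _ _, y => y == a
  | .seq P Q, y => P.mW y || Q.mW y
  | .ite _ P Q, y => P.mW y || Q.mW y
  | .loop _ _ P, y => P.mW y
  | _, _ => false

/-- The stores agree on the variables that `P` does not change. -/
structure Kept (P : Cmd) (h h' : Store) : Prop where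
  n : ∀ x, P.mn x = false → h'.n x = h.n x
  w : ∀ x, P.mw x = false → h'.w x = h.w x
  A : ∀ x, P.mA x = false → h'.A x = h.A x
  W : ∀ x, P.mW x = false → h'.W x = h.W x

theorem Kept.refl (P : Cmd) (h : Store) : Kept P h h :=
  ⟨fun _ _ => rfl, fun _ _ => rfl, fun _ _ => rfl, fun _ _ => rfl⟩

theorem Kept.trans {P : Cmd} {h h' h'' : Store} (h1 : Kept P h h') (h2 : Kept P h' h'') :
    Kept P h h'' :=
  ⟨fun x hx => (h2.n x hx).trans (h1.n x hx), fun x hx => (h2.w x hx).trans (h1.w x hx),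
    fun x hx => (h2.A x hx).trans (h1.A x hx), fun x hx => (h2.W x hx).trans (h1.W x hx)⟩

/-- The frame rule. Which variables a command may assign is computed from its syntax, so for
concrete commands that a variable is kept holds by `rfl`. -/
theorem wp_kept {E : Env} (P : Cmd) {Q : Store → Prop} {h : Store} (hw : wp E P Q h) :
    wp E P (fun h' => Q h' ∧ Kept P h h') h := by
  induction P generalizing Q h with
  | skip => exact ⟨hw, .refl _ h⟩
  | setN x e =>
    refine ⟨hw.1, hw.2, fun y hy => ?_, fun _ _ => rfl, fun _ _ => rfl, fun _ _ => rfl⟩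
    simp only [Cmd.mn, beq_eq_false_iff_ne] at hy
    simp [Store.setN, hy]
  | setP x e => exact ⟨hw.1, hw.2, fun _ _ => rfl, fun _ _ => rfl, fun _ _ => rfl, fun _ _ => rfl⟩
  | setW x e =>
    refine ⟨hw.1, hw.2, fun _ _ => rfl, fun y hy => ?_, fun _ _ => rfl, fun _ _ => rfl⟩
    simp only [Cmd.mw, beq_eq_false_iff_ne] at hy
    simp [Store.setW, hy]
  | stN a i e =>
    refine ⟨hw.1, hw.2.1, hw.2.2, fun _ _ => rfl, fun _ _ => rfl, fun y hy => ?_, fun _ _ => rfl⟩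
    simp only [Cmd.mA, beq_eq_false_iff_ne] at hy
    simp [Store.stN, hy]
  | stP a i e =>
    exact ⟨hw.1, hw.2.1, hw.2.2, fun _ _ => rfl, fun _ _ => rfl, fun _ _ => rfl, fun _ _ => rfl⟩
  | stW a i e =>
    refine ⟨hw.1, hw.2.1, hw.2.2, fun _ _ => rfl, fun _ _ => rfl, fun _ _ => rfl, fun y hy => ?_⟩
    simp only [Cmd.mW, beq_eq_false_iff_ne] at hy
    simp [Store.stW, hy]
  | call x =>
    obtain ⟨v, h1, h2⟩ := hw
    refine ⟨v, h1, fun p pa => ⟨h2 p pa, fun _ _ => rfl, fun y hy => ?_, fun _ _ => rfl,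
      fun _ _ => rfl⟩⟩
    simp only [Cmd.mw, beq_eq_false_iff_ne] at hy
    simp [Store.setW, hy]
  | seq P P' ih ih' =>
    refine wp_mono P (ih hw) fun h1 ⟨h2, h3⟩ => wp_mono P' (ih' h2) fun h4 ⟨h5, h6⟩ => ⟨h5, ?_⟩
    refine ⟨fun x hx => ?_, fun x hx => ?_, fun x hx => ?_, fun x hx => ?_⟩ <;>
      simp only [Cmd.mn, Cmd.mw, Cmd.mA, Cmd.mW, Bool.or_eq_false_iff] at hx
    · exact (h6.n x hx.2).trans (h3.n x hx.1)
    · exact (h6.w x hx.2).trans (h3.w x hx.1)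
    · exact (h6.A x hx.2).trans (h3.A x hx.1)
    · exact (h6.W x hx.2).trans (h3.W x hx.1)
  | ite b P P' ih ih' =>
    refine ⟨hw.1, fun hb => wp_mono P (ih (hw.2.1 hb)) fun h1 ⟨h2, h3⟩ => ⟨h2, ?_⟩,
      fun hb => wp_mono P' (ih' (hw.2.2 hb)) fun h1 ⟨h2, h3⟩ => ⟨h2, ?_⟩⟩ <;>
      refine ⟨fun x hx => ?_, fun x hx => ?_, fun x hx => ?_, fun x hx => ?_⟩ <;>
      simp only [Cmd.mn, Cmd.mw, Cmd.mA, Cmd.mW, Bool.or_eq_false_iff] at hx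
    · exact h3.n x hx.1
    · exact h3.w x hx.1
    · exact h3.A x hx.1
    · exact h3.W x hx.1
    · exact h3.n x hx.2
    · exact h3.w x hx.2
    · exact h3.A x hx.2
    · exact h3.W x hx.2
  | loop x e P ih =>
    refine ⟨hw.1, hw.2.1, ?_⟩
    have key : ∀ r i h1, Kept (.loop x e P) h h1 → rounds (wp E P) x Q r i h1 →
        rounds (wp E P) x (fun h' => Q h' ∧ Kept (.loop x e P) h h') r i h1 := by
      intro r
      induction r with
      | zero => exact fun i h1 hk hq => ⟨hq, hk⟩
      | succ r ihr =>
        intro i h1 hk hq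
        refine wp_mono P (ih hq) fun h2 ⟨h3, h4⟩ => ihr (i + 1) h2 (hk.trans ?_) h3
        refine ⟨fun y hy => ?_, fun y hy => ?_, fun y hy => ?_, fun y hy => ?_⟩ <;>
          simp only [Cmd.mn, Cmd.mw, Cmd.mA, Cmd.mW, Bool.or_eq_false_iff,
            beq_eq_false_iff_ne] at hy
        · rw [h4.n y hy.2]; simp [Store.setN, hy.1]
        · exact h4.w y hy
        · exact h4.A y hy
        · exact h4.W y hy
    exact key _ _ _ (.refl _ h) hw.2.2

/-- The rule for loops: `I i` holds before round `i`. -/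
theorem wp_loop {E : Env} {x m : ℕ} {e : NExp} {P : Cmd} {Q : Store → Prop} {h : Store}
    (I : ℕ → Store → Prop) (hok : e.ok E.s h) (hm : e.eval h = m) (hM : m ≤ E.M) (h0 : I 0 h)
    (hs : ∀ i < m, ∀ h', Kept (.loop x e P) h h' → I i h' → wp E P (I (i + 1)) (h'.setN x i))
    (hQ : ∀ h', Kept (.loop x e P) h h' → I m h' → Q h') : wp E (.loop x e P) Q h := by
  subst hm
  have hw : wp E (.loop x e P) (I (e.eval h)) h := by
    refine ⟨hok, hM, ?_⟩
    have key : ∀ r i h1, i + r = e.eval h → Kept (.loop x e P) h h1 → I i h1 →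
        rounds (wp E P) x (I (e.eval h)) r i h1 := by
      intro r
      induction r with
      | zero => intro i h1 hi _ hI; simp only [add_zero] at hi; subst hi; exact hI
      | succ r ihr =>
        intro i h1 hi hk hI
        refine wp_mono P (wp_kept P (hs i (by omega) h1 hk hI)) fun h2 ⟨h3, h4⟩ =>
          ihr (i + 1) h2 (by omega) (hk.trans ?_) h3
        refine ⟨fun y hy => ?_, fun y hy => ?_, fun y hy => ?_, fun y hy => ?_⟩ <;>
          simp only [Cmd.mn, Cmd.mw, Cmd.mA, Cmd.mW, Bool.or_eq_false_iff,
            beq_eq_false_iff_ne] at hy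
        · rw [h4.n y hy.2]; simp [Store.setN, hy.1]
        · exact h4.w y hy
        · exact h4.A y hy
        · exact h4.W y hy
    exact key _ 0 h (by omega) (.refl _ h) h0
  exact wp_mono _ (wp_kept _ hw) fun h' ⟨h1, h2⟩ => hQ h' h2 h1

/-- Uses a specification proved for a part of a program. -/
theorem wp_seq_of {E : Env} {P P' : Cmd} {Q R : Store → Prop} {h : Store} (hP : wp E P R h)
    (hQ : ∀ h', R h' → Kept P h h' → wp E P' Q h') : wp E (.seq P P') Q h :=
  wp_mono P (wp_kept P hP) fun h' ⟨h1, h2⟩ => hQ h' h1 h2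

end TreeDP


/-! ### Graphs given by depths in preorder -/

namespace TreeDP

/-- `i` is the parent of `j`: the nearest smaller depth to the left. -/
def Par (d : ℕ → ℕ) (i j : ℕ) : Prop := i < j ∧ d i < d j ∧ ∀ l, i < l → l < j → d j ≤ d l

theorem Par.unique {d : ℕ → ℕ} {i i' j : ℕ} (h : Par d i j) (h' : Par d i' j) : i = i' := by
  rcases lt_trichotomy i i' with hlt | heq | hlt
  · have := h.2.2 i' hlt h'.1
    have := h'.2.1
    omega
  · exact heq
  · have := h'.2.2 i hlt h.1
    have := h.2.1
    omega

/-- The last index before `j` with smaller depth is the parent, and `x` is a candidate. -/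
theorem exists_par {d : ℕ → ℕ} {x j : ℕ} (hx : x < j) (hd : d x < d j) :
    ∃ p, x ≤ p ∧ Par d p j := by
  classical
  have hne : ((Finset.range j).filter (fun l => d l < d j)).Nonempty :=
    ⟨x, by simp [hx, hd]⟩
  set p := Finset.max' _ hne with hp
  have hmem := Finset.max'_mem _ hne
  rw [← hp, Finset.mem_filter, Finset.mem_range] at hmem
  refine ⟨p, Finset.le_max' _ _ (by simp [hx, hd]), hmem.1, hmem.2, fun l h1 h2 => ?_⟩
  by_contra hc
  have := Finset.le_max' ((Finset.range j).filter (fun l => d l < d j)) l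
    (by simp only [Finset.mem_filter, Finset.mem_range]; omega)
  omega

/-- The graph in which every number is adjacent to its parent. -/
def preGraph (d : ℕ → ℕ) : SimpleGraph ℕ where
  Adj i j := Par d i j ∨ Par d j i
  symm := ⟨fun _ _ h => h.symm⟩
  loopless := ⟨fun i h => by rcases h with h | h <;> exact absurd h.1 (lt_irrefl i)⟩

/-- The restriction to `0, …, m - 1`. -/
abbrev preFin (d : ℕ → ℕ) (m : ℕ) : SimpleGraph (Fin m) := (preGraph d).comap Fin.val

theorem preFin_adj {d : ℕ → ℕ} {m : ℕ} {i j : Fin m} :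
    (preFin d m).Adj i j ↔ Par d i j ∨ Par d j i := Iff.rfl

/-- Every vertex other than 0 has a parent to its left, so all vertices reach 0. Every edge joins
such a vertex to its unique parent, so there are at most `m - 1` edges. -/
theorem preFin_isTree {d : ℕ → ℕ} {m : ℕ} (hm : 0 < m) (hd : ∀ i, 0 < i → i < m → d 0 < d i) :
    (preFin d m).IsTree := by
  classical
  have hpar : ∀ j : Fin m, 0 < j.val → ∃ p : Fin m, Par d p j := fun j hj => by
    obtain ⟨p, _, hp⟩ := exists_par hj (hd j hj j.2)
    exact ⟨⟨p, hp.1.trans j.2⟩, hp⟩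
  have hreach : ∀ k (hk : k < m), (preFin d m).Reachable ⟨k, hk⟩ ⟨0, hm⟩ := by
    intro k
    induction k using Nat.strong_induction_on with
    | _ k ih =>
      intro hk
      rcases Nat.eq_zero_or_pos k with rfl | hpos
      · exact .refl _
      · obtain ⟨p, hp⟩ := hpar ⟨k, hk⟩ hpos
        exact (SimpleGraph.Adj.reachable (G := preFin d m) (v := p) (Or.inr hp)).trans
          (ih p hp.1 p.2)
  have : Nonempty (Fin m) := ⟨⟨0, hm⟩⟩
  have hconn : (preFin d m).Connected :=
    ⟨fun u v => (hreach u u.2).trans (hreach v v.2).symm⟩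
  rw [SimpleGraph.isTree_iff_connected_and_card]
  refine ⟨hconn, le_antisymm ?_ hconn.card_vert_le_card_edgeSet_add_one⟩
  choose! f hf using hpar
  have hsub : (preFin d m).edgeSet ⊆
      ((Finset.univ.erase (⟨0, hm⟩ : Fin m)).image (fun j => s(f j, j)) : Finset _) := by
    intro e
    induction e using Sym2.ind with
    | _ a b =>
      intro h
      rw [SimpleGraph.mem_edgeSet, preFin_adj] at h
      simp only [Finset.coe_image, Set.mem_image, Finset.coe_erase, Finset.coe_univ]
      rcases h with h | h
      · refine ⟨b, ⟨trivial, fun hb => ?_⟩, ?_⟩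
        · have := h.1
          rw [Set.mem_singleton_iff.1 hb] at this
          simp at this
        · have : f b = a := Fin.ext ((hf b (by have := h.1; omega)).unique h)
          rw [this]
      · refine ⟨a, ⟨trivial, fun hb => ?_⟩, ?_⟩
        · have := h.1
          rw [Set.mem_singleton_iff.1 hb] at this
          simp at this
        · have : f a = b := Fin.ext ((hf a (by have := h.1; omega)).unique h)
          rw [this, Sym2.eq_swap]
  have h1 : Nat.card (preFin d m).edgeSet ≤ m - 1 := by
    rw [Nat.card_coe_set_eq]
    refine (Set.ncard_le_ncard hsub (Finset.finite_toSet _)).trans ?_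
    rw [Set.ncard_coe_finset]
    refine Finset.card_image_le.trans ?_
    simp
  rw [Nat.card_eq_fintype_card (α := Fin m), Fintype.card_fin]
  omega

/-! ### The measure on induced subgraphs -/

variable (H : GraphMeasure)

/-- The value of the measure on the subgraph induced by a finite set of numbers. -/
noncomputable def valOn (d : ℕ → ℕ) (C : Finset ℕ) : ℝ := H.val ((preGraph d).induce (C : Set ℕ))

/-- Isomorphism invariance, for a graph whose vertices are numbered by `f`. -/
theorem valOn_eq {d : ℕ → ℕ} {C : Finset ℕ} {V : Type} [Finite V] (G : SimpleGraph V) (f : V → ℕ)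
    (hf : Function.Injective f) (hC : ∀ l, l ∈ C ↔ ∃ v, f v = l)
    (hadj : ∀ u v, (preGraph d).Adj (f u) (f v) ↔ G.Adj u v) : valOn H d C = H.val G := by
  refine H.iso_inv _ _ ⟨RelIso.symm ⟨Equiv.ofBijective
    (fun v => (⟨f v, (hC _).2 ⟨v, rfl⟩⟩ : (C : Set ℕ))) ⟨fun u v h => hf (by simpa using h),
      fun l => ?_⟩, ?_⟩⟩
  · obtain ⟨v, hv⟩ := (hC l.1).1 l.2
    exact ⟨v, Subtype.ext hv⟩
  · intro u v
    exact hadj u v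

/-- With no edge between the two sets, the induced graph is a disjoint sum. All uses of additivity
go through this lemma. -/
theorem valOn_union (hH : H.Additive) {d : ℕ → ℕ} {A B : Finset ℕ} (hAB : Disjoint A B)
    (hadj : ∀ a ∈ A, ∀ b ∈ B, ¬ (preGraph d).Adj a b) :
    valOn H d (A ∪ B) = valOn H d A + valOn H d B := by
  rw [valOn, valOn, valOn, ← hH]
  refine valOn_eq H (V := (A : Set ℕ) ⊕ (B : Set ℕ)) _ (Sum.elim Subtype.val Subtype.val) ?_ ?_ ?_
  · rintro (⟨u, hu⟩ | ⟨u, hu⟩) (⟨v, hv⟩ | ⟨v, hv⟩) h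
    · simpa using h
    · simp only [Sum.elim_inl, Sum.elim_inr] at h
      subst h
      exact absurd hv (Finset.disjoint_left.1 hAB hu)
    · simp only [Sum.elim_inl, Sum.elim_inr] at h
      subst h
      exact absurd hu (Finset.disjoint_left.1 hAB hv)
    · simpa using h
  · intro l
    rw [Finset.mem_union]
    constructor
    · rintro (h | h)
      · exact ⟨.inl ⟨l, h⟩, rfl⟩
      · exact ⟨.inr ⟨l, h⟩, rfl⟩
    · rintro ⟨(⟨u, hu⟩ | ⟨u, hu⟩), rfl⟩
      · exact Or.inl hu
      · exact Or.inr hu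
  · rintro (⟨u, hu⟩ | ⟨u, hu⟩) (⟨v, hv⟩ | ⟨v, hv⟩)
    · simp
    · simp [hadj u hu v hv]
    · simpa using fun h => hadj v hv u hu h.symm
    · simp

/-- The empty graph is the disjoint sum of two copies of itself, so its value equals twice its
value. -/
theorem valOn_empty (hH : H.Additive) (d : ℕ → ℕ) : valOn H d ∅ = 0 := by
  have := valOn_union H hH (d := d) (Finset.disjoint_empty_left ∅) (by simp)
  simpa using this

/-- The value of the measure on the tree with the given list of depths. -/
noncomputable def valList (R : List ℕ) : ℝ := H.val (preFin (fun i => R.getD i 0) R.length)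

/-! ### Preorder and subtree intervals -/

/-- `d` lists the depths of a tree in preorder, and `nx i` is the end of the subtree at `i`. -/
structure Pre (n : ℕ) (d nx : ℕ → ℕ) : Prop where
  lt : ∀ i < n, i < nx i
  le : ∀ i < n, nx i ≤ n
  inside : ∀ i < n, ∀ l, i < l → l < nx i → d i < d l
  out : ∀ i < n, nx i < n → d (nx i) ≤ d i
  root : ∀ i, 0 < i → i < n → d 0 < d i

variable {H} {n : ℕ} {d nx : ℕ → ℕ}

theorem Pre.nx_zero (h : Pre n d nx) (hn : 0 < n) : nx 0 = n := by
  refine le_antisymm (h.le 0 hn) ?_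
  by_contra hc
  have h1 := h.out 0 hn (by omega)
  have h2 := h.root (nx 0) (h.lt 0 hn) (by omega)
  omega

/-- Otherwise `nx i` would lie strictly inside the subtree at `l` and be deeper than `l`, although
its depth is at most that of `i`. -/
theorem Pre.laminar (h : Pre n d nx) {i l : ℕ} (hi : i < n) (hil : i ≤ l) (hl : l < nx i) :
    nx l ≤ nx i := by
  have hln : l < n := hl.trans_le (h.le i hi)
  by_contra hc
  have h1 := h.inside l hln (nx i) hl (by omega)
  have h2 := h.out i hi (by have := h.le l hln; omega)
  rcases hil.eq_or_lt with rfl | hil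
  · omega
  · have := h.inside i hi l hil hl
    omega

/-- The vertex `nx p` is no deeper than `p`, so it can neither equal `j` nor lie between a vertex
`j` and its parent `p`. -/
theorem Pre.par_lt (h : Pre n d nx) {p j : ℕ} (hj : j < n) (hp : Par d p j) : j < nx p := by
  by_contra hc
  have hpn := hp.1.trans hj
  have h1 := h.lt p hpn
  have h2 := h.out p hpn (by omega)
  rcases (not_lt.1 hc).eq_or_lt with h3 | h3
  · rw [h3] at h2
    have := hp.2.1
    omega
  · have := hp.2.2 _ h1 h3
    have := hp.2.1
    omega

/-- Below `b`, parents stay in the subtree. -/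
theorem Pre.le_par (h : Pre n d nx) {b p j : ℕ} (hb : b < n) (hp : Par d p j) (hbj : b < j)
    (hj : j < nx b) : b ≤ p := by
  by_contra hc
  have := hp.2.2 b (by omega) hbj
  have := h.inside b hb j hbj hj
  omega

/-- Edges leave a subtree only towards the left, from its root. So no edge is lost when an interval
is cut after a complete subtree; additivity applies to the two pieces. -/
theorem Pre.not_adj (h : Pre n d nx) {i a b : ℕ} (hi : i < n) (ha : i ≤ a) (ha' : a < nx i)
    (hb : nx i ≤ b) (hbn : b < n) : ¬ (preGraph d).Adj a b := by
  rintro (hp | hp)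
  · have h1 := h.par_lt hbn hp
    have h2 := h.laminar hi ha ha'
    omega
  · have := hp.1
    omega

end TreeDP


/-! ### The recursion for the optimal values -/

namespace TreeDP

variable {H : GraphMeasure} {n : ℕ} {d nx : ℕ → ℕ}

/-- `l` lies below an element of `S` that is at least `x`. -/
def Hid (nx : ℕ → ℕ) (S : Finset ℕ) (x l : ℕ) : Prop := ∃ b ∈ S, x ≤ b ∧ b ≤ l ∧ l < nx b

instance (nx : ℕ → ℕ) (S : Finset ℕ) (x l : ℕ) : Decidable (Hid nx S x l) := by
  unfold Hid; infer_instance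

theorem Hid.congr {S S' : Finset ℕ} {x l e : ℕ} (hl : l < e)
    (hS : ∀ b, x ≤ b → b < e → (b ∈ S ↔ b ∈ S')) : Hid nx S x l ↔ Hid nx S' x l := by
  constructor
  · rintro ⟨b, h1, h2, h3, h4⟩
    exact ⟨b, (hS b h2 (by omega)).1 h1, h2, h3, h4⟩
  · rintro ⟨b, h1, h2, h3, h4⟩
    exact ⟨b, (hS b h2 (by omega)).2 h1, h2, h3, h4⟩

/-- The relative depths, from `i` on, of the vertices of the subtree at `x` that do not lie below
an element of `S`. -/
def dlist (d nx : ℕ → ℕ) (x : ℕ) (S : Finset ℕ) (i : ℕ) : List ℕ :=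
  ((List.range' i (nx x - i)).filter (fun l => ¬ Hid nx S x l)).map (fun l => d l - d x)

theorem dlist_congr {x : ℕ} {S S' : Finset ℕ} (i : ℕ)
    (hS : ∀ b, x ≤ b → b < nx x → (b ∈ S ↔ b ∈ S')) : dlist d nx x S i = dlist d nx x S' i := by
  unfold dlist
  congr 1
  refine List.filter_congr fun l hl => ?_
  rw [List.mem_range'_1] at hl
  rw [decide_eq_decide, Hid.congr (e := nx x) (by omega) hS]

theorem dlist_cons {x i : ℕ} {S : Finset ℕ} (hi : i < nx x) (hh : ¬ Hid nx S x i) :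
    dlist d nx x S i = (d i - d x) :: dlist d nx x S (i + 1) := by
  unfold dlist
  rw [show nx x - i = (nx x - (i + 1)) + 1 by omega, List.range'_succ, List.filter_cons_of_pos
    (by simpa using hh), List.map_cons]

theorem dlist_skip {x i m : ℕ} {S : Finset ℕ} (him : i ≤ m) (hm : m ≤ nx x)
    (hh : ∀ l, i ≤ l → l < m → Hid nx S x l) : dlist d nx x S i = dlist d nx x S m := by
  unfold dlist
  have : List.range' i (nx x - i) = List.range' i (m - i) ++ List.range' m (nx x - m) := by
    have := List.range'_append_1 (s := i) (m := m - i) (n := nx x - m)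
    rw [show i + (m - i) = m by omega, show m - i + (nx x - m) = nx x - i by omega] at this
    exact this.symm
  rw [this, List.filter_append]
  have h0 : (List.range' i (m - i)).filter (fun l => ¬ Hid nx S x l) = [] := by
    rw [List.filter_eq_nil_iff]
    intro l hl
    rw [List.mem_range'_1] at hl
    simpa using hh l (by omega) (by omega)
  rw [h0, List.nil_append]

theorem dlist_end (x : ℕ) (S : Finset ℕ) : dlist d nx x S (nx x) = [] := by
  simp [dlist]

/-- The component of `x` after deleting `S` from its subtree is given by its depths. -/
theorem valOn_comp (h : Pre n d nx) {x : ℕ} (hx : x < n) {S : Finset ℕ} :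
    valOn H d ((Finset.Ico x (nx x)).filter (fun l => ¬ Hid nx S x l)) =
      valList H (dlist d nx x S x) := by
  set L := (List.range' x (nx x - x)).filter (fun l => ¬ Hid nx S x l) with hL
  have hsort : L.Pairwise (· < ·) := (List.pairwise_lt_range' (s := x) (n := nx x - x)).filter _
  have hmem : ∀ l, l ∈ L ↔ (x ≤ l ∧ l < nx x) ∧ ¬ Hid nx S x l := by
    intro l
    have := h.lt x hx
    rw [hL, List.mem_filter, List.mem_range'_1, show x + (nx x - x) = nx x by omega]
    simp
  have hR : dlist d nx x S x = L.map (fun l => d l - d x) := rfl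
  have hlen : (dlist d nx x S x).length = L.length := by rw [hR, List.length_map]
  have hxd : ∀ l ∈ L, d x ≤ d l := by
    intro l hl
    have h1 := (hmem l).1 hl
    rcases h1.1.1.eq_or_lt with rfl | h2
    · exact le_rfl
    · exact (h.inside x hx l h2 h1.1.2).le
  set f : Fin (dlist d nx x S x).length → ℕ := fun t => L[t.1]'(by rw [← hlen]; exact t.2) with hf
  have hmono : StrictMono f := fun s t hst => List.pairwise_iff_getElem.1 hsort _ _ _ _ hst
  have hfL : ∀ t, f t ∈ L := fun t => List.getElem_mem _
  have hsurj : ∀ l ∈ L, ∃ t, f t = l := by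
    intro l hl
    obtain ⟨t, ht, rfl⟩ := List.mem_iff_getElem.1 hl
    exact ⟨⟨t, by rw [hlen]; exact ht⟩, rfl⟩
  have hval : ∀ t : Fin (dlist d nx x S x).length,
      (dlist d nx x S x).getD t.1 0 = d (f t) - d x := by
    intro t
    rw [List.getD_eq_getElem _ _ t.2]
    simp [hR, hf]
  -- The parent relation survives the restriction to the component: if a vertex was hidden below a
  -- deleted one, so would be its children. Hence parents stay in the list, and the nearest smaller
  -- depth in the list is the nearest one overall.
  have hpar : ∀ s t, Par d (f s) (f t) ↔
      Par (fun i => (dlist d nx x S x).getD i 0) s t := by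
    intro s t
    have hs := hxd _ (hfL s)
    have ht := hxd _ (hfL t)
    constructor
    · rintro ⟨h1, h2, h3⟩
      refine ⟨hmono.lt_iff_lt.1 h1, ?_, fun l hl1 hl2 => ?_⟩
      · simp only [hval]; omega
      · have hl : l < (dlist d nx x S x).length := hl2.trans t.2
        have := h3 (f ⟨l, hl⟩) (hmono hl1) (hmono hl2)
        have e := hval ⟨l, hl⟩
        simp only at e
        simp only [hval, e]; omega
    · rintro ⟨h1, h2, h3⟩
      simp only [hval] at h2
      have hst : f s < f t := hmono h1
      have hxs := ((hmem _).1 (hfL s)).1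
      have htm := (hmem _).1 (hfL t)
      obtain ⟨p, hp1, hp2⟩ := exists_par (d := d) (x := x) (j := f t) (by omega)
        (h.inside x hx _ (by omega) htm.1.2)
      have hpL : p ∈ L := by
        rw [hmem]
        refine ⟨⟨hp1, hp2.1.trans htm.1.2⟩, ?_⟩
        rintro ⟨b, hb1, hb2, hb3, hb4⟩
        refine htm.2 ⟨b, hb1, hb2, hb3.trans hp2.1.le, ?_⟩
        have hbn : b < n := by have := h.le x hx; have := hp2.1; omega
        have hpn : p < n := by have := h.le x hx; have := hp2.1; omega
        exact (h.par_lt (by have := h.le x hx; omega) hp2).trans_le (h.laminar hbn hb3 hb4)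
      obtain ⟨u, rfl⟩ := hsurj p hpL
      have hut : u < t := hmono.lt_iff_lt.1 hp2.1
      rcases lt_trichotomy s u with hsu | rfl | hsu
      · have := h3 u hsu hut
        simp only [hval] at this
        have := hp2.2.1
        omega
      · exact hp2
      · have := hp2.2.2 _ (hmono hsu) hst
        omega
  refine valOn_eq H _ f hmono.injective (fun l => ?_) fun s t => ?_
  · rw [Finset.mem_filter, Finset.mem_Ico, ← hmem]
    exact ⟨hsurj l, fun ⟨t, ht⟩ => ht ▸ hfL t⟩
  · rw [preFin_adj, ← hpar, ← hpar]; rfl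

/-! ### Attainable values and their recursions -/

/-- Minimal-sum convolution of two families of sets of values. -/
def Conv (A B : ℕ → Set ℝ) (j : ℕ) : Set ℝ :=
  {v | ∃ j1 j2, j1 + j2 = j ∧ ∃ a ∈ A j1, ∃ b ∈ B j2, v = a + b}

-- The proposition `q` switches the restriction to the family on and off. With `False` the sets
-- contain all attainable values; with `True`, only those a table entry must not exceed.
variable (H n d nx) (fam : ℕ → Set (List ℕ)) (q : Prop)

/-- The components left by `S` in the interval belong to the family. -/
def Nice (i e : ℕ) (S : Finset ℕ) : Prop :=
  q → ∀ y, i ≤ y → y < e → y ∉ S → dlist d nx y S y ∈ fam y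

/-- The values after deleting `j` vertices from an interval. -/
def valI (i e j : ℕ) : Set ℝ :=
  {v | ∃ S ⊆ Finset.Ico i e, S.card = j ∧ Nice d nx fam q i e S ∧
    v = valOn H d ((Finset.Ico i e).filter (· ∉ S))}

/-- The values after deleting `j` vertices, and among them the root, from a subtree. -/
def valD (x j : ℕ) : Set ℝ :=
  {v | ∃ S ⊆ Finset.Ico x (nx x), S.card = j ∧ x ∈ S ∧ Nice d nx fam q x (nx x) S ∧
    v = valOn H d ((Finset.Ico x (nx x)).filter (· ∉ S))}

/-- The values after deleting `j` vertices from the part from `i` on of the subtree at `x`, when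
the component of `x` is `R` and its vertices before `i` are the first `r` elements of `R`;
this component is not counted. -/
def valV (x : ℕ) (R : List ℕ) (r i j : ℕ) : Set ℝ :=
  {v | ∃ S ⊆ Finset.Ico i (nx x), S.card = j ∧ Nice d nx fam q i (nx x) S ∧
    dlist d nx x S i = R.drop r ∧
    v = valOn H d ((Finset.Ico i (nx x)).filter (fun l => Hid nx S x l ∧ l ∉ S))}

variable {H n d nx fam q}

/-- The list of `y` depends only on the deletions inside the subtree at `y`. -/
theorem Nice.congr {i e i' e' : ℕ} {S S' : Finset ℕ} (hS : Nice d nx fam q i e S) (hi : i ≤ i')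
    (he : e' ≤ e) (hSS : ∀ y, i' ≤ y → y < e' → ∀ b, y ≤ b → b < nx y → (b ∈ S ↔ b ∈ S'))
    (hlt : ∀ y, i' ≤ y → y < e' → y < nx y) : Nice d nx fam q i' e' S' := by
  intro hq y h1 h2 h3
  rw [← dlist_congr y (hSS y h1 h2)]
  exact hS hq y (by omega) (by omega) (by rwa [hSS y h1 h2 y le_rfl (hlt y h1 h2)])

theorem Ico_filter_split {i m e : ℕ} (him : i ≤ m) (hme : m ≤ e) (p : ℕ → Prop) [DecidablePred p] :
    (Finset.Ico i e).filter p = (Finset.Ico i m).filter p ∪ (Finset.Ico m e).filter p := by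
  rw [← Finset.filter_union, Finset.Ico_union_Ico_eq_Ico him hme]

theorem valOn_split (hH : H.Additive) (h : Pre n d nx) {i e : ℕ} (hi : i < n) (hie : nx i ≤ e)
    (hen : e ≤ n) (p : ℕ → Prop) [DecidablePred p] :
    valOn H d ((Finset.Ico i e).filter p) = valOn H d ((Finset.Ico i (nx i)).filter p) +
      valOn H d ((Finset.Ico (nx i) e).filter p) := by
  rw [Ico_filter_split (h.lt i hi).le hie, valOn_union H hH]
  · rw [Finset.disjoint_left]
    intro l h1 h2
    simp only [Finset.mem_filter, Finset.mem_Ico] at h1 h2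
    omega
  · intro a ha b hb
    simp only [Finset.mem_filter, Finset.mem_Ico] at ha hb
    exact h.not_adj hi ha.1.1 ha.1.2 hb.1.1 (by omega)

/-- The deletion set is cut at `nx i`. No edge crosses this point, and the lists of the remaining
vertices do not notice the cut. -/
theorem valI_split (hH : H.Additive) (h : Pre n d nx) {i e j : ℕ} (hi : i < n) (hie : nx i ≤ e)
    (hen : e ≤ n) {v : ℝ} (hv : v ∈ valI H d nx fam q i e j) :
    v ∈ Conv (valI H d nx fam q i (nx i)) (valI H d nx fam q (nx i) e) j := by
  obtain ⟨S, hS, rfl, hN, rfl⟩ := hv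
  have hi' := h.lt i hi
  have hmem : ∀ b ∈ S, i ≤ b ∧ b < e := fun b hb => Finset.mem_Ico.1 (hS hb)
  refine ⟨(S.filter (· < nx i)).card, (S.filter (¬ · < nx i)).card,
    Finset.card_filter_add_card_filter_not _, _,
    ⟨S.filter (· < nx i), ?_, rfl, ?_, rfl⟩, _, ⟨S.filter (¬ · < nx i), ?_, rfl, ?_, rfl⟩, ?_⟩
  · intro b hb
    rw [Finset.mem_filter] at hb
    exact Finset.mem_Ico.2 ⟨(hmem b hb.1).1, hb.2⟩
  · refine hN.congr le_rfl hie (fun y h1 h2 b h3 h4 => ?_) fun y h1 h2 => h.lt y (by omega)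
    have := h.laminar hi h1 h2
    rw [Finset.mem_filter, and_iff_left (by omega)]
  · intro b hb
    rw [Finset.mem_filter] at hb
    exact Finset.mem_Ico.2 ⟨by omega, (hmem b hb.1).2⟩
  · refine hN.congr hi'.le le_rfl (fun y h1 h2 b h3 h4 => ?_) fun y h1 h2 => h.lt y (by omega)
    rw [Finset.mem_filter, and_iff_left (by omega)]
  · rw [valOn_split hH h hi hie hen]
    congr 2 <;>
    · refine Finset.filter_congr fun b hb => ?_
      rw [Finset.mem_Ico] at hb
      rw [Finset.mem_filter]
      simp only [not_and_or]
      constructor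
      · exact fun h => Or.inl h
      · rintro (h | h)
        · exact h
        · omega

/-- Needed only for attained values, so the family plays no role here. -/
theorem valI_glue (hH : H.Additive) (h : Pre n d nx) {i e j : ℕ} (hi : i < n) (hie : nx i ≤ e)
    (hen : e ≤ n) {v : ℝ}
    (hv : v ∈ Conv (valI H d nx fam False i (nx i)) (valI H d nx fam False (nx i) e) j) :
    v ∈ valI H d nx fam False i e j := by
  obtain ⟨_, _, rfl, _, ⟨S1, hS1, rfl, -, rfl⟩, _, ⟨S2, hS2, rfl, -, rfl⟩, rfl⟩ := hv
  have hi' := h.lt i hi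
  have h1 : ∀ b ∈ S1, i ≤ b ∧ b < nx i := fun b hb => Finset.mem_Ico.1 (hS1 hb)
  have h2 : ∀ b ∈ S2, nx i ≤ b ∧ b < e := fun b hb => Finset.mem_Ico.1 (hS2 hb)
  refine ⟨S1 ∪ S2, ?_, ?_, fun hq => hq.elim, ?_⟩
  · intro b hb
    rcases Finset.mem_union.1 hb with hb | hb
    · exact Finset.mem_Ico.2 ⟨(h1 b hb).1, by have := h1 b hb; omega⟩
    · exact Finset.mem_Ico.2 ⟨by have := h2 b hb; omega, (h2 b hb).2⟩
  · rw [Finset.card_union_of_disjoint]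
    rw [Finset.disjoint_left]
    intro b hb hb'
    have := h1 b hb
    have := h2 b hb'
    omega
  · rw [valOn_split hH h hi hie hen]
    congr 2 <;>
    · refine Finset.filter_congr fun b hb => ?_
      rw [Finset.mem_Ico] at hb
      rw [Finset.mem_union, not_or]
      constructor
      · intro h3
        refine ⟨?_, ?_⟩ <;> first | assumption | (intro h4; first | (have := h1 b h4; omega) | (have := h2 b h4; omega))
      · rintro ⟨h3, h4⟩; assumption

theorem valI_empty (hH : H.Additive) {e j : ℕ} {v : ℝ} :
    v ∈ valI H d nx fam q e e j ↔ j = 0 ∧ v = 0 := by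
  constructor
  · rintro ⟨S, hS, rfl, -, rfl⟩
    rw [Finset.Ico_self, Finset.subset_empty] at hS
    subst hS
    simp [valOn_empty H hH]
  · rintro ⟨rfl, rfl⟩
    exact ⟨∅, by simp, rfl, fun _ y h1 h2 => by omega, by simp [valOn_empty H hH]⟩

theorem valD_zero {x : ℕ} {v : ℝ} : v ∉ valD H d nx fam q x 0 := by
  rintro ⟨S, -, h0, hx, -⟩
  rw [Finset.card_eq_zero] at h0
  simp [h0] at hx

theorem Ico_filter_notMem {x e : ℕ} {S S' : Finset ℕ} (hx : x ∈ S)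
    (hS : ∀ b, x < b → (b ∈ S ↔ b ∈ S')) :
    (Finset.Ico x e).filter (· ∉ S) = (Finset.Ico (x + 1) e).filter (· ∉ S') := by
  ext b
  simp only [Finset.mem_filter, Finset.mem_Ico]
  rcases lt_trichotomy x b with h | rfl | h
  · rw [hS b h]; constructor <;> rintro ⟨h1, h2⟩ <;> exact ⟨by omega, h2⟩
  · simp [hx]
  · constructor <;> rintro ⟨h1, h2⟩ <;> omega

/-- Deleting `x` uses up one deletion and leaves the forest on the next vertices. -/
theorem valD_succ (h : Pre n d nx) {x j : ℕ} (hx : x < n) {v : ℝ} :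
    v ∈ valD H d nx fam q x (j + 1) ↔ v ∈ valI H d nx fam q (x + 1) (nx x) j := by
  have hx' := h.lt x hx
  have hle := h.le x hx
  constructor
  · rintro ⟨S, hS, hc, hxS, hN, rfl⟩
    have hmem : ∀ b ∈ S, x ≤ b ∧ b < nx x := fun b hb => Finset.mem_Ico.1 (hS hb)
    refine ⟨S.erase x, ?_, by rw [Finset.card_erase_of_mem hxS]; omega, ?_, ?_⟩
    · intro b hb
      rw [Finset.mem_erase] at hb
      have := hmem b hb.2
      rw [Finset.mem_Ico]
      omega
    · refine hN.congr (by omega) le_rfl (fun y h1 h2 b h3 h4 => ?_) fun y h1 h2 => h.lt y (by omega)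
      rw [Finset.mem_erase, and_iff_right (by omega)]
    · rw [Ico_filter_notMem hxS]
      intro b hb
      rw [Finset.mem_erase, and_iff_right (by omega)]
  · rintro ⟨S, hS, hc, hN, rfl⟩
    have hmem : ∀ b ∈ S, x + 1 ≤ b ∧ b < nx x := fun b hb => Finset.mem_Ico.1 (hS hb)
    have hxS : x ∉ S := fun hb => by have := hmem x hb; omega
    refine ⟨insert x S, ?_, by rw [Finset.card_insert_of_notMem hxS, hc], by simp, ?_, ?_⟩
    · intro b hb
      rw [Finset.mem_insert] at hb
      rw [Finset.mem_Ico]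
      rcases hb with rfl | hb
      · omega
      · have := hmem b hb; omega
    · intro hq y h1 h2 h3
      rw [Finset.mem_insert, not_or] at h3
      rw [← dlist_congr y (S := S)]
      · exact hN hq y (by omega) h2 h3.2
      · intro b h4 h5
        rw [Finset.mem_insert, or_iff_right (by omega)]
    · rw [Ico_filter_notMem (S := insert x S) (S' := S) (by simp)]
      intro b hb
      rw [Finset.mem_insert, or_iff_right (by omega)]

/-- The component of `x` and the rest of its subtree are independent. -/
theorem valOn_comp_add (hH : H.Additive) (h : Pre n d nx) {x : ℕ} (hx : x < n) {S : Finset ℕ}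
    (hS : S ⊆ Finset.Ico (x + 1) (nx x)) :
    valOn H d ((Finset.Ico x (nx x)).filter (· ∉ S)) = valList H (dlist d nx x S x) +
      valOn H d ((Finset.Ico (x + 1) (nx x)).filter (fun l => Hid nx S x l ∧ l ∉ S)) := by
  have hmem : ∀ b ∈ S, x + 1 ≤ b ∧ b < nx x := fun b hb => Finset.mem_Ico.1 (hS hb)
  have hxS : x ∉ S := fun hb => by have := hmem x hb; omega
  have hx' := h.lt x hx
  have hle := h.le x hx
  have hhid : ∀ l ∈ S, Hid nx S x l := fun l hl =>
    ⟨l, hl, by have := hmem l hl; omega, le_rfl, h.lt l (by have := hmem l hl; omega)⟩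
  have hxh : ¬ Hid nx S x x := by
    rintro ⟨b, h1, h2, h3, h4⟩
    exact hxS (by rwa [show x = b by omega])
  rw [← valOn_comp h hx, ← valOn_union H hH]
  · congr 1
    ext l
    simp only [Finset.mem_union, Finset.mem_filter, Finset.mem_Ico]
    constructor
    · rintro ⟨h1, h2⟩
      by_cases hl : Hid nx S x l
      · right
        refine ⟨⟨?_, h1.2⟩, hl, h2⟩
        rcases h1.1.eq_or_lt with rfl | h3
        · exact absurd hl hxh
        · exact h3
      · exact Or.inl ⟨h1, hl⟩
    · rintro (⟨h1, h2⟩ | ⟨h1, h2, h3⟩)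
      · exact ⟨h1, fun h3 => h2 (hhid l h3)⟩
      · exact ⟨by omega, h3⟩
  · rw [Finset.disjoint_left]
    intro l h1 h2
    rw [Finset.mem_filter] at h1 h2
    exact h1.2 h2.2.1
  · intro a ha b hb hab
    simp only [Finset.mem_filter, Finset.mem_Ico] at ha hb
    obtain ⟨⟨ha1, ha2⟩, ha3⟩ := ha
    obtain ⟨⟨hb1, hb2⟩, ⟨c, hc1, hc2, hc3, hc4⟩, hb4⟩ := hb
    have hcn : c < n := by omega
    rcases hab with hp | hp
    · have hcb : c < b := lt_of_le_of_ne hc3 (fun e => hb4 (e ▸ hc1))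
      have := h.le_par hcn hp hcb hc4
      exact ha3 ⟨c, hc1, hc2, this, hp.1.trans hc4⟩
    · have := h.par_lt (by omega) hp
      have := h.laminar hcn hc3 hc4
      have := hp.1
      exact ha3 ⟨c, hc1, hc2, by omega, by omega⟩

/-- If `x` stays, take `R` to be the list of its actual component. Its first entry is `x` itself, so
the alignment starts at position 1 and vertex `x + 1`. -/
theorem valM_cases (hH : H.Additive) (h : Pre n d nx) {x j : ℕ} (hx : x < n) {v : ℝ}
    (hv : v ∈ valI H d nx fam q x (nx x) j) :
    v ∈ valD H d nx fam q x j ∨ ∃ R : List ℕ, (q → R ∈ fam x) ∧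
      ∃ u ∈ valV H d nx fam q x R 1 (x + 1) j, v = valList H R + u := by
  obtain ⟨S, hS, rfl, hN, rfl⟩ := hv
  have hx' := h.lt x hx
  have hle := h.le x hx
  by_cases hxS : x ∈ S
  · exact Or.inl ⟨S, hS, rfl, hxS, hN, rfl⟩
  · right
    have hS' : S ⊆ Finset.Ico (x + 1) (nx x) := by
      intro b hb
      have h1 := Finset.mem_Ico.1 (hS hb)
      rw [Finset.mem_Ico]
      have : b ≠ x := fun e => hxS (e ▸ hb)
      omega
    refine ⟨dlist d nx x S x, fun hq => hN hq x le_rfl hx' hxS, _, ⟨S, hS', rfl, ?_, ?_, rfl⟩,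
      valOn_comp_add hH h hx hS'⟩
    · exact fun hq y h1 h2 h3 => hN hq y (by omega) h2 h3
    · rw [dlist_cons hx']
      · rfl
      · rintro ⟨b, h1, h2, h3, h4⟩
        exact hxS (by rwa [show x = b by omega])

/-- A list that starts with 0 and aligns is the list of the actual component, so its value is right
no matter which code produced it. Codes that describe nothing cannot align and do no harm. -/
theorem valM_of_comp (hH : H.Additive) (h : Pre n d nx) {x j : ℕ} (hx : x < n) {R : List ℕ}
    (hR : R.head? = some 0) {u : ℝ} (hu : u ∈ valV H d nx fam False x R 1 (x + 1) j) :
    valList H R + u ∈ valI H d nx fam False x (nx x) j := by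
  obtain ⟨S, hS, rfl, -, hd, rfl⟩ := hu
  have hx' := h.lt x hx
  have hmem : ∀ b ∈ S, x + 1 ≤ b ∧ b < nx x := fun b hb => Finset.mem_Ico.1 (hS hb)
  refine ⟨S, fun b hb => ?_, rfl, fun hq => hq.elim, ?_⟩
  · have := hmem b hb
    rw [Finset.mem_Ico]; omega
  · rw [valOn_comp_add hH h hx hS, dlist_cons hx', hd]
    · cases R with
      | nil => simp at hR
      | cons a R =>
        simp only [List.head?_cons, Option.some.injEq] at hR
        subst hR
        simp
    · rintro ⟨b, h1, h2, h3, h4⟩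
      have := hmem b h1
      omega

theorem valM_of_valD {x j : ℕ} {v : ℝ} (hv : v ∈ valD H d nx fam q x j) :
    v ∈ valI H d nx fam q x (nx x) j := by
  obtain ⟨S, h1, h2, -, h3, h4⟩ := hv
  exact ⟨S, h1, h2, h3, h4⟩

theorem valV_end (hH : H.Additive) {x r j : ℕ} {R : List ℕ} {v : ℝ} :
    v ∈ valV H d nx fam q x R r (nx x) j ↔ (j = 0 ∧ R.length ≤ r) ∧ v = 0 := by
  constructor
  · rintro ⟨S, hS, rfl, -, hd, rfl⟩
    rw [Finset.Ico_self, Finset.subset_empty] at hS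
    subst hS
    rw [dlist_end] at hd
    simp [valOn_empty H hH, List.drop_eq_nil_iff.1 hd.symm]
  · rintro ⟨⟨rfl, hr⟩, rfl⟩
    exact ⟨∅, by simp, rfl, fun _ y h1 h2 => by omega,
      by rw [dlist_end, List.drop_eq_nil_iff.2 hr], by simp [valOn_empty H hH]⟩

/-- As all deletions come after `i`, nothing hides `i`. It belongs to the component, and hence must
be its next vertex. -/
theorem valV_match {x i r : ℕ} {R : List ℕ} (hi : i < nx x) {S : Finset ℕ} (hS : S ⊆ Finset.Ico (i + 1) (nx x)) :
    (dlist d nx x S i = R.drop r ↔ (r < R.length ∧ R.getD r 0 = d i - d x) ∧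
      dlist d nx x S (i + 1) = R.drop (r + 1)) ∧
    (Finset.Ico i (nx x)).filter (fun l => Hid nx S x l ∧ l ∉ S) =
      (Finset.Ico (i + 1) (nx x)).filter (fun l => Hid nx S x l ∧ l ∉ S) := by
  have hmem : ∀ b ∈ S, i + 1 ≤ b ∧ b < nx x := fun b hb => Finset.mem_Ico.1 (hS hb)
  have hh : ¬ Hid nx S x i := by
    rintro ⟨b, h1, h2, h3, h4⟩
    have := hmem b h1
    omega
  constructor
  · rw [dlist_cons hi hh]
    by_cases hr : r < R.length
    · rw [List.drop_eq_getElem_cons hr, List.cons.injEq, List.getD_eq_getElem _ _ hr]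
      simp only [hr, true_and]
      rw [eq_comm (a := d i - d x)]
    · rw [List.drop_eq_nil_iff.2 (by omega)]
      simp [hr]
  · ext l
    simp only [Finset.mem_filter, Finset.mem_Ico]
    constructor
    · rintro ⟨h1, h2, h3⟩
      refine ⟨⟨?_, h1.2⟩, h2, h3⟩
      rcases h1.1.eq_or_lt with rfl | h4
      · exact absurd h2 hh
      · exact h4
    · rintro ⟨h1, h2⟩
      exact ⟨by omega, h2⟩

/-- The value of the hidden part splits at the end of a deleted subtree. -/
theorem valOn_hid_split (hH : H.Additive) (h : Pre n d nx) {x i : ℕ} (hx : x < n) (hxi : x < i)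
    (hi : i < nx x) {S S1 S2 : Finset ℕ} (hS : S ⊆ Finset.Ico i (nx x)) (hiS : i ∈ S)
    (h1 : ∀ b, b ∈ S1 ↔ b ∈ S ∧ b < nx i) (h2 : ∀ b, b ∈ S2 ↔ b ∈ S ∧ nx i ≤ b) :
    valOn H d ((Finset.Ico i (nx x)).filter (fun l => Hid nx S x l ∧ l ∉ S)) =
      valOn H d ((Finset.Ico i (nx i)).filter (· ∉ S1)) +
      valOn H d ((Finset.Ico (nx i) (nx x)).filter (fun l => Hid nx S2 x l ∧ l ∉ S2)) ∧
    dlist d nx x S i = dlist d nx x S2 (nx i) := by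
  have hle := h.le x hx
  have hin : i < n := by omega
  have hi' := h.lt i hin
  have hlam := h.laminar hx hxi.le hi
  have hhid : ∀ l, nx i ≤ l → (Hid nx S x l ↔ Hid nx S2 x l) := by
    intro l hl
    constructor
    · rintro ⟨b, c1, c2, c3, c4⟩
      refine ⟨b, (h2 b).2 ⟨c1, ?_⟩, c2, c3, c4⟩
      by_contra hc
      have := h.laminar hin (Finset.mem_Ico.1 (hS c1)).1 (not_le.1 hc)
      omega
    · rintro ⟨b, c1, c2⟩
      exact ⟨b, ((h2 b).1 c1).1, c2⟩
  constructor
  · rw [valOn_split hH h hin hlam hle]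
    congr 2
    · refine Finset.filter_congr fun b hb => ?_
      rw [Finset.mem_Ico] at hb
      rw [h1, and_iff_left hb.2, and_iff_right]
      exact ⟨i, hiS, hxi.le, hb.1, hb.2⟩
    · refine Finset.filter_congr fun b hb => ?_
      rw [Finset.mem_Ico] at hb
      rw [h2, and_iff_left hb.1, hhid b hb.1]
  · rw [dlist_skip hi'.le hlam fun l c1 c2 => ⟨i, hiS, hxi.le, c1, c2⟩]
    unfold dlist
    congr 1
    refine List.filter_congr fun l hl => ?_
    rw [List.mem_range'_1] at hl
    rw [decide_eq_decide, hhid l hl.1]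

/-- Either `i` is deleted, its whole subtree leaves the component, and the alignment resumes at `nx
i` with the same position `r`; or `i` is the vertex at position `r`. -/
theorem valV_cases (hH : H.Additive) (h : Pre n d nx) {x i r j : ℕ} {R : List ℕ} (hx : x < n)
    (hxi : x < i) (hi : i < nx x) {v : ℝ} (hv : v ∈ valV H d nx fam q x R r i j) :
    v ∈ Conv (valD H d nx fam q i) (valV H d nx fam q x R r (nx i)) j ∨
      ((r < R.length ∧ R.getD r 0 = d i - d x) ∧ v ∈ valV H d nx fam q x R (r + 1) (i + 1) j) := by
  obtain ⟨S, hS, rfl, hN, hd, rfl⟩ := hv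
  have hle := h.le x hx
  have hin : i < n := by omega
  have hi' := h.lt i hin
  have hlam := h.laminar hx hxi.le hi
  have hmem : ∀ b ∈ S, i ≤ b ∧ b < nx x := fun b hb => Finset.mem_Ico.1 (hS hb)
  by_cases hiS : i ∈ S
  · left
    obtain ⟨e1, e2⟩ := valOn_hid_split hH h hx hxi hi hS hiS (S1 := S.filter (· < nx i))
      (S2 := S.filter (¬ · < nx i)) (fun b => by simp) (fun b => by simp)
    refine ⟨(S.filter (· < nx i)).card, (S.filter (¬ · < nx i)).card,
      Finset.card_filter_add_card_filter_not _, _, ⟨_, ?_, rfl, ?_, ?_, rfl⟩, _,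
      ⟨_, ?_, rfl, ?_, ?_, rfl⟩, e1⟩
    · intro b hb
      rw [Finset.mem_filter] at hb
      exact Finset.mem_Ico.2 ⟨(hmem b hb.1).1, hb.2⟩
    · simp [hiS, hi']
    · refine hN.congr le_rfl hlam (fun y h1 h2 b h3 h4 => ?_) fun y h1 h2 => h.lt y (by omega)
      have := h.laminar hin h1 h2
      rw [Finset.mem_filter, and_iff_left (by omega)]
    · intro b hb
      rw [Finset.mem_filter] at hb
      exact Finset.mem_Ico.2 ⟨by omega, (hmem b hb.1).2⟩
    · refine hN.congr hi'.le le_rfl (fun y h1 h2 b h3 h4 => ?_) fun y h1 h2 => h.lt y (by omega)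
      rw [Finset.mem_filter, and_iff_left (by omega)]
    · rw [← e2, hd]
  · right
    have hS' : S ⊆ Finset.Ico (i + 1) (nx x) := by
      intro b hb
      have h1 := hmem b hb
      rw [Finset.mem_Ico]
      have : b ≠ i := fun e => hiS (e ▸ hb)
      omega
    obtain ⟨e1, e2⟩ := valV_match (d := d) (R := R) (r := r) hi hS'
    refine ⟨(e1.1 hd).1, S, hS', rfl, ?_, (e1.1 hd).2, by rw [e2]⟩
    exact fun hq y h1 h2 h3 => hN hq y (by omega) h2 h3

theorem valV_of_match {x i r j : ℕ} {R : List ℕ} (hi : i < nx x) {v : ℝ} (hr : r < R.length ∧ R.getD r 0 = d i - d x)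
    (hv : v ∈ valV H d nx fam False x R (r + 1) (i + 1) j) :
    v ∈ valV H d nx fam False x R r i j := by
  obtain ⟨S, hS, rfl, -, hd, rfl⟩ := hv
  obtain ⟨e1, e2⟩ := valV_match (d := d) (R := R) (r := r) hi hS
  refine ⟨S, fun b hb => ?_, rfl, fun hq => hq.elim, e1.2 ⟨hr, hd⟩, by rw [e2]⟩
  have := Finset.mem_Ico.1 (hS hb)
  rw [Finset.mem_Ico]; omega

theorem valV_of_conv (hH : H.Additive) (h : Pre n d nx) {x i r j : ℕ} {R : List ℕ} (hx : x < n)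
    (hxi : x < i) (hi : i < nx x) {v : ℝ}
    (hv : v ∈ Conv (valD H d nx fam False i) (valV H d nx fam False x R r (nx i)) j) :
    v ∈ valV H d nx fam False x R r i j := by
  obtain ⟨_, _, rfl, _, ⟨S1, hS1, rfl, hiS, -, rfl⟩, _, ⟨S2, hS2, rfl, -, hd, rfl⟩, rfl⟩ := hv
  have hle := h.le x hx
  have hin : i < n := by omega
  have hi' := h.lt i hin
  have hlam := h.laminar hx hxi.le hi
  have h1 : ∀ b ∈ S1, i ≤ b ∧ b < nx i := fun b hb => Finset.mem_Ico.1 (hS1 hb)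
  have h2 : ∀ b ∈ S2, nx i ≤ b ∧ b < nx x := fun b hb => Finset.mem_Ico.1 (hS2 hb)
  have hS : S1 ∪ S2 ⊆ Finset.Ico i (nx x) := by
    intro b hb
    rw [Finset.mem_Ico]
    rcases Finset.mem_union.1 hb with hb | hb
    · have := h1 b hb; omega
    · have := h2 b hb; omega
  have c1 : ∀ b, b ∈ S1 ↔ b ∈ S1 ∪ S2 ∧ b < nx i := by
    intro b
    rw [Finset.mem_union]
    constructor
    · exact fun hb => ⟨Or.inl hb, (h1 b hb).2⟩
    · rintro ⟨hb | hb, h3⟩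
      · exact hb
      · have := h2 b hb; omega
  have c2 : ∀ b, b ∈ S2 ↔ b ∈ S1 ∪ S2 ∧ nx i ≤ b := by
    intro b
    rw [Finset.mem_union]
    constructor
    · exact fun hb => ⟨Or.inr hb, (h2 b hb).1⟩
    · rintro ⟨hb | hb, h3⟩
      · have := h1 b hb; omega
      · exact hb
  obtain ⟨e1, e2⟩ := valOn_hid_split hH h hx hxi hi hS (Finset.mem_union_left _ hiS) c1 c2
  refine ⟨S1 ∪ S2, hS, ?_, fun hq => hq.elim, by rw [e2, hd], e1.symm⟩
  rw [Finset.card_union_of_disjoint]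
  rw [Finset.disjoint_left]
  intro b hb hb'
  have := h1 b hb
  have := h2 b hb'
  omega

/-- Bounds for an entry of a table: it is attained in `lo`, and a lower bound for `hi`. -/
def Between (w : WithTop ℝ) (lo hi : Set ℝ) : Prop :=
  (∀ v : ℝ, w = v → v ∈ lo) ∧ ∀ v ∈ hi, w ≤ (v : ℝ)

end TreeDP


/-! ### Symbolic execution -/

namespace TreeDP

section
variable (E : Env) (Q : Store → Prop) (h : Store)

/-- Equations for rewriting. Loops have none, so that they stay folded until `wp_loop` is applied
with an invariant. -/
theorem wp_skip : wp E .skip Q h = Q h := rfl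
theorem wp_seq (P P' : Cmd) : wp E (.seq P P') Q h = wp E P (wp E P' Q) h := rfl
theorem wp_setN (x : ℕ) (e : NExp) :
    wp E (.setN x e) Q h = (e.ok E.s h ∧ Q (h.setN x (e.eval h))) := rfl
theorem wp_setW (x : ℕ) (e : WExp) :
    wp E (.setW x e) Q h = (e.ok E.s h ∧ Q (h.setW x (e.eval h))) := rfl
theorem wp_setP (x : ℕ) (e : NExp) :
    wp E (.setP x e) Q h = (e.ok E.s h ∧ Q (h.setP x (e.eval h))) := rfl
theorem wp_stN (a : ℕ) (i e : NExp) : wp E (.stN a i e) Q h =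
    ((i.ok E.s h ∧ i.eval h < E.s) ∧ e.ok E.s h ∧ Q (h.stN a (i.eval h) (e.eval h))) := rfl
theorem wp_stW (a : ℕ) (i : NExp) (e : WExp) : wp E (.stW a i e) Q h =
    ((i.ok E.s h ∧ i.eval h < E.s) ∧ e.ok E.s h ∧ Q (h.stW a (i.eval h) (e.eval h))) := rfl
theorem wp_stP (a : ℕ) (i e : NExp) : wp E (.stP a i e) Q h =
    ((i.ok E.s h ∧ i.eval h < E.s) ∧ e.ok E.s h ∧ Q (h.stP a (i.eval h) (e.eval h))) := rfl
theorem wp_ite (b : BExp) (P P' : Cmd) : wp E (.ite b P P') Q h =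
    (b.ok E.s h ∧ (b.eval h → wp E P Q h) ∧ (¬ b.eval h → wp E P' Q h)) := rfl

end

/-! ### Depth-first search -/

/-- The search from vertex `0`: array `0` holds the adjacency matrix, the arrays `1`, `2` and `3`
receive the order of the vertices, the marks of visited vertices, and the depths. -/
def dfsBody : Cmd :=
  .seq (.setN 14 (.c 0)) <| .seq (.setN 15 (.c 0)) <|
  .seq (.loop 12 (.add (.v 11) (.c 1)) (.loop 13 (.v 0)
    (.ite (.and (.eq (.ld 2 (.v 13)) (.c 0))
        (.eq (.ld 0 (.add (.mul (.ld 1 (.v 12)) (.v 0)) (.v 13))) (.c 1)))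
      (.seq (.setN 14 (.v 12)) (.setN 15 (.v 13))) .skip))) <|
  .seq (.stN 1 (.add (.v 11) (.c 1)) (.v 15)) <|
  .seq (.stN 2 (.v 15) (.c 1)) <|
  .stN 3 (.add (.v 11) (.c 1)) (.add (.ld 3 (.v 14)) (.c 1))

def dfsCmd : Cmd := .seq (.stN 2 (.c 0) (.c 1)) (.loop 11 (.sub (.v 0) (.c 1)) dfsBody)

/-- The state of the search when `p` vertices have been visited. -/
structure Dfs (n : ℕ) (a : ℕ → ℕ → Prop) (o vis d : ℕ → ℕ) (p : ℕ) : Prop where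
  lt : ∀ i < p, o i < n
  inj : ∀ i < p, ∀ j < p, o i = o j → i = j
  vis : ∀ v < n, vis v = 0 ↔ ∀ i < p, o i ≠ v
  par : ∀ q, 0 < q → q < p → ∃ i < q, d q = d i + 1 ∧ a (o i) (o q) ∧
    ∀ l, i < l → l < q → ∀ v < n, a (o l) v → ∃ m < q, o m = v
  zero : d 0 = 0

/-- The vertex `i` from which `q` was discovered is its parent by depths. A vertex `l` between them
was not discovered from before `i`: that would mean that all neighbours of `i` had been visited
before `l`, but `q` is one of them. So by induction `l` is at least as deep as `q`. -/
theorem Dfs.par_par {n p : ℕ} {a : ℕ → ℕ → Prop} {o vis d : ℕ → ℕ} (h : Dfs n a o vis d p)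
    {q : ℕ} (hq : 0 < q) (hqp : q < p) : ∃ i, Par d i q ∧ d q = d i + 1 ∧ a (o i) (o q) := by
  obtain ⟨i, hi, hd, ha, hc⟩ := h.par q hq hqp
  refine ⟨i, ⟨hi, by omega, ?_⟩, hd, ha⟩
  intro l
  induction l using Nat.strong_induction_on with
  | _ l ih =>
    intro hil hlq
    obtain ⟨i2, hi2, hd2, -, hc2⟩ := h.par l (by omega) (by omega)
    rcases lt_trichotomy i2 i with hlt | rfl | hlt
    · obtain ⟨m, hm, e⟩ := hc2 i hlt hil (o q) (h.lt q hqp) ha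
      have := h.inj m (by omega) q hqp e
      omega
    · omega
    · have := ih i2 hi2 hlt (by omega)
      omega

theorem Dfs.depth {n p : ℕ} {a : ℕ → ℕ → Prop} {o vis d : ℕ → ℕ} (h : Dfs n a o vis d p)
    {i q : ℕ} (hqp : q < p) (hi : Par d i q) : d q = d i + 1 := by
  obtain ⟨i', h1, h2, -⟩ := h.par_par (by have := hi.1; omega) hqp
  rwa [h1.unique hi] at h2

/-- By `hmax`, the search continues from the last visited vertex that has an unvisited neighbour;
this is what the last clause of `par` records. -/
theorem Dfs.step {n p : ℕ} {a : ℕ → ℕ → Prop} {o vis d : ℕ → ℕ} (h : Dfs n a o vis d (p + 1))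
    {i v : ℕ} (hi : i < p + 1) (hv : v < n) (hvis : vis v = 0) (ha : a (o i) v)
    (hmax : ∀ i' < p + 1, ∀ v' < n, vis v' = 0 → a (o i') v' → i' ≤ i) :
    Dfs n a (Function.update o (p + 1) v) (Function.update vis v 1)
      (Function.update d (p + 1) (d i + 1)) (p + 2) := by
  have ho : ∀ l < p + 1, Function.update o (p + 1) v l = o l := fun l hl => by
    rw [Function.update_of_ne (by omega)]
  have hdl : ∀ l < p + 1, Function.update d (p + 1) (d i + 1) l = d l := fun l hl => by
    rw [Function.update_of_ne (by omega)]
  have hnew := (h.vis v hv).1 hvis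
  refine ⟨fun l hl => ?_, fun l hl m hm e => ?_, fun u hu => ?_, fun q hq hqp => ?_, ?_⟩
  · rcases Nat.lt_succ_iff_lt_or_eq.1 hl with hl | rfl
    · rw [ho l hl]; exact h.lt l hl
    · rw [Function.update_self]; exact hv
  · rcases Nat.lt_succ_iff_lt_or_eq.1 hl with hl | rfl <;>
      rcases Nat.lt_succ_iff_lt_or_eq.1 hm with hm | rfl
    · rw [ho l hl, ho m hm] at e; exact h.inj l hl m hm e
    · rw [ho l hl, Function.update_self] at e; exact absurd e (hnew l hl)
    · rw [ho m hm, Function.update_self] at e; exact absurd e.symm (hnew m hm)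
    · rfl
  · by_cases huv : u = v
    · subst huv
      rw [Function.update_self]
      simp only [one_ne_zero, false_iff, not_forall]
      exact ⟨p + 1, by omega, by simp⟩
    · rw [Function.update_of_ne huv, h.vis u hu]
      constructor
      · intro h1 l hl
        rcases Nat.lt_succ_iff_lt_or_eq.1 hl with hl | rfl
        · rw [ho l hl]; exact h1 l hl
        · rw [Function.update_self]; exact Ne.symm huv
      · intro h1 l hl
        rw [← ho l hl]; exact h1 l (by omega)
  · rcases Nat.lt_succ_iff_lt_or_eq.1 hqp with hqp | rfl
    · obtain ⟨i', h1, h2, h3, h4⟩ := h.par q hq hqp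
      refine ⟨i', h1, ?_, ?_, fun l hl1 hl2 u hu hau => ?_⟩
      · rw [hdl q hqp, hdl i' (by omega)]; exact h2
      · rw [ho q hqp, ho i' (by omega)]; exact h3
      · rw [ho l (by omega)] at hau
        obtain ⟨m, hm, e⟩ := h4 l hl1 hl2 u hu hau
        exact ⟨m, hm, by rw [ho m (by omega)]; exact e⟩
    · refine ⟨i, hi, ?_, ?_, fun l hl1 hl2 u hu hau => ?_⟩
      · rw [Function.update_self, hdl i hi]
      · rw [Function.update_self, ho i hi]; exact ha
      · rw [ho l hl2] at hau
        by_contra hc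
        have : vis u = 0 := (h.vis u hu).2 fun m hm e => hc ⟨m, hm, by rw [ho m hm]; exact e⟩
        have := hmax l hl2 u hu this hau
        omega
  · rw [hdl 0 (by omega)]; exact h.zero

/-- The adjacency relation read off from a matrix. -/
def MatAdj (n : ℕ) (A : ℕ → ℕ) (u v : ℕ) : Prop := A (u * n + v) = 1

theorem mul_add_lt_sq {n u v : ℕ} (hu : u < n) (hv : v < n) : u * n + v < n * n := by
  calc u * n + v < u * n + n := by omega
    _ = (u + 1) * n := by ring
    _ ≤ n * n := Nat.mul_le_mul_right _ hu

/-- Every hit overwrites the previous one, so the last hit of the double loop has the largest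
position `i`. -/
theorem dfsBody_spec {E : Env} {n p : ℕ} {h : Store} (hn : h.n 0 = n) (hp : h.n 11 = p)
    (hpn : p + 1 < n) (hs : n * n ≤ E.s) (hM : n ≤ E.M)
    (hd : Dfs n (MatAdj n (h.A 0)) (h.A 1) (h.A 2) (h.A 3) (p + 1))
    (hex : ∃ i < p + 1, ∃ v < n, h.A 2 v = 0 ∧ MatAdj n (h.A 0) (h.A 1 i) v) :
    wp E dfsBody (fun h' => Dfs n (MatAdj n (h.A 0)) (h'.A 1) (h'.A 2) (h'.A 3) (p + 2)) h := by
  have hns : n ≤ E.s := (Nat.le_mul_self n).trans hs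
  unfold dfsBody
  rw [wp_seq, wp_setN, wp_seq, wp_setN, wp_seq]
  refine ⟨trivial, trivial, ?_⟩
  set good : ℕ → ℕ → Prop := fun i v => h.A 2 v = 0 ∧ MatAdj n (h.A 0) (h.A 1 i) v with hgood
  -- Until the first hit, both variables hold the default 0; that they are a hit is claimed only
  -- once some pair qualifies.
  refine wp_loop (m := p + 1) (fun i h' => (h'.n 14 ≤ i ∧ h'.n 14 < p + 1) ∧ h'.n 15 < n ∧ ∀ i' < i, ∀ v' < n,
    good i' v' → good (h'.n 14) (h'.n 15) ∧ i' ≤ h'.n 14) ?_ ?_ ?_ ?_ ?_ ?_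
  · exact ⟨trivial, trivial⟩
  · simp [NExp.eval, Store.setN, hp]
  · omega
  · refine ⟨?_, ?_, fun i' hi' => by omega⟩
    · simp [Store.setN, NExp.eval]
    · simp only [Store.setN, NExp.eval, Function.update_apply, if_true]; omega
  · intro i hi h1 k1 hI
    have e0 : h1.n 0 = n := (k1.n 0 rfl).trans hn
    have eA : h1.A = h.A := funext fun a => k1.A a rfl
    refine wp_loop (m := n) (fun v h' => (h'.n 14 ≤ i ∧ h'.n 14 < p + 1) ∧ h'.n 15 < n ∧ ∀ i' < i + 1, ∀ v' < n,
      (i' < i ∨ v' < v) → good i' v' → good (h'.n 14) (h'.n 15) ∧ i' ≤ h'.n 14) trivial ?_ hM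
      ?_ ?_ ?_
    · simp [NExp.eval, Store.setN, e0]
    · refine ⟨hI.1, hI.2.1, fun i' hi' v' hv' hor => ?_⟩
      exact hI.2.2 i' (by omega) v' hv'
    · intro v hv h2 k2 hJ
      have e02 : h2.n 0 = n := (k2.n 0 rfl).trans e0
      have e12 : h2.n 12 = i := k2.n 12 rfl
      have eA2 : h2.A = h.A := (funext fun a => k2.A a rfl).trans eA
      rw [wp_ite]
      simp only [BExp.ok, NExp.ok, NExp.eval, BExp.eval, wp_seq, wp_setN, wp_skip, Store.setN,
        Function.update_apply, eA2, e02, e12, 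
        Nat.reduceEqDiff, if_true, if_false, true_and, and_true]
      have hoi := hd.lt i hi
      have := mul_add_lt_sq hoi hv
      refine ⟨⟨by omega, by omega, by omega⟩, fun hb => ⟨⟨by omega, by omega⟩, by omega, ?_⟩,
        fun hb => ⟨⟨by omega, by omega⟩, by omega, ?_⟩⟩
      · exact fun i' hi' _ _ _ _ => ⟨hb, by omega⟩
      · intro i' hi' v' hv' hor hg
        refine hJ.2.2 i' hi' v' hv' ?_ hg
        by_contra hc
        have h1 : i' = i := by omega
        have h2 : v' = v := by omega
        subst h1 h2
        exact hb hg
    · intro h2 k2 hJ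
      exact ⟨by omega, hJ.2.1, fun i' hi' v' hv' => hJ.2.2 i' hi' v' hv' (Or.inr hv')⟩
  · intro h1 k1 hI
    have eA : h1.A = h.A := funext fun a => k1.A a rfl
    have e11 : h1.n 11 = p := (k1.n 11 rfl).trans hp
    obtain ⟨i, hi, v, hv, hg⟩ := hex
    obtain ⟨hg1, -⟩ := hI.2.2 i hi v hv hg
    simp only [NExp.ok, NExp.eval, wp_seq, wp_stN, Store.stN, Function.update_apply, eA, e11,
      Nat.reduceEqDiff, if_true, if_false, true_and, and_true]
    refine ⟨by omega, by omega, by omega, by omega, ?_⟩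
    exact hd.step hI.1.2 hI.2.1 hg1.1 hg1.2 fun i' hi' v' hv' h1 h2 =>
      (hI.2.2 i' hi' v' hv' ⟨h1, h2⟩).2

theorem dfsCmd_spec {E : Env} {n : ℕ} (G : SimpleGraph (Fin n)) (hG : G.IsTree) {h : Store}
    (hn : h.n 0 = n) (hs : n * n ≤ E.s) (hM : n ≤ E.M)
    (hA : ∀ u v : Fin n, MatAdj n (h.A 0) u v ↔ G.Adj u v)
    (h1 : h.A 1 = 0) (h2 : h.A 2 = 0) (h3 : h.A 3 = 0) :
    wp E dfsCmd (fun h' => Dfs n (MatAdj n (h.A 0)) (h'.A 1) (h'.A 2) (h'.A 3) n) h := by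
  have hn0 : 0 < n := by
    obtain ⟨v⟩ := hG.connected.nonempty
    have := v.2
    omega
  have hns : n ≤ E.s := (Nat.le_mul_self n).trans hs
  unfold dfsCmd
  rw [wp_seq, wp_stN]
  refine ⟨⟨trivial, by simp only [NExp.eval]; omega⟩, trivial, ?_⟩
  refine wp_loop (m := n - 1) (fun p h' => Dfs n (MatAdj n (h.A 0)) (h'.A 1) (h'.A 2) (h'.A 3)
    (p + 1)) ⟨trivial, trivial⟩ ?_ (by omega) ?_ ?_ ?_
  · simp [NExp.eval, Store.stN, hn]
  · simp only [Store.stN, Function.update_apply, NExp.eval, h1, h2, h3, Nat.reduceEqDiff, if_true, if_false]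
    refine ⟨fun i _ => hn0, fun i hi j hj _ => by omega, fun v hv => ?_, fun q h1 h2 => by omega,
      rfl⟩
    rw [Function.update_apply]
    split_ifs with h0
    · simp [h0]
    · simp only [Pi.zero_apply, true_iff]
      exact fun i hi => Ne.symm h0
  · intro p hp h' hk hd
    have eA : h'.A 0 = h.A 0 := (hk.A 0 rfl).trans (by simp [Store.stN])
    refine wp_mono _ (dfsBody_spec (n := n) (p := p) ?_ ?_ (by omega) hs hM ?_ ?_) ?_
    · simp only [Store.setN]; rw [Function.update_of_ne (by decide)]
      exact (hk.n 0 rfl).trans (by simp [Store.stN, hn])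
    · simp [Store.setN]
    · simp only [Store.setN]; rw [eA]; exact hd
    · simp only [Store.setN]
      rw [eA]
      -- If no visited vertex had an unvisited neighbour, the visited set would be closed under
      -- adjacency. By connectedness it would be everything, but it has only `p + 1 < n` elements.
      by_contra hc
      push Not at hc
      have hcl : ∀ u v : Fin n, (∃ i < p + 1, h'.A 1 i = u) → G.Adj u v →
          ∃ i < p + 1, h'.A 1 i = v := by
        rintro u v ⟨i, hi, hiu⟩ huv
        by_contra hv
        push Not at hv
        refine hc i hi v v.2 ((hd.vis v v.2).2 hv) ?_
        rw [hiu]; exact (hA u v).2 huv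
      have hall : ∀ v : Fin n, ∃ i < p + 1, h'.A 1 i = v := by
        intro v
        by_contra hv
        obtain ⟨w⟩ := hG.connected.preconnected ⟨h'.A 1 0, hd.lt 0 (by omega)⟩ v
        obtain ⟨e, -, he1, he2⟩ := w.exists_boundary_dart
          {u : Fin n | ∃ i < p + 1, h'.A 1 i = u} ⟨0, by omega, rfl⟩ hv
        exact he2 (hcl _ _ he1 e.adj)
      choose f hf using hall
      have hinj : Function.Injective (fun v => (⟨f v, (hf v).1⟩ : Fin (p + 1))) := by
        intro u v huv
        have : f u = f v := congrArg Fin.val huv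
        exact Fin.ext (by rw [← (hf u).2, ← (hf v).2, this])
      have := Fintype.card_le_of_injective _ hinj
      simp only [Fintype.card_fin] at this
      omega
    · intro h'' hd''
      simp only [Store.setN] at hd''
      rw [eA] at hd''
      exact hd''
  · intro h' hk hd
    rwa [show n - 1 + 1 = n by omega] at hd

/-- The search finds the tree. -/
theorem Dfs.exists_iso {n : ℕ} {G : SimpleGraph (Fin n)} (hG : G.IsTree) {a : ℕ → ℕ → Prop}
    {o vis d : ℕ → ℕ} (h : Dfs n a o vis d n) (ha : ∀ u v : Fin n, a u v ↔ G.Adj u v) :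
    Nonempty (preFin d n ≃g G) ∧ ∀ i, 0 < i → i < n → d 0 < d i := by
  have hroot : ∀ i, 0 < i → i < n → d 0 < d i := by
    intro i h1 h2
    obtain ⟨l, -, h3, -⟩ := h.par i h1 h2
    rw [h.zero]; omega
  refine ⟨?_, hroot⟩
  have hn0 : 0 < n := by
    obtain ⟨v⟩ := hG.connected.nonempty
    have := v.2
    omega
  set f : Fin n → Fin n := fun i => ⟨o i, h.lt i i.2⟩ with hf
  have hinj : Function.Injective f := fun i j e =>
    Fin.ext (h.inj i i.2 j j.2 (congrArg Fin.val e))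
  set e : Fin n ≃ Fin n := Equiv.ofBijective f hinj.bijective_of_finite
  have hT := preFin_isTree hn0 hroot
  have hle : preFin d n ≤ G.comap e := by
    have hpar : ∀ i j : Fin n, Par d i j → G.Adj (e i) (e j) := by
      intro i j hp
      obtain ⟨l, h1, -, h2⟩ := h.par_par (q := j) (by have := hp.1; omega) j.2
      rw [h1.unique hp] at h2
      exact (ha (e i) (e j)).1 h2
    intro i j hij
    rcases hij with hp | hp
    · exact hpar i j hp
    · exact (hpar j i hp).symm
  have hG' : (G.comap e).IsTree := (SimpleGraph.Iso.comap e G).isTree_iff.2 hG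
  -- One tree contains the other on the same vertices, and a tree is minimal among connected graphs.
  have heq : preFin d n = G.comap e :=
    le_antisymm hle ((SimpleGraph.isTree_iff_minimal_connected.1 hG').2 hT.connected hle)
  rw [heq]
  exact ⟨SimpleGraph.Iso.comap e G⟩

/-! ### Ends of subtrees -/

/-- Array `4` receives the ends of the subtrees. -/
def nextCmd : Cmd :=
  .loop 11 (.v 0) (.seq (.stN 4 (.v 11) (.v 0)) (.loop 12 (.v 0)
    (.seq (.setN 13 (.sub (.sub (.v 0) (.c 1)) (.v 12)))
      (.ite (.and (.lt (.v 11) (.v 13)) (.not (.lt (.ld 3 (.v 11)) (.ld 3 (.v 13)))))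
        (.stN 4 (.v 11) (.v 13)) .skip))))

/-- The inner loop goes down from `n - 1`, so the last entry written is the first later vertex that
is no deeper than `i`; the default is `n`. -/
theorem nextCmd_spec {E : Env} {n : ℕ} {h : Store} (hn : h.n 0 = n) (hs : n ≤ E.s) (hM : n ≤ E.M)
    (hroot : ∀ i, 0 < i → i < n → h.A 3 0 < h.A 3 i) :
    wp E nextCmd (fun h' => Pre n (h.A 3) (h'.A 4)) h := by
  set d := h.A 3 with hd
  let Ok : ℕ → ℕ → Prop := fun i e => (i < e ∧ e ≤ n) ∧ (∀ l, i < l → l < e → d i < d l) ∧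
    (e < n → d e ≤ d i)
  unfold nextCmd
  refine wp_loop (m := n) (fun i h' => ∀ i' < i, Ok i' (h'.A 4 i')) trivial hn hM
    (fun i' hi' => by omega) ?_ ?_
  · intro i hi h1 k1 hI
    have e0 : h1.n 0 = n := (k1.n 0 rfl).trans hn
    have e3 : h1.A 3 = d := k1.A 3 rfl
    rw [wp_seq, wp_stN]
    simp only [NExp.ok, NExp.eval, Store.setN, Function.update_apply, if_true, true_and]
    refine ⟨by omega, ?_⟩
    refine wp_loop (m := n) (fun l h' => (∀ i' < i, Ok i' (h'.A 4 i')) ∧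
      (i < h'.A 4 i ∧ h'.A 4 i ≤ n) ∧ (h'.A 4 i < n → d (h'.A 4 i) ≤ d i) ∧
      ∀ m, i < m → n - l ≤ m → m < h'.A 4 i → d i < d m) trivial ?_ hM ?_ ?_ ?_
    · simp [NExp.eval, Store.stN, e0]
    · simp only [Store.stN, Function.update_apply, 
        Nat.reduceEqDiff, if_true, if_false, e0]
      refine ⟨fun i' hi' => ?_, ⟨hi, le_rfl⟩, fun h => absurd h (by simp), fun m h1 h2 h3 => by omega⟩
      rw [if_neg (by omega)]
      exact hI i' hi'
    · intro l hl h2 k2 hJ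
      have e02 : h2.n 0 = n := (k2.n 0 rfl).trans (by simp [Store.stN, e0])
      have e112 : h2.n 11 = i := (k2.n 11 rfl).trans (by simp [Store.stN])
      have e32 : h2.A 3 = d := (k2.A 3 rfl).trans (by simp [Store.stN, e3])
      simp only [wp_seq, wp_setN, wp_ite, wp_stN, wp_skip, BExp.ok, BExp.eval, NExp.ok, NExp.eval,
        Store.setN, Store.stN, Function.update_apply, e02, e112, e32, Nat.reduceEqDiff,
        if_true, if_false, true_and, and_true]
      refine ⟨⟨by omega, by omega⟩, fun hb => ⟨by omega, ?_⟩, fun hb => ?_⟩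
      · refine ⟨fun i' hi' => ?_, ⟨hb.1, by omega⟩, fun _ => by omega, fun m h1 h2 h3 => by omega⟩
        rw [if_neg (by omega)]
        exact hJ.1 i' hi'
      · refine ⟨hJ.1, hJ.2.1, hJ.2.2.1, fun m h1 h2 h3 => ?_⟩
        by_cases hm : m = n - 1 - l
        · subst hm
          by_contra hc
          exact hb ⟨h1, hc⟩
        · exact hJ.2.2.2 m h1 (by omega) h3
    · intro h2 k2 hJ i' hi'
      rcases Nat.lt_succ_iff_lt_or_eq.1 hi' with hi' | rfl
      · exact hJ.1 i' hi'
      · exact ⟨hJ.2.1, fun l h1 h2 => hJ.2.2.2 l h1 (by omega) h2, hJ.2.2.1⟩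
  · intro h' hk hI
    exact ⟨fun i hi => (hI i hi).1.1, fun i hi => (hI i hi).1.2, fun i hi => (hI i hi).2.1,
      fun i hi => (hI i hi).2.2, hroot⟩

end TreeDP


/-! ### Tables of optimal values -/

namespace TreeDP

theorem Between.congr {w : WithTop ℝ} {lo lo' hi hi' : Set ℝ} (h : Between w lo hi)
    (hlo : lo ⊆ lo') (hhi : hi' ⊆ hi) : Between w lo' hi' :=
  ⟨fun v hv => hlo (h.1 v hv), fun v hv => h.2 v (hhi hv)⟩

theorem Between.top : Between ⊤ ∅ ∅ := ⟨fun v hv => by simp at hv, fun v hv => hv.elim⟩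

/-- Tables are built from minima and sums, and both halves of `Between` pass through these. -/
theorem Between.union {w w' : WithTop ℝ} {lo lo' hi hi' : Set ℝ} (h : Between w lo hi)
    (h' : Between w' lo' hi') : Between (min w w') (lo ∪ lo') (hi ∪ hi') := by
  refine ⟨fun v hv => ?_, fun v hv => ?_⟩
  · rcases min_choice w w' with e | e
    · exact Or.inl (h.1 v (e ▸ hv))
    · exact Or.inr (h'.1 v (e ▸ hv))
  · rcases hv with hv | hv
    · exact (min_le_left _ _).trans (h.2 v hv)
    · exact (min_le_right _ _).trans (h'.2 v hv)

theorem Between.add {w w' : WithTop ℝ} {lo lo' hi hi' : Set ℝ} (h : Between w lo hi)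
    (h' : Between w' lo' hi') :
    Between (w + w') {v | ∃ a ∈ lo, ∃ b ∈ lo', v = a + b} {v | ∃ a ∈ hi, ∃ b ∈ hi', v = a + b} := by
  refine ⟨fun v hv => ?_, ?_⟩
  · rw [WithTop.add_eq_coe] at hv
    obtain ⟨a, b, ha, hb, rfl⟩ := hv
    exact ⟨a, h.1 a ha.symm, b, h'.1 b hb.symm, rfl⟩
  · rintro _ ⟨a, ha, b, hb, rfl⟩
    rw [WithTop.coe_add]
    exact add_le_add (h.2 a ha) (h'.2 b hb)

theorem Between.real (r : ℝ) : Between (r : WithTop ℝ) {r} {r} :=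
  ⟨fun v hv => (WithTop.coe_injective hv).symm, fun v hv => by rw [hv]⟩

/-- The facts about the tree that the table computations use. -/
structure Base (n N : ℕ) (d nx : ℕ → ℕ) (h : Store) : Prop where
  n : h.n 0 = n
  N : h.n 2 = N
  d : h.A 3 = d
  nx : h.A 4 = nx

theorem Base.kept {n N : ℕ} {d nx : ℕ → ℕ} {h h' : Store} {P : Cmd} (hb : Base n N d nx h)
    (hk : Kept P h h') (h0 : P.mn 0 = false) (h2 : P.mn 2 = false) (h3 : P.mA 3 = false)
    (h4 : P.mA 4 = false) : Base n N d nx h' :=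
  ⟨(hk.n 0 h0).trans hb.n, (hk.n 2 h2).trans hb.N, (hk.A 3 h3).trans hb.d, (hk.A 4 h4).trans hb.nx⟩

theorem Base.setN {n N : ℕ} {d nx : ℕ → ℕ} {h : Store} (hb : Base n N d nx h) (x v : ℕ)
    (h0 : x ≠ 0) (h2 : x ≠ 2) : Base n N d nx (h.setN x v) :=
  ⟨by simp [Store.setN, h0.symm, hb.n], by simp [Store.setN, h2.symm, hb.N], hb.d, hb.nx⟩

/-- The available resources suffice for tables with rows of length `N`. -/
structure Room (E : Env) (n N : ℕ) : Prop where
  width : 2 * n + 2 ≤ N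
  space : N * N * N ≤ E.s
  rounds : N ≤ E.M

theorem Room.idx {E : Env} {n N : ℕ} (hr : Room E n N) {row j : ℕ} (h1 : row < N * N) (h2 : j < N) :
    row * N + j < E.s := by
  refine lt_of_lt_of_le ?_ hr.space
  calc row * N + j < row * N + N := by omega
    _ = (row + 1) * N := by ring
    _ ≤ N * N * N := Nat.mul_le_mul_right _ h1

theorem lt_sq {i N : ℕ} (h : i < N) : i < N * N :=
  h.trans_le (Nat.le_mul_self N)

theorem Room.lt_s {E : Env} {n N : ℕ} (hr : Room E n N) {i : ℕ} (h : i < N) : i < E.s := by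
  have := hr.idx (row := 0) (Nat.mul_pos (by omega) (by omega)) h
  simpa using this

theorem row_inj {N row row' j j' : ℕ} (h : j < N) (h' : j' < N) (e : row * N + j = row' * N + j') :
    row = row' ∧ j = j' := by
  have h1 : (row * N + j) / N = row := by
    rw [mul_comm, Nat.mul_add_div (by omega), Nat.div_eq_of_lt h, add_zero]
  have h2 : (row' * N + j') / N = row' := by
    rw [mul_comm, Nat.mul_add_div (by omega), Nat.div_eq_of_lt h', add_zero]
  have h3 : row = row' := by rw [← h1, ← h2, e]
  subst h3
  exact ⟨rfl, by omega⟩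

/-- The entries of row `row` of the table `W a`. -/
def RowBetween (n N : ℕ) (T : ℕ → WithTop ℝ) (row : ℕ) (lo hi : ℕ → Set ℝ) : Prop :=
  ∀ j ≤ n, Between (T (row * N + j)) (lo j) (hi j)

/-- The tables agree outside row `row`. -/
def EqOff (N : ℕ) (row : ℕ) (T T' : ℕ → WithTop ℝ) : Prop :=
  ∀ row' j, j < N → row' ≠ row → T' (row' * N + j) = T (row' * N + j)

theorem EqOff.refl (N row : ℕ) (T : ℕ → WithTop ℝ) : EqOff N row T T := fun _ _ _ _ => rfl

theorem EqOff.trans {N row : ℕ} {T T' T'' : ℕ → WithTop ℝ} (h : EqOff N row T T')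
    (h' : EqOff N row T' T'') : EqOff N row T T'' :=
  fun r j hj hr => (h' r j hj hr).trans (h r j hj hr)

theorem EqOff.update {N row j : ℕ} {T T' : ℕ → WithTop ℝ} (h : EqOff N row T T') (hj : j < N)
    (v : WithTop ℝ) : EqOff N row T (Function.update T' (row * N + j) v) := by
  intro r l hl hr
  rw [Function.update_of_ne (fun e => hr (row_inj hl hj e).1)]
  exact h r l hl hr

theorem EqOff.row {n N row row' : ℕ} {T T' : ℕ → WithTop ℝ} (h : EqOff N row T T') (hn : n < N)
    (hr : row' ≠ row) {lo hi : ℕ → Set ℝ} (hb : RowBetween n N T row' lo hi) :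
    RowBetween n N T' row' lo hi := fun j hj => by
  rw [h row' j (by omega) hr]; exact hb j hj

/-- The convolution of row `n 23` of `W b` and row `n 24` of `W c` into row `n 22` of `W a`. -/
def convCmd (a b c : ℕ) : Cmd :=
  .loop 20 (.add (.v 0) (.c 1)) <|
    .seq (.setW 2 .top) <|
    .seq (.loop 21 (.add (.v 20) (.c 1)) (.ite
      (.wle (.v 2) (.add (.ld b (.add (.mul (.v 23) (.v 2)) (.v 21)))
        (.ld c (.add (.mul (.v 24) (.v 2)) (.sub (.v 20) (.v 21)))))) .skip
      (.setW 2 (.add (.ld b (.add (.mul (.v 23) (.v 2)) (.v 21)))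
        (.ld c (.add (.mul (.v 24) (.v 2)) (.sub (.v 20) (.v 21)))))))) <|
    .stW a (.add (.mul (.v 22) (.v 2)) (.v 20)) (.v 2)

/-- The tables `a` and `c` may coincide, as long as the row read differs from the row written. The
forest and alignment tables are filled in place this way. -/
theorem convCmd_spec {E : Env} {n N : ℕ} (hr : Room E n N) {a b c : ℕ} (hab : a ≠ b) {h : Store}
    (hn : h.n 0 = n) (hN : h.n 2 = N) {r0 r1 r2 : ℕ} (e0 : h.n 22 = r0) (e1 : h.n 23 = r1)
    (e2 : h.n 24 = r2) (b0 : r0 < N * N) (b1 : r1 < N * N) (b2 : r2 < N * N) (hac : r2 ≠ r0)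
    {lo hi lo' hi' : ℕ → Set ℝ} (h1 : RowBetween n N (h.W b) r1 lo hi)
    (h2 : RowBetween n N (h.W c) r2 lo' hi') :
    wp E (convCmd a b c) (fun h' => RowBetween n N (h'.W a) r0 (Conv lo lo') (Conv hi hi') ∧
      EqOff N r0 (h.W a) (h'.W a)) h := by
  have hnN : n + 1 < N := by have := hr.width; omega
  have hM := hr.rounds
  unfold convCmd
  refine wp_loop (m := n + 1) (fun j h' => (∀ l < j, Between (h'.W a (r0 * N + l)) (Conv lo lo' l)
    (Conv hi hi' l)) ∧ EqOff N r0 (h.W a) (h'.W a)) ⟨trivial, trivial⟩ (by simp [NExp.eval, hn])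
    (by omega) ⟨fun l hl => by omega, EqOff.refl _ _ _⟩ ?_ ?_
  · intro j hj h' hk ⟨hI1, hI2⟩
    have hWb : h'.W b = h.W b := hk.W b (by simp [Cmd.mW, hab.symm])
    have hWc : RowBetween n N (h'.W c) r2 lo' hi' := by
      by_cases hca : c = a
      · subst hca; exact hI2.row (by omega) hac h2
      · rw [hk.W c (by simp [Cmd.mW, hca])]; exact h2
    have f0 : h'.n 2 = N := (hk.n 2 rfl).trans hN
    have f1 : h'.n 22 = r0 := (hk.n 22 rfl).trans e0
    have f2 : h'.n 23 = r1 := (hk.n 23 rfl).trans e1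
    have f3 : h'.n 24 = r2 := (hk.n 24 rfl).trans e2
    rw [wp_seq, wp_setW, wp_seq]
    refine ⟨trivial, ?_⟩
    refine wp_loop (m := j + 1) (fun t h'' => Between (h''.w 2)
      {v | ∃ j1 j2, j1 + j2 = j ∧ j1 < t ∧ ∃ x ∈ lo j1, ∃ y ∈ lo' j2, v = x + y}
      {v | ∃ j1 j2, j1 + j2 = j ∧ j1 < t ∧ ∃ x ∈ hi j1, ∃ y ∈ hi' j2, v = x + y})
      ⟨trivial, trivial⟩ ?_ (by omega) ?_ ?_ ?_
    · simp [NExp.eval, Store.setN, Store.setW]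
    · refine (Between.top.congr (Set.empty_subset _) ?_ : _)
      rintro v ⟨j1, j2, _, h, _⟩
      omega
    · intro t ht h'' hk' hJ
      have g0 : h''.n 2 = N := (hk'.n 2 rfl).trans (by simp [Store.setN, Store.setW, f0])
      have g2 : h''.n 23 = r1 := (hk'.n 23 rfl).trans (by simp [Store.setN, Store.setW, f2])
      have g3 : h''.n 24 = r2 := (hk'.n 24 rfl).trans (by simp [Store.setN, Store.setW, f3])
      have g4 : h''.n 20 = j := (hk'.n 20 rfl).trans (by simp [Store.setN, Store.setW])
      have gb : h''.W b = h.W b := (hk'.W b rfl).trans hWb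
      have gc : h''.W c = h'.W c := hk'.W c rfl
      have i1 := hr.idx b1 (j := t) (by omega)
      have i2 := hr.idx b2 (j := j - t) (by omega)
      have key := hJ.union ((h1 t (by omega)).add (hWc (j - t) (by omega)))
      simp only [wp_ite, wp_skip, wp_setW, BExp.ok, BExp.eval, WExp.ok, WExp.eval, NExp.ok,
        NExp.eval, Store.setN, Store.setW, Function.update_apply, g0, g2, g3, g4, gb, gc,
        Nat.reduceEqDiff, if_true, if_false, true_and, and_true, not_le]
      refine ⟨⟨i1, i2⟩, fun hb => ?_, fun hb => ⟨⟨i1, i2⟩, ?_⟩⟩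
      · rw [min_eq_left hb] at key
        refine key.congr ?_ ?_
        · rintro v (⟨j1, j2, c1, c2, c3⟩ | c)
          · exact ⟨j1, j2, c1, by omega, c3⟩
          · exact ⟨t, j - t, by omega, by omega, c⟩
        · rintro v ⟨j1, j2, c1, c2, c3⟩
          rcases Nat.lt_succ_iff_lt_or_eq.1 c2 with c2 | rfl
          · exact Or.inl ⟨j1, j2, c1, c2, c3⟩
          · right
            rwa [show j2 = j - j1 by omega] at c3
      · rw [min_eq_right hb.le] at key
        refine key.congr ?_ ?_
        · rintro v (⟨j1, j2, c1, c2, c3⟩ | c)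
          · exact ⟨j1, j2, c1, by omega, c3⟩
          · exact ⟨t, j - t, by omega, by omega, c⟩
        · rintro v ⟨j1, j2, c1, c2, c3⟩
          rcases Nat.lt_succ_iff_lt_or_eq.1 c2 with c2 | rfl
          · exact Or.inl ⟨j1, j2, c1, c2, c3⟩
          · right
            rwa [show j2 = j - j1 by omega] at c3
    · intro h'' hk' hJ
      have g0 : h''.n 2 = N := (hk'.n 2 rfl).trans (by simp [Store.setN, Store.setW, f0])
      have g2 : h''.n 22 = r0 := (hk'.n 22 rfl).trans (by simp [Store.setN, Store.setW, f1])
      have g4 : h''.n 20 = j := (hk'.n 20 rfl).trans (by simp [Store.setN, Store.setW])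
      have ga : h''.W a = h'.W a := hk'.W a rfl
      simp only [wp_stW, WExp.ok, WExp.eval, NExp.ok, NExp.eval, Store.stW, Function.update_apply,
        g0, g2, g4, if_true, true_and, and_true]
      refine ⟨hr.idx b0 (by omega), fun l hl => ?_, ?_⟩
      · rcases Nat.lt_succ_iff_lt_or_eq.1 hl with hl | rfl
        · rw [if_neg (fun e => by have := (row_inj (by omega) (by omega) e).2; omega), ga]
          exact hI1 l hl
        · rw [if_pos rfl]
          refine hJ.congr ?_ ?_
          · rintro v ⟨j1, j2, c1, c2, c3⟩
            exact ⟨j1, j2, c1, c3⟩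
          · rintro v ⟨j1, j2, c1, c3⟩
            exact ⟨j1, j2, c1, by omega, c3⟩
      · rw [ga]
        exact hI2.update (by omega) _
  · intro h' hk hI
    exact ⟨fun j hj => hI.1 j (by omega), hI.2⟩

/-- Sets row `n 22` of `W a` to `⊤`, except that the first entry is `0` if `n 25 = 1`. -/
def initCmd (a : ℕ) : Cmd :=
  .seq (.loop 20 (.add (.v 0) (.c 1)) (.stW a (.add (.mul (.v 22) (.v 2)) (.v 20)) .top)) <|
  .ite (.eq (.v 25) (.c 1)) (.stW a (.mul (.v 22) (.v 2)) (.real 0)) .skip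

theorem initCmd_spec {E : Env} {n N : ℕ} (hr : Room E n N) {a : ℕ} {h : Store} (hn : h.n 0 = n)
    (hN : h.n 2 = N) {r0 : ℕ} (e0 : h.n 22 = r0) (b0 : r0 < N * N) :
    wp E (initCmd a) (fun h' => RowBetween n N (h'.W a) r0
      (fun j => {v | (j = 0 ∧ h.n 25 = 1) ∧ v = 0}) (fun j => {v | (j = 0 ∧ h.n 25 = 1) ∧ v = 0}) ∧
      EqOff N r0 (h.W a) (h'.W a)) h := by
  have hnN : n + 1 < N := by have := hr.width; omega
  have hM := hr.rounds
  unfold initCmd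
  rw [wp_seq]
  refine wp_loop (m := n + 1) (fun j h' => (∀ l < j, h'.W a (r0 * N + l) = ⊤) ∧
    EqOff N r0 (h.W a) (h'.W a)) ⟨trivial, trivial⟩ (by simp [NExp.eval, hn]) (by omega)
    ⟨fun l hl => by omega, EqOff.refl _ _ _⟩ ?_ ?_
  · intro j hj h' hk ⟨hI1, hI2⟩
    have f0 : h'.n 2 = N := (hk.n 2 rfl).trans hN
    have f1 : h'.n 22 = r0 := (hk.n 22 rfl).trans e0
    simp only [wp_stW, WExp.ok, WExp.eval, NExp.ok, NExp.eval, Store.setN, Store.stW,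
      Function.update_apply, f0, f1, Nat.reduceEqDiff, if_true, if_false, true_and, and_true]
    refine ⟨hr.idx b0 (by omega), fun l hl => ?_, hI2.update (by omega) _⟩
    split_ifs with e
    · rfl
    · refine hI1 l ?_
      rcases Nat.lt_succ_iff_lt_or_eq.1 hl with hl | rfl
      · exact hl
      · exact absurd rfl e
  · intro h' hk ⟨hI1, hI2⟩
    have f0 : h'.n 2 = N := (hk.n 2 rfl).trans hN
    have f1 : h'.n 22 = r0 := (hk.n 22 rfl).trans e0
    have f2 : h'.n 25 = h.n 25 := hk.n 25 rfl
    have i0 := hr.idx b0 (j := 0) (by omega)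
    simp only [wp_ite, wp_skip, wp_stW, BExp.ok, BExp.eval, WExp.ok, WExp.eval, NExp.ok, NExp.eval,
      Store.stW, Function.update_apply, f0, f1, f2, if_true, true_and, and_true]
    refine ⟨fun hb => ⟨i0, fun j hj => ?_, hI2.update (j := 0) (by omega) _⟩,
      fun hb => ⟨fun j hj => ?_, hI2⟩⟩
    · by_cases hj0 : j = 0
      · subst hj0
        rw [add_zero, Function.update_self]
        refine (Between.real 0).congr ?_ ?_
        · rintro v rfl; exact ⟨⟨rfl, hb⟩, rfl⟩
        · rintro v ⟨-, rfl⟩; rfl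
      · rw [Function.update_of_ne (by omega), hI1 j (by omega)]
        refine Between.top.congr (Set.empty_subset _) ?_
        rintro v ⟨⟨h, -⟩, -⟩; exact hj0 h
    · rw [hI1 j (by omega)]
      refine Between.top.congr (Set.empty_subset _) ?_
      rintro v ⟨⟨-, h⟩, -⟩; exact hb h

/-- Row `n 22` of `W a` becomes its minimum with `w 3` plus row `n 26` of `W b`. -/
def minCmd (a b : ℕ) : Cmd :=
  .loop 20 (.add (.v 0) (.c 1)) (.ite (.wle (.ld a (.add (.mul (.v 22) (.v 2)) (.v 20)))
      (.add (.v 3) (.ld b (.add (.mul (.v 26) (.v 2)) (.v 20))))) .skip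
    (.stW a (.add (.mul (.v 22) (.v 2)) (.v 20))
      (.add (.v 3) (.ld b (.add (.mul (.v 26) (.v 2)) (.v 20))))))

/-- Both tables may coincide if the rows differ. The invariant also has to say that entries not yet
reached are the original ones, as the row is updated in place. -/
theorem minCmd_spec {E : Env} {n N : ℕ} (hr : Room E n N) {a b : ℕ} {h : Store} (hn : h.n 0 = n)
    (hN : h.n 2 = N) {r0 r1 : ℕ} (e0 : h.n 22 = r0) (e1 : h.n 26 = r1) (b0 : r0 < N * N)
    (b1 : r1 < N * N) (hab : r1 ≠ r0 ∨ a ≠ b) {u : ℝ} (hu : h.w 3 = u) {lo hi lo' hi' : ℕ → Set ℝ}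
    (h1 : RowBetween n N (h.W a) r0 lo hi) (h2 : RowBetween n N (h.W b) r1 lo' hi') :
    wp E (minCmd a b) (fun h' => RowBetween n N (h'.W a) r0
      (fun j => lo j ∪ {v | ∃ y ∈ lo' j, v = u + y}) (fun j => hi j ∪ {v | ∃ y ∈ hi' j, v = u + y}) ∧
      EqOff N r0 (h.W a) (h'.W a)) h := by
  have hnN : n + 1 < N := by have := hr.width; omega
  have hM := hr.rounds
  unfold minCmd
  refine wp_loop (m := n + 1) (fun j h' => (∀ l < j, Between (h'.W a (r0 * N + l))
    (lo l ∪ {v | ∃ y ∈ lo' l, v = u + y}) (hi l ∪ {v | ∃ y ∈ hi' l, v = u + y})) ∧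
    (∀ l, j ≤ l → l ≤ n → h'.W a (r0 * N + l) = h.W a (r0 * N + l)) ∧
    EqOff N r0 (h.W a) (h'.W a)) ⟨trivial, trivial⟩ (by simp [NExp.eval, hn]) (by omega)
    ⟨fun l hl => by omega, fun _ _ _ => rfl, EqOff.refl _ _ _⟩ ?_ ?_
  · intro j hj h' hk ⟨hI1, hI2, hI3⟩
    have hWb : RowBetween n N (h'.W b) r1 lo' hi' := by
      by_cases hba : b = a
      · subst hba
        exact hI3.row (by omega) (hab.resolve_right (fun e => e rfl)) h2
      · rw [hk.W b (by simp [Cmd.mW, hba])]; exact h2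
    have f0 : h'.n 2 = N := (hk.n 2 rfl).trans hN
    have f1 : h'.n 22 = r0 := (hk.n 22 rfl).trans e0
    have f2 : h'.n 26 = r1 := (hk.n 26 rfl).trans e1
    have f3 : h'.w 3 = u := (hk.w 3 rfl).trans hu
    have i0 := hr.idx b0 (j := j) (by omega)
    have i1 := hr.idx b1 (j := j) (by omega)
    have key := (h1 j (by omega)).union ((Between.real u).add (hWb j (by omega)))
    rw [← hI2 j le_rfl (by omega)] at key
    have hs : ∀ A B : Set ℝ, A ∪ {v | ∃ x ∈ ({u} : Set ℝ), ∃ y ∈ B, v = x + y} =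
        A ∪ {v | ∃ y ∈ B, v = u + y} := fun A B => by simp
    rw [hs, hs] at key
    simp only [wp_ite, wp_skip, wp_stW, BExp.ok, BExp.eval, WExp.ok, WExp.eval, NExp.ok, NExp.eval,
      Store.setN, Store.stW, Function.update_apply, f0, f1, f2, f3, Nat.reduceEqDiff, if_true,
      if_false, true_and, and_true, not_le]
    refine ⟨⟨i0, i1⟩, fun hb => ⟨fun l hl => ?_, fun l h1 h2 => hI2 l (by omega) h2, hI3⟩,
      fun hb => ⟨i0, i1, fun l hl => ?_, fun l h1 h2 => ?_, hI3.update (by omega) _⟩⟩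
    · rcases Nat.lt_succ_iff_lt_or_eq.1 hl with hl | rfl
      · exact hI1 l hl
      · rwa [min_eq_left hb] at key
    · rcases Nat.lt_succ_iff_lt_or_eq.1 hl with hl | rfl
      · rw [if_neg (fun e => by have := (row_inj (by omega) (by omega) e).2; omega)]
        exact hI1 l hl
      · rwa [if_pos rfl, ← min_eq_right hb.le]
    · rw [if_neg (fun e => by have := (row_inj (by omega) (by omega) e).2; omega)]
      exact hI2 l (by omega) h2
  · intro h' hk hI
    exact ⟨fun j hj => hI.1 j (by omega), hI.2.2⟩

end TreeDP


/-! ### Tables for forests, deleted roots and alignments -/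

namespace TreeDP

variable {H : GraphMeasure} {n : ℕ} {d nx : ℕ → ℕ} {fam : ℕ → Set (List ℕ)}

/-- The forests that follow the vertices of the subtree at `x = n 10`, in the table `W 2`. -/
def forestCmd : Cmd :=
  .seq (.setN 22 (.ld 4 (.v 10))) <| .seq (.setN 25 (.c 1)) <| .seq (initCmd 2) <|
  .loop 12 (.sub (.sub (.ld 4 (.v 10)) (.v 10)) (.c 1)) <|
    .seq (.setN 13 (.sub (.sub (.ld 4 (.v 10)) (.c 1)) (.v 12))) <|
    .seq (.setN 22 (.v 13)) <| .seq (.setN 23 (.v 13)) <| .seq (.setN 24 (.ld 4 (.v 13))) <|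
    convCmd 2 0 2

variable (H n d nx fam) in
/-- The table for whole subtrees is correct from `x` on. -/
def SubtreesOk (N : ℕ) (T : ℕ → WithTop ℝ) (x : ℕ) : Prop :=
  ∀ i, x ≤ i → i < n → RowBetween n N T i (valI H d nx fam False i (nx i))
    (valI H d nx fam True i (nx i))

variable (H n d nx fam) in
/-- The table for subtrees with deleted roots is correct from `x` on. -/
def DeletedOk (N : ℕ) (T : ℕ → WithTop ℝ) (x : ℕ) : Prop :=
  ∀ i, x ≤ i → i < n → RowBetween n N T i (valD H d nx fam False i) (valD H d nx fam True i)

/-- Row `nx x` is the empty forest. Going left, row `i` is the convolution of the row of the subtree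
at `i` with the forest row at `nx i`. -/
theorem forestCmd_spec (hH : H.Additive) (hp : Pre n d nx) {E : Env} {N : ℕ} (hr : Room E n N)
    {h : Store} (hb : Base n N d nx h) {x : ℕ} (hx : x < n) (h10 : h.n 10 = x)
    (hM : SubtreesOk H n d nx fam N (h.W 0) (x + 1)) :
    wp E forestCmd (fun h' => ∀ i, x < i → i ≤ nx x → RowBetween n N (h'.W 2) i
      (valI H d nx fam False i (nx x)) (valI H d nx fam True i (nx x))) h := by
  have hxlt := hp.lt x hx
  have hxle := hp.le x hx
  have hw := hr.width
  have hrounds := hr.rounds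
  unfold forestCmd
  rw [wp_seq, wp_setN, wp_seq, wp_setN]
  refine ⟨⟨trivial, ?_⟩, trivial, ?_⟩
  · simp only [NExp.eval, h10]; exact hr.lt_s (by omega)
  refine wp_seq_of (initCmd_spec hr (n := n) (N := N) (r0 := nx x) ?_ ?_ ?_
    (lt_sq (by omega))) ?_
  · simp [Store.setN, hb.n]
  · simp [Store.setN, hb.N]
  · simp [Store.setN, NExp.eval, h10, hb.nx]
  rintro h1 ⟨hrow, -⟩ hk1
  have hb1 : Base n N d nx h1 :=
    ((hb.setN 22 _ (by decide) (by decide)).setN 25 _ (by decide) (by decide)).kept hk1 rfl rfl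
      rfl rfl
  have h110 : h1.n 10 = x := (hk1.n 10 rfl).trans (by simp [Store.setN, h10])
  have hM1 : h1.W 0 = h.W 0 := hk1.W 0 rfl
  refine wp_loop (m := nx x - x - 1) (fun t h' => ∀ i, nx x - t ≤ i → i ≤ nx x →
    RowBetween n N (h'.W 2) i (valI H d nx fam False i (nx x)) (valI H d nx fam True i (nx x)))
    ?_ ?_ (by omega) ?_ ?_ ?_
  · simp only [NExp.ok, NExp.eval, h110, and_true, true_and]; exact hr.lt_s (by omega)
  · simp [NExp.eval, hb1.nx, h110]
  · intro i hi1 hi2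
    have hi : i = nx x := by omega
    subst hi
    refine fun j hj => (hrow j hj).congr ?_ ?_
    · rintro v ⟨⟨h1, -⟩, h2⟩
      exact (valI_empty hH).2 ⟨h1, h2⟩
    · intro v hv
      obtain ⟨h1, h2⟩ := (valI_empty hH).1 hv
      exact ⟨⟨h1, by simp [Store.setN, NExp.eval]⟩, h2⟩
  · intro t ht h2 hk2 hI
    have hb2 : Base n N d nx h2 := hb1.kept hk2 rfl rfl rfl rfl
    have h210 : h2.n 10 = x := (hk2.n 10 rfl).trans h110
    have hM2 : h2.W 0 = h.W 0 := (hk2.W 0 rfl).trans hM1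
    have hin : nx x - 1 - t < n := by omega
    have hnx := hp.laminar hx (l := nx x - 1 - t) (by omega) (by omega)
    have hnx' := hp.lt _ hin
    simp only [wp_seq, wp_setN, NExp.ok, NExp.eval, Store.setN, Function.update_apply, h210,
      hb2.nx, Nat.reduceEqDiff, if_true, if_false, true_and, and_true]
    refine ⟨hr.lt_s (by omega), hr.lt_s (by omega), ?_⟩
    refine wp_mono _ (convCmd_spec hr (r0 := nx x - 1 - t) (r1 := nx x - 1 - t)
      (r2 := nx (nx x - 1 - t)) (by decide) ?_ ?_ ?_ ?_ ?_ (lt_sq (by omega))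
      (lt_sq (by omega)) (lt_sq (by omega)) (by omega)
      (h1 := by simp only []; rw [hM2]; exact hM _ (by omega) hin)
      (h2 := hI _ (by omega) hnx)) ?_
    · simp [hb2.n]
    · simp [hb2.N]
    · simp
    · simp
    · simp
    · rintro h3 ⟨hrow3, hoff⟩ i hi1 hi2
      by_cases hi : i = nx x - 1 - t
      · subst hi
        refine fun j hj => (hrow3 j hj).congr ?_ ?_
        · exact fun v hv => valI_glue hH hp hin hnx hxle hv
        · exact fun v hv => valI_split hH hp hin hnx hxle hv
      · exact hoff.row (by omega) hi (hI i (by omega) hi2)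
  · intro h2 hk2 hI i h3 h4
    exact hI i (by omega) h4

/-- The row of `x = n 10` in the tables `W 1` and `W 0`, with `x` deleted. -/
def deletedCmd : Cmd :=
  .seq (.stW 1 (.mul (.v 10) (.v 2)) .top) <|
  .seq (.loop 20 (.v 0) (.stW 1 (.add (.mul (.v 10) (.v 2)) (.add (.v 20) (.c 1)))
    (.ld 2 (.add (.mul (.add (.v 10) (.c 1)) (.v 2)) (.v 20))))) <|
  .loop 20 (.add (.v 0) (.c 1)) (.stW 0 (.add (.mul (.v 10) (.v 2)) (.v 20))
    (.ld 1 (.add (.mul (.v 10) (.v 2)) (.v 20))))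

/-- The row of the forest at `x + 1` is shifted by one for the deletion of `x`. Its copy in the
table of whole subtrees is the starting value, to be lowered by components that contain `x`. -/
theorem deletedCmd_spec (hp : Pre n d nx) {E : Env} {N : ℕ} (hr : Room E n N)
    {h : Store} (hb : Base n N d nx h) {x : ℕ} (hx : x < n) (h10 : h.n 10 = x)
    (hF : RowBetween n N (h.W 2) (x + 1)
      (valI H d nx fam False (x + 1) (nx x)) (valI H d nx fam True (x + 1) (nx x))) :
    wp E deletedCmd (fun h' =>
      (RowBetween n N (h'.W 1) x (valD H d nx fam False x) (valD H d nx fam True x) ∧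
        EqOff N x (h.W 1) (h'.W 1)) ∧
      (RowBetween n N (h'.W 0) x (valD H d nx fam False x) (valD H d nx fam True x) ∧
        EqOff N x (h.W 0) (h'.W 0))) h := by
  have hw := hr.width
  have hrounds := hr.rounds
  have hxN : x < N * N := lt_sq (by omega)
  have hx1N : x + 1 < N * N := lt_sq (by omega)
  unfold deletedCmd
  rw [wp_seq, wp_stW, wp_seq]
  refine ⟨⟨⟨trivial, trivial⟩, ?_⟩, trivial, ?_⟩
  · simp only [NExp.eval, h10, hb.N]; exact hr.idx hxN (j := 0) (by omega)
  refine wp_loop (m := n) (fun t h' => (h'.W 1 (x * N) = ⊤ ∧ ∀ l < t,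
    h'.W 1 (x * N + (l + 1)) = h.W 2 ((x + 1) * N + l)) ∧ EqOff N x (h.W 1) (h'.W 1))
    trivial ?_ (by omega) ?_ ?_ ?_
  · simp [NExp.eval, Store.stW, hb.n]
  · refine ⟨⟨by simp [Store.stW, NExp.eval, WExp.eval, h10, hb.N], fun l hl => by omega⟩, ?_⟩
    simp only [Store.stW, NExp.eval, h10, hb.N, Function.update_self]
    exact (EqOff.refl N x _).update (j := 0) (by omega) _
  · intro t ht h1 hk1 hI
    have e10 : h1.n 10 = x := (hk1.n 10 rfl).trans h10
    have e2 : h1.n 2 = N := (hk1.n 2 rfl).trans hb.N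
    have eW : h1.W 2 = h.W 2 := hk1.W 2 rfl
    simp only [wp_stW, NExp.ok, WExp.ok, NExp.eval, WExp.eval, Store.setN, Store.stW, e10, e2, eW,
      Function.update_apply, Nat.reduceEqDiff, if_true, if_false, true_and, and_true]
    refine ⟨hr.idx hxN (by omega), hr.idx hx1N (by omega), ⟨?_, fun l hl => ?_⟩,
      hI.2.update (by omega) _⟩
    · rw [if_neg (by omega)]; exact hI.1.1
    · rcases Nat.lt_succ_iff_lt_or_eq.1 hl with hl | rfl
      · rw [if_neg (by omega)]; exact hI.1.2 l hl
      · rw [if_pos rfl]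
  · rintro h1 hk1 ⟨⟨hI1, hI2⟩, hI3⟩
    have hD : RowBetween n N (h1.W 1) x (valD H d nx fam False x) (valD H d nx fam True x) := by
      intro j hj
      rcases j with _ | j
      · rw [add_zero, hI1]
        exact Between.top.congr (Set.empty_subset _) fun v hv => (valD_zero hv).elim
      · rw [hI2 j (by omega)]
        exact (hF j (by omega)).congr (fun v hv => (valD_succ hp hx).2 hv)
          fun v hv => (valD_succ hp hx).1 hv
    have e10 : h1.n 10 = x := (hk1.n 10 rfl).trans h10
    have e2 : h1.n 2 = N := (hk1.n 2 rfl).trans hb.N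
    have e0 : h1.n 0 = n := (hk1.n 0 rfl).trans hb.n
    have eW : h1.W 0 = h.W 0 := hk1.W 0 rfl
    refine wp_loop (m := n + 1) (fun t h' => (∀ l < t, h'.W 0 (x * N + l) = h1.W 1 (x * N + l)) ∧
      EqOff N x (h.W 0) (h'.W 0)) ⟨trivial, trivial⟩ ?_ (by omega) ?_ ?_ ?_
    · simp [NExp.eval, e0]
    · exact ⟨fun l hl => by omega, by rw [eW]; exact EqOff.refl _ _ _⟩
    · intro t ht h2 hk2 hJ
      have f10 : h2.n 10 = x := (hk2.n 10 rfl).trans e10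
      have f2 : h2.n 2 = N := (hk2.n 2 rfl).trans e2
      have fW : h2.W 1 = h1.W 1 := hk2.W 1 rfl
      simp only [wp_stW, NExp.ok, WExp.ok, NExp.eval, WExp.eval, Store.setN, Store.stW, f10, f2,
        fW, Function.update_apply, Nat.reduceEqDiff, if_true, if_false, true_and, and_true]
      have := hr.idx hxN (j := t) (by omega)
      refine ⟨this, this, fun l hl => ?_, hJ.2.update (by omega) _⟩
      rcases Nat.lt_succ_iff_lt_or_eq.1 hl with hl | rfl
      · rw [if_neg (by omega)]; exact hJ.1 l hl
      · rw [if_pos rfl]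
    · intro h2 hk2 hJ
      have fW : h2.W 1 = h1.W 1 := hk2.W 1 rfl
      rw [fW]
      refine ⟨⟨hD, hI3⟩, fun j hj => ?_, hJ.2⟩
      rw [hJ.1 j (by omega)]
      exact hD j hj

/-- The alignment of the subtree at `x = n 10` with the list in `A 6` of length `n 17`. -/
def alignCellCmd : Cmd :=
  .seq (.setN 22 (.add (.mul (.v 13) (.v 2)) (.v 14))) <|
  .seq (.setN 23 (.v 13)) <|
  .seq (.setN 24 (.add (.mul (.ld 4 (.v 13)) (.v 2)) (.v 14))) <|
  .seq (convCmd 3 1 3) <|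
  .ite (.and (.lt (.v 14) (.v 17))
      (.eq (.ld 6 (.v 14)) (.sub (.ld 3 (.v 13)) (.ld 3 (.v 10)))))
    (.seq (.setN 26 (.add (.mul (.add (.v 13) (.c 1)) (.v 2)) (.add (.v 14) (.c 1))))
      (minCmd 3 3)) .skip

/-- Row `i * N + r` of `W 3` belongs to vertex `i` and position `r` of the list. Setting `w 3` to 0
makes `minCmd` a plain minimum of two rows. -/
def alignCmd : Cmd :=
  .seq (.setW 3 (.real 0)) <|
  .seq (.loop 14 (.add (.v 17) (.c 1))
    (.seq (.setN 22 (.add (.mul (.ld 4 (.v 10)) (.v 2)) (.v 14)))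
      (.seq (.ite (.lt (.v 14) (.v 17)) (.setN 25 (.c 0)) (.setN 25 (.c 1))) (initCmd 3)))) <|
  .loop 12 (.sub (.sub (.ld 4 (.v 10)) (.v 10)) (.c 1)) <|
    .seq (.setN 13 (.sub (.sub (.ld 4 (.v 10)) (.c 1)) (.v 12))) <|
    .loop 14 (.add (.v 17) (.c 1)) alignCellCmd

/-- The list `R` is stored in `A 6`, and its length in `n 17`. -/
structure Stored (R : List ℕ) (h : Store) : Prop where
  len : h.n 17 = R.length
  val : ∀ i < R.length, h.A 6 i = R.getD i 0

/-- The convolution is the case that `i` is deleted; the minimum with row `(i + 1, r + 1)` is the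
case that `i` is matched, available only if the depths agree. -/
theorem alignCellCmd_spec (hH : H.Additive) (hp : Pre n d nx) {E : Env} {N : ℕ} (hr : Room E n N)
    {h : Store} (hb : Base n N d nx h) {x i r : ℕ} {R : List ℕ} (hx : x < n) (h10 : h.n 10 = x)
    (hxi : x < i) (hi : i < nx x) (h13 : h.n 13 = i) (h14 : h.n 14 = r) (hR : Stored R h)
    (hrR : r ≤ R.length) (hlen : R.length < N) (hw3 : h.w 3 = (0 : ℝ))
    (hD : DeletedOk H n d nx fam N (h.W 1) (x + 1))
    (hV1 : RowBetween n N (h.W 3) (nx i * N + r) (valV H d nx fam False x R r (nx i))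
      (valV H d nx fam True x R r (nx i)))
    (hV2 : r < R.length → RowBetween n N (h.W 3) ((i + 1) * N + (r + 1))
      (valV H d nx fam False x R (r + 1) (i + 1)) (valV H d nx fam True x R (r + 1) (i + 1))) :
    wp E alignCellCmd (fun h' => RowBetween n N (h'.W 3) (i * N + r)
      (valV H d nx fam False x R r i) (valV H d nx fam True x R r i) ∧
      EqOff N (i * N + r) (h.W 3) (h'.W 3)) h := by
  have hw := hr.width
  have hxle := hp.le x hx
  have hin : i < n := by omega
  have hnxi := hp.lt i hin
  have hnxle := hp.le i hin
  have hrow : i * N + r < N * N := mul_add_lt_sq (by omega) (by omega)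
  have hrow1 : nx i * N + r < N * N := mul_add_lt_sq (by omega) (by omega)
  have hsx := hr.lt_s (i := x) (by omega)
  have hsi := hr.lt_s (i := i) (by omega)
  have hsr := hr.lt_s (i := r) (by omega)
  unfold alignCellCmd
  rw [wp_seq, wp_setN, wp_seq, wp_setN, wp_seq, wp_setN]
  simp only [NExp.ok, NExp.eval, Store.setN, Function.update_apply, h13, h14,
      hb.N, hb.nx, Nat.reduceEqDiff, if_false, true_and, and_true]
  refine ⟨hsi, ?_⟩
  refine wp_seq_of (convCmd_spec hr (r0 := i * N + r) (r1 := i) (r2 := nx i * N + r) (by decide)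
    ?_ ?_ ?_ ?_ ?_ hrow (lt_sq (by omega)) hrow1 ?_ (h1 := hD i (by omega) hin) (h2 := hV1)) ?_
  · simp [hb.n]
  · simp [hb.N]
  · simp
  · simp
  · simp
  · intro e
    have := (row_inj (by omega) (by omega) e).1
    omega
  · rintro h1 ⟨hc1, hc2⟩ hk1
    have e0 : h1.n 0 = n := (hk1.n 0 rfl).trans (by simp [hb.n])
    have e2 : h1.n 2 = N := (hk1.n 2 rfl).trans (by simp [hb.N])
    have e10 : h1.n 10 = x := (hk1.n 10 rfl).trans (by simp [h10])
    have e13 : h1.n 13 = i := (hk1.n 13 rfl).trans (by simp [h13])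
    have e14 : h1.n 14 = r := (hk1.n 14 rfl).trans (by simp [h14])
    have e17 : h1.n 17 = R.length := (hk1.n 17 rfl).trans (by simp [hR.len])
    have e22 : h1.n 22 = i * N + r := (hk1.n 22 rfl).trans (by simp)
    have e3 : h1.w 3 = (0 : ℝ) := (hk1.w 3 rfl).trans (by simpa using hw3)
    have eA3 : h1.A 3 = d := (hk1.A 3 rfl).trans (by simp [hb.d])
    have eA6 : h1.A 6 = h.A 6 := (hk1.A 6 rfl)
    rw [wp_ite]
    simp only [BExp.ok, BExp.eval, wp_skip, wp_seq, wp_setN, NExp.ok, NExp.eval, e10, e13, e14,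
      e17, eA3, eA6, e2, and_true, true_and]
    refine ⟨⟨hsr, hsi, hsx⟩, fun hm => ?_, fun hm => ?_⟩
    · have hm' : r < R.length ∧ R.getD r 0 = d i - d x := ⟨hm.1, by rw [← hR.val r hm.1]; exact hm.2⟩
      have hne : (i + 1) * N + (r + 1) ≠ i * N + r := fun e => by
        have := (row_inj (by omega) (by omega) e).1
        omega
      refine wp_mono _ (minCmd_spec hr (r0 := i * N + r) (r1 := (i + 1) * N + (r + 1)) (u := 0)
        ?_ ?_ ?_ ?_ hrow (mul_add_lt_sq (by omega) (by omega)) (Or.inl hne) ?_ hc1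
        (hc2.row (by omega) hne (hV2 hm.1))) ?_
      · simp [Store.setN, e0]
      · simp [Store.setN, e2]
      · simp [Store.setN, e22]
      · simp [Store.setN]
      · simpa [Store.setN] using e3
      · rintro h2 ⟨hm1, hm2⟩
        refine ⟨fun j hj => (hm1 j hj).congr ?_ ?_, hc2.trans hm2⟩
        · rintro v (hv | ⟨y, hy, rfl⟩)
          · exact valV_of_conv hH hp hx hxi hi hv
          · rw [zero_add]; exact valV_of_match hi hm' hy
        · intro v hv
          rcases valV_cases hH hp hx hxi hi hv with hv | ⟨-, hv⟩
          · exact Or.inl hv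
          · exact Or.inr ⟨v, hv, (zero_add v).symm⟩
    · refine ⟨fun j hj => (hc1 j hj).congr ?_ ?_, hc2⟩
      · exact fun v hv => valV_of_conv hH hp hx hxi hi hv
      · intro v hv
        rcases valV_cases hH hp hx hxi hi hv with hv | ⟨⟨h1, h2⟩, -⟩
        · exact hv
        · exact absurd ⟨h1, by rw [hR.val r h1]; exact h2⟩ hm

theorem alignCmd_spec (hH : H.Additive) (hp : Pre n d nx) {E : Env} {N : ℕ} (hr : Room E n N)
    {h : Store} (hb : Base n N d nx h) {x : ℕ} {R : List ℕ} (hx : x < n) (h10 : h.n 10 = x)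
    (hR : Stored R h) (hlen : R.length < N) (hD : DeletedOk H n d nx fam N (h.W 1) (x + 1)) :
    wp E alignCmd (fun h' => ∀ i, x < i → i ≤ nx x → ∀ r ≤ R.length,
      RowBetween n N (h'.W 3) (i * N + r) (valV H d nx fam False x R r i)
        (valV H d nx fam True x R r i)) h := by
  have hxlt := hp.lt x hx
  have hxle := hp.le x hx
  have hw := hr.width
  have hrounds := hr.rounds
  have hsx := hr.lt_s (i := x) (by omega)
  unfold alignCmd
  rw [wp_seq, wp_setW, wp_seq]
  refine ⟨trivial, ?_⟩
  have hb0 : Base n N d nx (h.setW 3 (WExp.eval h (.real 0))) := ⟨hb.n, hb.N, hb.d, hb.nx⟩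
  refine wp_loop (m := R.length + 1) (fun r h' => ∀ r' < r, RowBetween n N (h'.W 3) (nx x * N + r')
    (valV H d nx fam False x R r' (nx x)) (valV H d nx fam True x R r' (nx x)))
    ⟨trivial, trivial⟩ ?_ (by omega) (fun r' hr' => by omega) ?_ ?_
  · simp [NExp.eval, Store.setW, hR.len]
  · intro r hrl h1 hk1 hI
    have hb1 : Base n N d nx h1 := hb0.kept hk1 rfl rfl rfl rfl
    have e10 : h1.n 10 = x := (hk1.n 10 rfl).trans h10
    have e17 : h1.n 17 = R.length := (hk1.n 17 rfl).trans hR.len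
    -- At the end of the subtree the flag `f` tells whether the list has been used up; only then is
    -- the value 0 allowed, with no deletions left.
    have hinit : ∀ f, (f = 1 ↔ R.length ≤ r) → wp E (initCmd 3) (fun h' => ∀ r' < r + 1,
        RowBetween n N (h'.W 3) (nx x * N + r') (valV H d nx fam False x R r' (nx x))
        (valV H d nx fam True x R r' (nx x)))
        (((h1.setN 14 r).setN 22 (nx x * N + r)).setN 25 f) := by
      intro f hf
      refine wp_mono _ (initCmd_spec hr (n := n) (N := N) (r0 := nx x * N + r) ?_ ?_ ?_
        (mul_add_lt_sq (by omega) (by omega))) ?_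
      · simp [Store.setN, hb1.n]
      · simp [Store.setN, hb1.N]
      · simp [Store.setN]
      · rintro h2 ⟨hc1, hc2⟩ r' hr'
        rcases Nat.lt_succ_iff_lt_or_eq.1 hr' with hr' | rfl
        · refine hc2.row (by omega) (fun e => ?_) (hI r' hr')
          have := (row_inj (by omega) (by omega) e).2
          omega
        · have e25 : (((h1.setN 14 r').setN 22 (nx x * N + r')).setN 25 f).n 25 = f := by
            simp [Store.setN]
          rw [e25] at hc1
          refine fun j hj => (hc1 j hj).congr ?_ ?_
          · rintro v ⟨⟨h1, h2⟩, h3⟩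
            exact (valV_end hH).2 ⟨⟨h1, hf.1 h2⟩, h3⟩
          · intro v hv
            obtain ⟨⟨h1, h2⟩, h3⟩ := (valV_end hH).1 hv
            exact ⟨⟨h1, hf.2 h2⟩, h3⟩
    rw [wp_seq, wp_setN, wp_seq, wp_ite, wp_setN, wp_setN]
    have e22 : NExp.eval (h1.setN 14 r) (.add (.mul (.ld 4 (.v 10)) (.v 2)) (.v 14)) =
        nx x * N + r := by
      simp [NExp.eval, Store.setN, e10, hb1.nx, hb1.N]
    rw [e22]
    refine ⟨⟨⟨⟨trivial, ?_⟩, trivial⟩, trivial⟩, ⟨trivial, trivial⟩, fun hc => ⟨trivial, ?_⟩,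
      fun hc => ⟨trivial, ?_⟩⟩
    · simpa [NExp.eval, Store.setN, Function.update_apply, e10] using hsx
    all_goals simp only [BExp.eval, NExp.eval, Store.setN, Function.update_apply,
      Nat.reduceEqDiff, if_true, if_false, e17] at hc
    · refine hinit 0 ⟨fun h => by omega, fun h => by omega⟩
    · refine hinit 1 ⟨fun h => by omega, fun h => by omega⟩
  · intro h1 hk1 hI
    have hb1 : Base n N d nx h1 := hb0.kept hk1 rfl rfl rfl rfl
    have e10 : h1.n 10 = x := (hk1.n 10 rfl).trans h10
    have e17 : h1.n 17 = R.length := (hk1.n 17 rfl).trans hR.len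
    have e3 : h1.w 3 = (0 : ℝ) := (hk1.w 3 rfl).trans rfl
    have eA6 : h1.A 6 = h.A 6 := hk1.A 6 rfl
    have eW1 : h1.W 1 = h.W 1 := hk1.W 1 rfl
    refine wp_loop (m := nx x - x - 1) (fun t h' => ∀ i, nx x - t ≤ i → i ≤ nx x →
      ∀ r ≤ R.length, RowBetween n N (h'.W 3) (i * N + r) (valV H d nx fam False x R r i)
        (valV H d nx fam True x R r i)) ?_ ?_ (by omega) ?_ ?_ ?_
    · simp only [NExp.ok, NExp.eval, e10, and_true, true_and]; exact hsx
    · simp [NExp.eval, hb1.nx, e10]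
    · intro i hi1 hi2 r hrl
      have hi : i = nx x := by omega
      subst hi
      exact hI r (by omega)
    · intro t ht h2 hk2 hI2
      have hb2 : Base n N d nx h2 := hb1.kept hk2 rfl rfl rfl rfl
      have f10 : h2.n 10 = x := (hk2.n 10 rfl).trans e10
      have f17 : h2.n 17 = R.length := (hk2.n 17 rfl).trans e17
      have f3 : h2.w 3 = (0 : ℝ) := (hk2.w 3 rfl).trans e3
      have fA6 : h2.A 6 = h.A 6 := (hk2.A 6 rfl).trans eA6
      have fW1 : h2.W 1 = h.W 1 := (hk2.W 1 rfl).trans eW1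
      rw [wp_seq, wp_setN]
      refine ⟨?_, ?_⟩
      · simp only [NExp.ok, NExp.eval, Store.setN, Function.update_apply, f10, Nat.reduceEqDiff,
          if_false, and_true, true_and]
        exact hsx
      have ei : NExp.eval (h2.setN 12 t) (.sub (.sub (.ld 4 (.v 10)) (.c 1)) (.v 12)) =
          nx x - 1 - t := by
        simp [NExp.eval, Store.setN, f10, hb2.nx]
      rw [ei]
      set i := nx x - 1 - t with hi
      have hin : i < n := by omega
      have hnxi := hp.lt i hin
      have hnx := hp.laminar hx (l := i) (by omega) (by omega)
      refine wp_loop (m := R.length + 1) (fun r h' => (∀ r' < r, RowBetween n N (h'.W 3)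
        (i * N + r') (valV H d nx fam False x R r' i) (valV H d nx fam True x R r' i)) ∧
        ∀ i', i < i' → i' ≤ nx x → ∀ r' ≤ R.length, RowBetween n N (h'.W 3) (i' * N + r')
        (valV H d nx fam False x R r' i') (valV H d nx fam True x R r' i'))
        ⟨trivial, trivial⟩ ?_ (by omega) ?_ ?_ ?_
      · simp [NExp.eval, Store.setN, f17]
      · exact ⟨fun r' hr' => by omega, fun i' h1 h2 r' h3 => hI2 i' (by omega) h2 r' h3⟩
      · rintro r hrl h3 hk3 ⟨hJ1, hJ2⟩
        have hb3 : Base n N d nx h3 :=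
          ((hb2.setN 12 t (by decide) (by decide)).setN 13 i (by decide) (by decide)).kept hk3
            rfl rfl rfl rfl
        refine wp_mono _ (alignCellCmd_spec hH hp hr (hb3.setN 14 r (by decide) (by decide)) hx
          (i := i) (r := r) (R := R) ?_ (by omega) (by omega) ?_ ?_ ⟨?_, ?_⟩ (by omega) hlen ?_
          (fam := fam) ?_ ?_ ?_) ?_
        · simp [Store.setN]; exact (hk3.n 10 rfl).trans (by simp [Store.setN, f10])
        · simp [Store.setN]; exact (hk3.n 13 rfl).trans (by simp [Store.setN])
        · simp [Store.setN]
        · simp [Store.setN]; exact (hk3.n 17 rfl).trans (by simp [Store.setN, f17])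
        · intro l hl
          rw [← hR.val l hl, ← fA6]
          exact congrFun (hk3.A 6 rfl) l
        · exact (hk3.w 3 rfl).trans f3
        · have : (h3.setN 14 r).W 1 = h.W 1 := (hk3.W 1 rfl).trans fW1
          rw [this]; exact hD
        · exact hJ2 (nx i) (by omega) (by omega) r (by omega)
        · exact fun hrR => hJ2 (i + 1) (by omega) (by omega) (r + 1) (by omega)
        · rintro h4 ⟨hc1, hc2⟩
          refine ⟨fun r' hr' => ?_, fun i' h1 h2 r' h3 => hc2.row (by omega) (fun e => ?_)
            (hJ2 i' h1 h2 r' h3)⟩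
          · rcases Nat.lt_succ_iff_lt_or_eq.1 hr' with hr' | rfl
            · refine hc2.row (by omega) (fun e => ?_) (hJ1 r' hr')
              have := (row_inj (by omega) (by omega) e).2
              omega
            · exact hc1
          · have := (row_inj (by omega) (by omega) e).1
            omega
      · rintro h3 hk3 ⟨hJ1, hJ2⟩ i' h1 h2 r' hr'
        rcases (show i ≤ i' by omega).eq_or_lt with rfl | hlt
        · exact hJ1 r' (by omega)
        · exact hJ2 i' hlt h2 r' hr'
    · intro h2 hk2 hI2 i h3 h4
      exact hI2 i (by omega) h4

end TreeDP


/-! ### Codes of components -/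

namespace TreeDP

variable {H : GraphMeasure} {n : ℕ} {d nx : ℕ → ℕ}

/-- The digits of `w` in base `B`. -/
def digit (B w l : ℕ) : ℕ := w / B ^ l % B

theorem exists_digits {B : ℕ} (K : ℕ) (f : ℕ → ℕ) (hf : ∀ l < K, f l < B) :
    ∃ w < B ^ K, ∀ l < K, digit B w l = f l := by
  induction K generalizing f with
  | zero => exact ⟨0, by simp, fun l hl => by omega⟩
  | succ K ih =>
    obtain ⟨w, hw, h⟩ := ih (fun l => f (l + 1)) fun l hl => hf _ (by omega)
    have h0 := hf 0 (by omega)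
    refine ⟨f 0 + B * w, ?_, fun l hl => ?_⟩
    · calc f 0 + B * w < B + B * w := by omega
        _ = B * (w + 1) := by ring
        _ ≤ B * B ^ K := Nat.mul_le_mul_left _ hw
        _ = B ^ (K + 1) := by ring
    · rcases l with _ | l
      · simp [digit, Nat.mod_eq_of_lt h0]
      · rw [← h l (by omega), digit, digit, pow_succ', ← Nat.div_div_eq_div_mul,
          Nat.add_mul_div_left _ _ (by omega), Nat.div_eq_of_lt h0, zero_add]

/-- The digits of `n 16` in base `n 5` go to `A 5`. -/
def digitsCmd : Cmd :=
  .seq (.setN 18 (.v 16)) <| .loop 19 (.v 4) <|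
    .seq (.setN 27 (.c 0)) <|
    .seq (.loop 28 (.v 18) (.ite (.lt (.v 18) (.mul (.add (.v 27) (.c 1)) (.v 5))) .skip
      (.setN 27 (.add (.v 27) (.c 1))))) <|
    .seq (.stN 5 (.v 19) (.sub (.v 18) (.mul (.v 27) (.v 5)))) (.setN 18 (.v 27))

/-- The language has no integer division, so each quotient is found by counting up until it is
reached. This takes at most `w` rounds, which is affordable because `w` is bounded by `M`. -/
theorem digitsCmd_spec {E : Env} {h : Store} {w B K : ℕ} (h16 : h.n 16 = w) (h5 : h.n 5 = B)
    (h4 : h.n 4 = K) (hB : 0 < B) (hw : w ≤ E.M) (hK : K ≤ E.M) (hKs : K ≤ E.s) :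
    wp E digitsCmd (fun h' => ∀ l < K, h'.A 5 l = digit B w l) h := by
  unfold digitsCmd
  rw [wp_seq, wp_setN]
  refine ⟨trivial, wp_loop (m := K) (fun t h' => h'.n 18 = w / B ^ t ∧
    ∀ l < t, h'.A 5 l = digit B w l) trivial ?_ hK ?_ ?_ fun h' _ hI => hI.2⟩
  · simp [NExp.eval, Store.setN, h4]
  · exact ⟨by simp [NExp.eval, Store.setN, h16], fun l hl => by omega⟩
  · rintro t ht h1 hk1 ⟨hI1, hI2⟩
    have e5 : h1.n 5 = B := (hk1.n 5 rfl).trans (by simp [Store.setN, h5])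
    rw [wp_seq, wp_setN, wp_seq]
    refine ⟨trivial, wp_loop (m := w / B ^ t) (fun u h' => h'.n 27 = min u (w / B ^ t / B)) trivial
      ?_ ((Nat.div_le_self _ _).trans hw) ?_ ?_ ?_⟩
    · simp [NExp.eval, Store.setN, hI1]
    · simp [NExp.eval, Store.setN]
    · intro u hu h2 hk2 hJ
      have f5 : h2.n 5 = B := (hk2.n 5 rfl).trans (by simp [Store.setN, e5])
      have f18 : h2.n 18 = w / B ^ t := (hk2.n 18 rfl).trans (by simp [Store.setN, hI1])
      simp only [wp_ite, wp_skip, wp_setN, BExp.ok, BExp.eval, NExp.ok, NExp.eval, Store.setN,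
        Function.update_apply, f5, f18, hJ, Nat.reduceEqDiff, if_true, if_false, true_and, and_true]
      have key := Nat.le_div_iff_mul_le (k := B) (x := min u (w / B ^ t / B) + 1) (y := w / B ^ t) hB
      constructor
      · intro hc
        have : ¬ (min u (w / B ^ t / B) + 1 ≤ w / B ^ t / B) := fun h => by
          have := key.1 h
          omega
        omega
      · intro hc
        have := key.2 (by omega)
        omega
    · intro h2 hk2 hJ
      have f5 : h2.n 5 = B := (hk2.n 5 rfl).trans (by simp [Store.setN, e5])
      have f18 : h2.n 18 = w / B ^ t := (hk2.n 18 rfl).trans (by simp [Store.setN, hI1])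
      have f19 : h2.n 19 = t := (hk2.n 19 rfl).trans (by simp [Store.setN])
      have fA : h2.A 5 = h1.A 5 := hk2.A 5 rfl
      rw [min_eq_right (Nat.div_le_self _ _)] at hJ
      simp only [wp_seq, wp_stN, wp_setN, NExp.ok, NExp.eval, Store.setN, Store.stN,
        Function.update_apply, f5, f18, f19, fA, hJ, if_true, true_and, and_true]
      refine ⟨by omega, ?_, fun l hl => ?_⟩
      · rw [pow_succ, Nat.div_div_eq_div_mul]
      · rcases Nat.lt_succ_iff_lt_or_eq.1 hl with hl | rfl
        · rw [if_neg (by omega)]; exact hI2 l hl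
        · rw [if_pos rfl, digit, Nat.mod_eq_sub_div_mul]

/-- Depth lists of trees in preorder. -/
def TreeList (R : List ℕ) : Prop := ∃ T : List ℕ, R = 0 :: T ∧ ∀ v ∈ T, 0 < v

theorem TreeList.head {R : List ℕ} (h : TreeList R) : R.head? = some 0 := by
  obtain ⟨T, rfl, -⟩ := h; rfl

theorem TreeList.pos {R : List ℕ} (h : TreeList R) : 0 < R.length := by
  obtain ⟨T, rfl, -⟩ := h; simp

theorem TreeList.root {R : List ℕ} (h : TreeList R) (i : ℕ) (h0 : 0 < i) (hi : i < R.length) :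
    R.getD 0 0 < R.getD i 0 := by
  obtain ⟨T, rfl, hT⟩ := h
  obtain ⟨j, rfl⟩ : ∃ j, i = j + 1 := ⟨i - 1, by omega⟩
  rw [List.length_cons] at hi
  rw [List.getD_cons_zero, List.getD_cons_succ, List.getD_eq_getElem _ _ (by omega)]
  exact hT _ (List.getElem_mem _)

theorem Stored.append {R : List ℕ} {h h' : Store} (hR : Stored R h) {v : ℕ}
    (h17 : h'.n 17 = h.n 17 + 1) (h6 : ∀ i, h'.A 6 i = if i = h.n 17 then v else h.A 6 i) :
    Stored (R ++ [v]) h' := by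
  refine ⟨by rw [h17, hR.len, List.length_append, List.length_singleton], fun i hi => ?_⟩
  rw [h6, hR.len]
  rw [List.length_append, List.length_singleton] at hi
  rcases Nat.lt_succ_iff_lt_or_eq.1 hi with hi | rfl
  · rw [if_neg (by omega), List.getD_append _ _ _ _ hi, hR.val i hi]
  · rw [if_pos rfl, List.getD_append_right _ _ _ _ le_rfl, Nat.sub_self]; rfl

theorem Stored.congr {R : List ℕ} {h h' : Store} (hR : Stored R h) (h17 : h'.n 17 = h.n 17)
    (h6 : h'.A 6 = h.A 6) : Stored R h' :=
  ⟨h17.trans hR.len, fun i hi => (congrFun h6 i).trans (hR.val i hi)⟩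

/-- The vertices above `x` among the first `K` digits. -/
def cutSet (B w K x : ℕ) : Finset ℕ := ((Finset.range K).image (digit B w)).filter (x < ·)

/-- Because `x` itself is never in a cut set, even a meaningless code yields the depth list of a
tree, on which the subroutine may be called. -/
theorem treeList_dlist (hp : Pre n d nx) {x : ℕ} (hx : x < n) {S : Finset ℕ}
    (hS : ∀ b ∈ S, x < b) : TreeList (dlist d nx x S x) := by
  have hlt := hp.lt x hx
  refine ⟨dlist d nx x S (x + 1), ?_, fun v hv => ?_⟩
  · rw [dlist_cons hlt, Nat.sub_self]
    rintro ⟨b, hb, h1, h2, -⟩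
    have := hS b hb
    omega
  · obtain ⟨l, hl, rfl⟩ := List.mem_map.1 hv
    have hl' := List.mem_range'_1.1 (List.mem_filter.1 hl).1
    have := hp.inside x hx l (by omega) (by omega)
    omega

/-- The list of the component of `x = n 10` cut off by the digits in `A 5`. -/
def cutCmd : Cmd :=
  .seq (.setN 17 (.c 0)) <| .loop 27 (.sub (.ld 4 (.v 10)) (.v 10)) <|
    .seq (.setN 29 (.add (.v 10) (.v 27))) <| .seq (.setN 30 (.c 1)) <|
    .seq (.loop 28 (.v 4) (.ite (.and (.lt (.v 10) (.ld 5 (.v 28)))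
      (.and (.not (.lt (.v 29) (.ld 5 (.v 28)))) (.lt (.v 29) (.ld 4 (.ld 5 (.v 28))))))
      (.setN 30 (.c 0)) .skip)) <|
    .ite (.eq (.v 30) (.c 1)) (.seq (.stN 6 (.v 17) (.sub (.ld 3 (.v 29)) (.ld 3 (.v 10))))
      (.setN 17 (.add (.v 17) (.c 1)))) .skip

theorem cutCmd_spec (hp : Pre n d nx) {E : Env} {N : ℕ} (hr : Room E n N) {h : Store}
    (hb : Base n N d nx h) {x w K : ℕ} (hx : x < n) (h10 : h.n 10 = x) (h4 : h.n 4 = K)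
    (hKN : K < N) (hD : ∀ l < K, h.A 5 l = digit n w l) :
    wp E cutCmd (Stored (dlist d nx x (cutSet n w K x) x)) h := by
  have hlt := hp.lt x hx
  have hle := hp.le x hx
  have hw := hr.width
  have hM := hr.rounds
  have hs : ∀ i, i ≤ n → i < E.s := fun i hi => hr.lt_s (by omega)
  have hdig : ∀ l, digit n w l < n := fun l => Nat.mod_lt _ (by omega)
  set S := cutSet n w K x with hS
  have hHid : ∀ i, Hid nx S x i ↔ ∃ l < K, x < digit n w l ∧ digit n w l ≤ i ∧
      i < nx (digit n w l) := by
    intro i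
    constructor
    · rintro ⟨b, hb, h1, h2, h3⟩
      rw [hS, cutSet, Finset.mem_filter, Finset.mem_image] at hb
      obtain ⟨⟨l, hl, rfl⟩, hb⟩ := hb
      exact ⟨l, Finset.mem_range.1 hl, hb, h2, h3⟩
    · rintro ⟨l, hl, h1, h2, h3⟩
      refine ⟨_, ?_, h1.le, h2, h3⟩
      rw [hS, cutSet, Finset.mem_filter, Finset.mem_image]
      exact ⟨⟨l, Finset.mem_range.2 hl, rfl⟩, h1⟩
  -- The part of the list that comes from the first `t` vertices of the subtree.
  let R : ℕ → List ℕ := fun t =>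
    ((List.range' x t).filter (fun l => ¬ Hid nx S x l)).map (fun l => d l - d x)
  have hRlen : ∀ t, (R t).length ≤ t := fun t => by
    rw [List.length_map]
    exact (List.length_filter_le _ _).trans (by rw [List.length_range'])
  have hRs : ∀ t, R (t + 1) = R t ++ if Hid nx S x (x + t) then [] else [d (x + t) - d x] := by
    intro t
    simp only [R, List.range'_1_concat, List.filter_append, List.map_append]
    congr 1
    split_ifs with hh <;> simp [hh]
  unfold cutCmd
  rw [wp_seq, wp_setN]
  refine ⟨trivial, wp_loop (m := nx x - x) (fun t h' => Stored (R t) h') ?_ ?_ (by omega) ?_ ?_ ?_⟩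
  · simp only [NExp.ok, NExp.eval, Store.setN, Function.update_apply, h10, Nat.reduceEqDiff,
      if_false, and_true, true_and]
    exact hs x (by omega)
  · simp [NExp.eval, Store.setN, h10, hb.nx]
  · exact ⟨by simp [Store.setN, NExp.eval, R], fun i hi => by simp [R] at hi⟩
  · intro t ht h1 hk1 hI
    have hb1 : Base n N d nx h1 := (hb.setN 17 _ (by decide) (by decide)).kept hk1 rfl rfl rfl rfl
    have e10 : h1.n 10 = x := (hk1.n 10 rfl).trans (by simp [Store.setN, h10])
    have e4 : h1.n 4 = K := (hk1.n 4 rfl).trans (by simp [Store.setN, h4])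
    have e5 : ∀ l < K, h1.A 5 l = digit n w l := fun l hl =>
      (congrFun (hk1.A 5 rfl) l).trans (hD l hl)
    rw [wp_seq, wp_setN, wp_seq, wp_setN, wp_seq]
    refine ⟨⟨trivial, trivial⟩, trivial, ?_⟩
    refine wp_loop (m := K) (fun u h' => h'.n 30 = if ∃ l < u, x < digit n w l ∧
      digit n w l ≤ x + t ∧ x + t < nx (digit n w l) then 0 else 1) trivial ?_ (by omega) ?_ ?_ ?_
    · simp [NExp.eval, Store.setN, e4]
    · simp [NExp.eval, Store.setN]
    · intro u hu h2 hk2 hJ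
      have hb2 : Base n N d nx h2 := (((hb1.setN 27 t (by decide) (by decide)).setN 29 _ (by decide)
        (by decide)).setN 30 _ (by decide) (by decide)).kept hk2 rfl rfl rfl rfl
      have f10 : h2.n 10 = x := (hk2.n 10 rfl).trans (by simp [Store.setN, e10])
      have f29 : h2.n 29 = x + t := (hk2.n 29 rfl).trans (by simp [Store.setN, NExp.eval, e10])
      have f5 : h2.A 5 u = digit n w u := (congrFun (hk2.A 5 rfl) u).trans (e5 u hu)
      have hdu := hdig u
      simp only [wp_ite, wp_skip, wp_setN, BExp.ok, BExp.eval, NExp.ok, NExp.eval, Store.setN,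
        Function.update_apply, f10, f29, f5, hb2.nx, Nat.reduceEqDiff, if_true, if_false, true_and,
        hJ, not_lt]
      have hsu := hr.lt_s (i := u) (by omega)
      refine ⟨⟨hsu, hsu, hsu, hs _ (by omega)⟩, fun hc => ?_, fun hc => ?_⟩
      · rw [if_pos ⟨u, by omega, hc⟩]
      · refine if_congr ⟨?_, ?_⟩ rfl rfl
        · rintro ⟨l, hl, h⟩; exact ⟨l, by omega, h⟩
        · rintro ⟨l, hl, h⟩
          rcases Nat.lt_succ_iff_lt_or_eq.1 hl with hl | rfl
          · exact ⟨l, hl, h⟩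
          · exact absurd h hc
    · intro h2 hk2 hJ
      have hb2 : Base n N d nx h2 := (((hb1.setN 27 t (by decide) (by decide)).setN 29 _ (by decide)
        (by decide)).setN 30 _ (by decide) (by decide)).kept hk2 rfl rfl rfl rfl
      have f10 : h2.n 10 = x := (hk2.n 10 rfl).trans (by simp [Store.setN, e10])
      have f29 : h2.n 29 = x + t := (hk2.n 29 rfl).trans (by simp [Store.setN, NExp.eval, e10])
      have f17 : h2.n 17 = (R t).length := (hk2.n 17 rfl).trans (by simp [Store.setN, hI.len])
      have f6 : h2.A 6 = h1.A 6 := hk2.A 6 rfl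
      have hlen := hRlen t
      rw [if_congr (hHid (x + t)).symm rfl rfl] at hJ
      simp only [wp_ite, wp_skip, wp_seq, wp_stN, wp_setN, BExp.ok, BExp.eval, NExp.ok, NExp.eval,
        f10, f29, f17, hb2.d, true_and, and_true, hJ]
      rw [hRs]
      refine ⟨fun hc => ⟨hs _ (by omega), ⟨hs _ (by omega), hs _ (by omega)⟩, ?_⟩, fun hc => ?_⟩
      · rw [if_neg (fun h => by simp [h] at hc)]
        refine hI.append ?_ ?_
        · simp [Store.setN, Store.stN, hI.len, f17]
        · intro i
          simp [Store.setN, Store.stN, f6, hI.len, Function.update_apply]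
      · rw [if_pos (by_contra fun h => by simp [h] at hc), List.append_nil]
        exact hI.congr (by rw [f17, hI.len]) f6
  · intro h' _ hI
    exact hI

/-! ### Walks as codes of depth lists -/

/-- The depths read off a walk that starts at the root: `1` goes to a new child, anything else
goes up. -/
def walk (f : ℕ → ℕ) : ℕ → List ℕ × ℕ
  -- The second component is the depth that a new child would get. It never drops below 1, so upward
  -- moves at the root do nothing and can pad a code to a fixed length.
  | 0 => ([0], 1)
  | k + 1 => if f k = 1 then ((walk f k).1 ++ [(walk f k).2], (walk f k).2 + 1)
      else ((walk f k).1, if 1 < (walk f k).2 then (walk f k).2 - 1 else (walk f k).2)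

theorem walk_pos (f : ℕ → ℕ) (k : ℕ) : 1 ≤ (walk f k).2 := by
  induction k with
  | zero => simp [walk]
  | succ k ih => rw [walk]; split_ifs <;> simp only <;> omega

theorem walk_length (f : ℕ → ℕ) (k : ℕ) : (walk f k).1.length ≤ k + 1 := by
  induction k with
  | zero => simp [walk]
  | succ k ih => rw [walk]; split_ifs <;> simp <;> omega

theorem treeList_walk (f : ℕ → ℕ) (k : ℕ) : TreeList (walk f k).1 := by
  induction k with
  | zero => exact ⟨[], rfl, fun v hv => by simp at hv⟩
  | succ k ih =>
    rw [walk]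
    split_ifs
    · obtain ⟨T, h1, h2⟩ := ih
      refine ⟨T ++ [(walk f k).2], by rw [h1]; rfl, fun v hv => ?_⟩
      rcases List.mem_append.1 hv with hv | hv
      · exact h2 v hv
      · rw [List.mem_singleton.1 hv]; exact walk_pos f k
    all_goals exact ih

def walkCmd : Cmd :=
  .seq (.stN 6 (.c 0) (.c 0)) <| .seq (.setN 17 (.c 1)) <| .seq (.setN 29 (.c 1)) <|
  .loop 28 (.v 4) (.ite (.eq (.ld 5 (.v 28)) (.c 1))
    (.seq (.stN 6 (.v 17) (.v 29))
      (.seq (.setN 17 (.add (.v 17) (.c 1))) (.setN 29 (.add (.v 29) (.c 1)))))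
    (.ite (.lt (.c 1) (.v 29)) (.setN 29 (.sub (.v 29) (.c 1))) .skip))

theorem walkCmd_spec {E : Env} {h : Store} {K : ℕ} {f : ℕ → ℕ} (h4 : h.n 4 = K) (hKM : K ≤ E.M)
    (hKs : K < E.s) (hD : ∀ l < K, h.A 5 l = f l) : wp E walkCmd (Stored (walk f K).1) h := by
  unfold walkCmd
  rw [wp_seq, wp_stN, wp_seq, wp_setN, wp_seq, wp_setN]
  refine ⟨⟨trivial, by simp only [NExp.eval]; omega⟩, trivial, trivial, trivial, ?_⟩
  refine wp_loop (m := K) (fun t h' => Stored (walk f t).1 h' ∧ h'.n 29 = (walk f t).2) trivial ?_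
    hKM ?_ ?_ fun h' _ hI => hI.1
  · simp [NExp.eval, Store.setN, Store.stN, h4]
  · refine ⟨⟨by simp [Store.setN, Store.stN, NExp.eval, walk], fun i hi => ?_⟩, ?_⟩
    · have : i = 0 := by simpa [walk] using hi
      subst this
      simp [Store.setN, Store.stN, NExp.eval, walk]
    · simp [Store.setN, Store.stN, NExp.eval, walk]
  · rintro t ht h1 hk1 ⟨hI1, hI2⟩
    have e5 : h1.A 5 t = f t := (congrFun (hk1.A 5 rfl) t).trans (by simpa [Store.setN, Store.stN] using hD t ht)
    have e17 := hI1.len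
    have hlen := walk_length f t
    simp only [wp_ite, wp_skip, wp_seq, wp_stN, wp_setN, BExp.ok, BExp.eval, NExp.ok, NExp.eval,
      Store.setN, Function.update_apply, e5, e17, hI2, Nat.reduceEqDiff, if_true, if_false,
      true_and, and_true, walk]
    refine ⟨by omega, fun hc => ⟨by omega, ?_⟩, fun hc => ⟨fun hc' => ?_, fun hc' => ?_⟩⟩
    · rw [if_pos hc]
      refine ⟨hI1.append (v := (walk f t).2) ?_ fun i => ?_, ?_⟩
      · simp [Store.stN, e17]
      · simp [Store.stN, e17, Function.update_apply]
      · simp [Store.stN, hI2]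
    · rw [if_neg hc, if_pos hc']
      refine ⟨hI1.congr ?_ rfl, rfl⟩
      simp
    · rw [if_neg hc, if_neg hc']
      refine ⟨hI1.congr ?_ rfl, rfl⟩
      simp

/-- The depth list with code `w` for the component of `x`. -/
def codeList (d nx : ℕ → ℕ) (mode K B x w : ℕ) : List ℕ :=
  if mode = 1 then dlist d nx x (cutSet B w K x) x else (walk (digit B w) K).1

theorem treeList_codeList (hp : Pre n d nx) {mode K B x w : ℕ} (hx : x < n) :
    TreeList (codeList d nx mode K B x w) := by
  unfold codeList
  split_ifs
  · exact treeList_dlist hp hx fun b hb => (Finset.mem_filter.1 hb).2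
  · exact treeList_walk _ _

/-- A walk of `2 * n` bits can produce a list longer than the tree. This is why rows have length at
least `2 * n + 2`. -/
theorem codeList_length (hp : Pre n d nx) {mode K B x w : ℕ} (hx : x < n) (hK : K ≤ 2 * n) :
    (codeList d nx mode K B x w).length ≤ 2 * n + 1 := by
  unfold codeList
  split_ifs
  · have := hp.le x hx
    refine (List.length_map _).le.trans ((List.length_filter_le _ _).trans ?_)
    rw [List.length_range']; omega
  · exact (walk_length _ _).trans (by omega)

def decodeCmd : Cmd := .seq digitsCmd (.ite (.eq (.v 7) (.c 1)) cutCmd walkCmd)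

theorem decodeCmd_spec (hp : Pre n d nx) {E : Env} {N : ℕ} (hr : Room E n N) {h : Store}
    (hb : Base n N d nx h) {x w K B mode : ℕ} (hx : x < n) (h10 : h.n 10 = x) (h4 : h.n 4 = K)
    (h5 : h.n 5 = B) (h7 : h.n 7 = mode) (h16 : h.n 16 = w) (hK : K ≤ 2 * n) (hB : 0 < B)
    (hBn : mode = 1 → B = n) (hw : w ≤ E.M) :
    wp E decodeCmd (Stored (codeList d nx mode K B x w)) h := by
  have h1 := hr.width
  have h2 := hr.rounds
  have h3 := hr.lt_s (i := K) (by omega)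
  unfold decodeCmd
  refine wp_seq_of (digitsCmd_spec h16 h5 h4 hB hw (by omega) (by omega)) fun h' hD hk => ?_
  have e7 : h'.n 7 = mode := (hk.n 7 rfl).trans h7
  rw [wp_ite]
  refine ⟨⟨trivial, trivial⟩, fun hc => ?_, fun hc => ?_⟩ <;>
    simp only [BExp.eval, NExp.eval, e7] at hc <;> unfold codeList
  · rw [if_pos hc]
    obtain rfl := hBn hc
    exact cutCmd_spec hp hr (hb.kept hk rfl rfl rfl rfl) hx ((hk.n 10 rfl).trans h10)
      ((hk.n 4 rfl).trans h4) (by omega) hD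
  · rw [if_neg hc]
    exact walkCmd_spec ((hk.n 4 rfl).trans h4) (by omega) h3 hD

end TreeDP


/-! ### Evaluating the measure on a tree -/

namespace TreeDP

open RealRAM

variable {H : GraphMeasure}

/-- Resources `s`, `M`, and a subroutine that uses variables below `NP` and computes `H` on trees
with `m` vertices in time and space `a * m ^ b`. -/
def subEnv (H : GraphMeasure) (NP a b s M : ℕ) : Env where
  s := s
  M := M
  ret h v := ∃ (m : ℕ) (G : SimpleGraph (Fin m)), G.IsTree ∧ a * m ^ b ≤ s ∧ a * m ^ b ≤ M ∧
    (∀ x < NP, h.p x = (input G 0 0).scalar x) ∧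
    (∀ c < NP, ∀ i < a * m ^ b, h.pa c i = (input G 0 0).array c i) ∧ v = H.val G

/-- One more than the width is used, so that the output scalar 0 is among the tracked variables even
if the program mentions no variable. -/
theorem subEnv_sound {P₀ : Program} {a b : ℕ} (hP : ∀ (n : ℕ) (G : SimpleGraph (Fin n)), G.IsTree →
    Outputs P₀ (input G 0 0) (H.val G) (a * (n : ℝ) ^ b) (a * (n : ℝ) ^ b)) (s M : ℕ) :
    (subEnv H (P₀.width + 1) a b s M).Sound P₀ := by
  rintro h v σ ⟨m, G, hG, hs, hM, hp, hpa, rfl⟩ hr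
  obtain ⟨T, s', σ', hE, hv, hT, hs'⟩ := hP m G hG
  have hT' : T ≤ a * m ^ b := by exact_mod_cast hT
  have hs'' : s' ≤ a * m ^ b := by exact_mod_cast hs'
  obtain ⟨τ, h1, h2, h3⟩ := hE.rename (Nat.le_succ _) σ
    ⟨fun x hx => by rw [hr.p, hp x hx], fun c hc i hi => by rw [hr.pa, hpa c hc i (by omega)]⟩
  refine ⟨T, τ, h1.mono_space (hs''.trans hs), hT'.trans hM, h3, ?_⟩
  rw [← hv, ← h2.scalar 0 (by omega)]

/-- Clears the first `n 3` cells of the memory of the subroutine. -/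
def clearCmd : ℕ → Cmd
  | 0 => .skip
  | a + 1 => .seq (clearCmd a) (.seq (.setP a (.c 0)) (.loop 27 (.v 3) (.stP a (.v 27) (.c 0))))

theorem clearCmd_mn (a : ℕ) {y : ℕ} (hy : y ≠ 27) : (clearCmd a).mn y = false := by
  induction a with
  | zero => rfl
  | succ a ih => simp [clearCmd, Cmd.mn, ih, hy]

theorem clearCmd_mw (a y : ℕ) : (clearCmd a).mw y = false := by
  induction a with
  | zero => rfl
  | succ a ih => simp [clearCmd, Cmd.mw, ih]

theorem clearCmd_mA (a y : ℕ) : (clearCmd a).mA y = false := by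
  induction a with
  | zero => rfl
  | succ a ih => simp [clearCmd, Cmd.mA, ih]

theorem clearCmd_mW (a y : ℕ) : (clearCmd a).mW y = false := by
  induction a with
  | zero => rfl
  | succ a ih => simp [clearCmd, Cmd.mW, ih]

/-- The subroutine expects zeros, and an earlier call may have left anything. Only finitely many
variables, and in each array only `c` cells, have to be reset. -/
theorem clearCmd_spec {E : Env} {h : Store} {c : ℕ} (h3 : h.n 3 = c) (hs : c ≤ E.s)
    (hM : c ≤ E.M) (a : ℕ) :
    wp E (clearCmd a) (fun h' => ∀ x < a, h'.p x = 0 ∧ ∀ i < c, h'.pa x i = 0) h := by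
  induction a with
  | zero => exact fun x hx => by omega
  | succ a ih =>
    refine wp_seq_of ih fun h1 hI hk => ?_
    rw [wp_seq, wp_setP]
    refine ⟨trivial, wp_loop (m := c) (fun t h' => (∀ x < a + 1, h'.p x = 0) ∧
      (∀ x < a, ∀ i < c, h'.pa x i = 0) ∧ ∀ i < t, h'.pa a i = 0) trivial ?_ hM ?_ ?_ ?_⟩
    · exact (hk.n 3 (clearCmd_mn a (by decide))).trans h3
    · refine ⟨fun x hx => ?_, fun x hx => (hI x hx).2, fun i hi => by omega⟩
      simp only [Store.setP, NExp.eval, Function.update_apply, Nat.cast_zero]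
      split_ifs with e
      · rfl
      · exact (hI x (by omega)).1
    · rintro t ht h2 hk2 ⟨hJ1, hJ2, hJ3⟩
      simp only [wp_stP, NExp.ok, NExp.eval, Store.setN, Store.stP, Function.update_apply, if_true,
        true_and, Nat.cast_zero]
      refine ⟨by omega, hJ1, fun x hx i hi => ?_, fun i hi => ?_⟩
      · rw [if_neg (by omega)]; exact hJ2 x hx i hi
      · split_ifs with e
        · rfl
        · exact hJ3 i (by omega)
    · rintro h2 - ⟨hJ1, hJ2, hJ3⟩ x hx
      refine ⟨hJ1 x hx, fun i hi => ?_⟩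
      rcases Nat.lt_succ_iff_lt_or_eq.1 hx with hx | rfl
      · exact hJ2 x hx i hi
      · exact hJ3 i hi

/-- The adjacency matrix of the tree with the depth list in `A 6`, in the memory of the
subroutine. -/
def matrixCmd : Cmd :=
  .seq (.setP 0 (.v 17)) <| .loop 27 (.sub (.v 17) (.c 1)) <| .seq (.setN 29 (.c 0)) <|
    .seq (.loop 28 (.add (.v 27) (.c 1)) (.ite
      (.lt (.ld 6 (.v 28)) (.ld 6 (.add (.v 27) (.c 1)))) (.setN 29 (.v 28)) .skip)) <|
    .seq (.stP 0 (.add (.mul (.v 29) (.v 17)) (.add (.v 27) (.c 1))) (.c 1))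
      (.stP 0 (.add (.mul (.add (.v 27) (.c 1)) (.v 17)) (.v 29)) (.c 1))

open Classical in
-- Edges are entered one child at a time. The last index up to `t` with a depth below that of `t +
-- 1` is the parent of `t + 1`, and later hits overwrite earlier ones.
theorem matrixCmd_spec {E : Env} {h : Store} {R : List ℕ} {N : ℕ} (hR : Stored R h)
    (hT : TreeList R) (hlen : R.length < N) (hs : N * N ≤ E.s) (hM : N ≤ E.M) {c NP : ℕ}
    (h0 : ∀ x < NP, h.p x = 0 ∧ ∀ i < c, h.pa x i = 0) :
    wp E matrixCmd (fun h' =>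
      (∀ x < NP, h'.p x = (input (preFin (fun i => R.getD i 0) R.length) 0 0).scalar x) ∧
      (∀ x < NP, ∀ i < c, h'.pa x i =
        (input (preFin (fun i => R.getD i 0) R.length) 0 0).array x i)) h := by
  set m := R.length with hm
  have hpos := hT.pos
  have hmN : m * m ≤ E.s := (Nat.mul_le_mul hlen.le hlen.le).trans hs
  have hms : m ≤ E.s := (Nat.le_mul_self m).trans hmN
  set D : ℕ → ℕ := fun i => R.getD i 0 with hD
  have hroot : ∀ i, 0 < i → i < m → D 0 < D i := hT.root
  unfold matrixCmd
  rw [wp_seq, wp_setP]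
  refine ⟨trivial, ?_⟩
  -- After `t` rounds the matrix contains the edges whose child is at most `t`.
  refine wp_loop (m := m - 1) (fun t h' => (∀ x < NP, h'.p x = if x = 0 then (m : ℝ) else 0) ∧
    (∀ x < NP, x ≠ 0 → ∀ i < c, h'.pa x i = 0) ∧ (0 < NP → ∀ i < c, h'.pa 0 i =
      if ∃ u v, u < m ∧ v < m ∧ i = u * m + v ∧ (Par D u v ∧ v ≤ t ∨ Par D v u ∧ u ≤ t) then 1
      else 0)) ⟨trivial, trivial⟩ ?_ (by omega) ?_ ?_ ?_
  · simp [NExp.eval, Store.setP, hR.len, hm]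
  · refine ⟨fun x hx => ?_, fun x hx _ => (h0 x hx).2, fun hx i hi => ?_⟩
    · simp only [Store.setP, NExp.eval, Function.update_apply, hR.len, ← hm]
      split_ifs with e
      · rfl
      · exact (h0 x hx).1
    · rw [if_neg]
      · exact (h0 0 hx).2 i hi
      · rintro ⟨u, v, -, -, -, ⟨⟨h1, -⟩, h2⟩ | ⟨⟨h1, -⟩, h2⟩⟩ <;> omega
  · rintro t ht h1 hk1 ⟨hI1, hI2, hI3⟩
    have e17 : h1.n 17 = m := (hk1.n 17 rfl).trans hR.len
    have e6 : ∀ i < m, h1.A 6 i = D i := fun i hi => (congrFun (hk1.A 6 rfl) i).trans (hR.val i hi)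
    obtain ⟨q, -, hq⟩ := exists_par (d := D) (x := 0) (j := t + 1) (by omega)
      (hroot _ (by omega) (by omega))
    have hqt := hq.1
    rw [wp_seq, wp_setN, wp_seq]
    refine ⟨trivial, ?_⟩
    refine wp_loop (m := t + 1) (fun u h' => (q < u → h'.n 29 = q) ∧ h'.p = h1.p ∧ h'.pa = h1.pa)
      ⟨trivial, trivial⟩ ?_ (by omega) ?_ ?_ ?_
    · simp [NExp.eval, Store.setN]
    · exact ⟨fun h => by omega, rfl, rfl⟩
    · rintro u hu h2 hk2 ⟨hJ1, hJ2, hJ3⟩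
      have f27 : h2.n 27 = t := (hk2.n 27 rfl).trans (by simp [Store.setN])
      have f6 : ∀ i < m, h2.A 6 i = D i := fun i hi =>
        (congrFun (hk2.A 6 rfl) i).trans (e6 i hi)
      simp only [wp_ite, wp_skip, wp_setN, BExp.ok, BExp.eval, NExp.ok, NExp.eval, Store.setN,
        Function.update_apply, f27, f6 (t + 1) (by omega), f6 u (by omega), Nat.reduceEqDiff,
        if_true, if_false, true_and, and_true]
      refine ⟨by omega, fun hc => ⟨fun h => ?_, hJ2, hJ3⟩, fun hc => ⟨fun h => ?_, hJ2, hJ3⟩⟩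
      · rcases Nat.lt_succ_iff_lt_or_eq.1 h with h | h
        · have := hq.2.2 u h hu
          omega
        · exact h.symm
      · refine hJ1 (lt_of_le_of_ne (by omega) fun e => hc ?_)
        subst e
        exact hq.2.1
    · rintro h2 hk2 ⟨hJ1, hJ2, hJ3⟩
      have f27 : h2.n 27 = t := (hk2.n 27 rfl).trans (by simp [Store.setN])
      have f17 : h2.n 17 = m := (hk2.n 17 rfl).trans (by simp [Store.setN, e17])
      have f29 := hJ1 hqt
      have i1 := mul_add_lt_sq (n := m) (u := q) (v := t + 1) (by omega) (by omega)
      have i2 := mul_add_lt_sq (n := m) (u := t + 1) (v := q) (by omega) (by omega)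
      simp only [wp_seq, wp_stP, NExp.ok, NExp.eval, Store.stP, f27, f17, f29, true_and, and_true,
        Function.update_apply, Nat.cast_one]
      refine ⟨by omega, by omega, fun x hx => by rw [hJ2]; exact hI1 x hx, fun x hx hx0 i hi => ?_,
        fun hx i hi => ?_⟩
      · rw [if_neg hx0, if_neg hx0, hJ3]; exact hI2 x hx hx0 i hi
      · simp only [if_true, Function.update_apply]
        rw [hJ3, hI3 hx i hi]
        by_cases c1 : i = (t + 1) * m + q
        · rw [if_pos c1, if_pos ⟨t + 1, q, by omega, by omega, c1, Or.inr ⟨hq, le_rfl⟩⟩]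
        rw [if_neg c1]
        by_cases c2 : i = q * m + (t + 1)
        · rw [if_pos c2, if_pos ⟨q, t + 1, by omega, by omega, c2, Or.inl ⟨hq, le_rfl⟩⟩]
        rw [if_neg c2]
        refine if_congr ⟨?_, ?_⟩ rfl rfl
        · rintro ⟨u, v, hu, hv, he, ⟨g1, g2⟩ | ⟨g1, g2⟩⟩
          · exact ⟨u, v, hu, hv, he, Or.inl ⟨g1, by omega⟩⟩
          · exact ⟨u, v, hu, hv, he, Or.inr ⟨g1, by omega⟩⟩
        · rintro ⟨u, v, hu, hv, he, ⟨g1, g2⟩ | ⟨g1, g2⟩⟩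
          · refine ⟨u, v, hu, hv, he, Or.inl ⟨g1, ?_⟩⟩
            by_contra hc
            obtain rfl : v = t + 1 := by omega
            exact c2 (by rw [he, g1.unique hq])
          · refine ⟨u, v, hu, hv, he, Or.inr ⟨g1, ?_⟩⟩
            by_contra hc
            obtain rfl : u = t + 1 := by omega
            exact c1 (by rw [he, g1.unique hq])
  · rintro h1 - ⟨hI1, hI2, hI3⟩
    refine ⟨fun x hx => ?_, fun x hx i hi => ?_⟩
    · rw [hI1 x hx]
      simp only [input]
      split_ifs <;> rfl
    · simp only [input]
      by_cases hx0 : x = 0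
      · subst hx0
        rw [hI3 hx i hi, if_pos rfl, adjCells]
        refine if_congr ⟨?_, ?_⟩ rfl rfl
        · rintro ⟨u, v, hu, hv, he, g⟩
          exact ⟨⟨u, hu⟩, ⟨v, hv⟩, he, preFin_adj.2 (g.imp And.left And.left)⟩
        · rintro ⟨u, v, he, g⟩
          have hu := u.2
          have hv := v.2
          exact ⟨u, v, hu, hv, he, (preFin_adj.1 g).imp (fun g => ⟨g, by omega⟩)
            fun g => ⟨g, by omega⟩⟩
      · rw [if_neg hx0]; exact hI2 x hx hx0 i hi

/-- The value of the measure on the tree with the depth list in `A 6` goes to `w 3`. -/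
def evalCmd (NP : ℕ) : Cmd := .seq (clearCmd NP) (.seq matrixCmd (.call 3))

theorem evalCmd_spec {NP a b s M : ℕ} {h : Store} {R : List ℕ} {N : ℕ} (hR : Stored R h)
    (hT : TreeList R) (hlen : R.length < N) (hs : N * N ≤ s) (hM : N ≤ M)
    (h3 : h.n 3 = a * N ^ b) (hs' : a * N ^ b ≤ s) (hM' : a * N ^ b ≤ M) :
    wp (subEnv H NP a b s M) (evalCmd NP) (fun h' => h'.w 3 = valList H R) h := by
  have hle : a * R.length ^ b ≤ a * N ^ b :=
    Nat.mul_le_mul_left _ (Nat.pow_le_pow_left hlen.le _)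
  refine wp_seq_of (clearCmd_spec h3 hs' hM' NP) fun h1 hI1 hk1 => ?_
  have hR1 : Stored R h1 := hR.congr (hk1.n 17 (clearCmd_mn _ (by decide)))
    (hk1.A 6 (clearCmd_mA _ _))
  refine wp_seq_of (matrixCmd_spec hR1 hT hlen hs hM hI1) fun h2 hI2 hk2 => ?_
  exact ⟨_, ⟨R.length, _, preFin_isTree hT.pos hT.root, hle.trans hs', hle.trans hM', hI2.1,
    fun x hx i hi => hI2.2 x hx i (hi.trans_le hle), rfl⟩, fun p pa => by simp [Store.setW, valList]⟩

end TreeDP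


/-! ### The dynamic program -/

namespace TreeDP

variable {H : GraphMeasure} {n : ℕ} {d nx : ℕ → ℕ}

theorem evalCmd_mn (NP : ℕ) {y : ℕ} (hy : y < 27) : (evalCmd NP).mn y = false := by
  simp [evalCmd, Cmd.mn, clearCmd_mn, matrixCmd, show y ≠ 27 by omega, show y ≠ 28 by omega,
    show y ≠ 29 by omega]

theorem evalCmd_mw (NP : ℕ) {y : ℕ} (hy : y ≠ 3) : (evalCmd NP).mw y = false := by
  simp [evalCmd, Cmd.mw, clearCmd_mw, matrixCmd, hy]

theorem evalCmd_mA (NP y : ℕ) : (evalCmd NP).mA y = false := by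
  simp [evalCmd, Cmd.mA, clearCmd_mA, matrixCmd]

theorem evalCmd_mW (NP y : ℕ) : (evalCmd NP).mW y = false := by
  simp [evalCmd, Cmd.mW, clearCmd_mW, matrixCmd]

theorem or_false_of {a b : Bool} (ha : a = false) (hb : b = false) :
    (a || b) = false := by rw [ha, hb]; rfl

/-- The parameters of the dynamic program. -/
structure Params (c K B L mode : ℕ) (h : Store) : Prop where
  c : h.n 3 = c
  K : h.n 4 = K
  B : h.n 5 = B
  L : h.n 6 = L
  mode : h.n 7 = mode

theorem Params.kept {c K B L mode : ℕ} {h h' : Store} {P : Cmd} (hq : Params c K B L mode h)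
    (hk : Kept P h h') (h3 : P.mn 3 = false) (h4 : P.mn 4 = false) (h5 : P.mn 5 = false)
    (h6 : P.mn 6 = false) (h7 : P.mn 7 = false) : Params c K B L mode h' :=
  ⟨(hk.n 3 h3).trans hq.c, (hk.n 4 h4).trans hq.K, (hk.n 5 h5).trans hq.B, (hk.n 6 h6).trans hq.L,
    (hk.n 7 h7).trans hq.mode⟩

theorem Params.setN {c K B L mode : ℕ} {h : Store} (hq : Params c K B L mode h) {x : ℕ}
    (hx : 7 < x) (v : ℕ) : Params c K B L mode (h.setN x v) := by
  obtain ⟨h1, h2, h3, h4, h5⟩ := hq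
  constructor <;> simp only [Store.setN] <;> rw [Function.update_of_ne (by omega)] <;> assumption

/-- The depth lists that the program tries. -/
def codeFam (d nx : ℕ → ℕ) (K B L mode : ℕ) (x : ℕ) : Set (List ℕ) :=
  {R | ∃ w < L, R = codeList d nx mode K B x w}

/-- Takes the component with code `n 16` of `x = n 10` into account. -/
def codeCmd (NP : ℕ) : Cmd :=
  .seq decodeCmd <| .seq alignCmd <| .seq (evalCmd NP) <| .seq (.setN 22 (.v 10)) <|
  .seq (.setN 26 (.add (.mul (.add (.v 10) (.c 1)) (.v 2)) (.c 1))) (minCmd 0 3)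

theorem codeCmd_mn (NP : ℕ) {y : ℕ} (hy : y < 12) : (codeCmd NP).mn y = false := by
  have h := evalCmd_mn NP (y := y) (by omega)
  refine or_false_of ?_ (or_false_of ?_ (or_false_of h ?_)) <;>
    interval_cases y <;> rfl

theorem codeCmd_mA (NP : ℕ) {y : ℕ} (hy : y < 5) : (codeCmd NP).mA y = false := by
  have h := evalCmd_mA NP y
  refine or_false_of ?_ (or_false_of ?_ (or_false_of h ?_)) <;>
    interval_cases y <;> rfl

theorem codeCmd_mw (NP : ℕ) {y : ℕ} (hy : y < 2) : (codeCmd NP).mw y = false := by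
  have h := evalCmd_mw NP (y := y) (by omega)
  refine or_false_of ?_ (or_false_of ?_ (or_false_of h ?_)) <;>
    interval_cases y <;> rfl

theorem codeCmd_mW (NP : ℕ) {y : ℕ} (hy : y = 1 ∨ y = 2) : (codeCmd NP).mW y = false := by
  have h := evalCmd_mW NP y
  refine or_false_of ?_ (or_false_of ?_ (or_false_of h ?_)) <;>
    rcases hy with rfl | rfl <;> rfl

/-- What the dynamic program needs from the resources and its parameters. -/
structure Fits (n N a b s M K B L mode : ℕ) : Prop where
  width : 2 * n + 2 ≤ N
  space : N * N * N ≤ s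
  rounds : N ≤ M
  sub_space : a * N ^ b ≤ s
  sub_rounds : a * N ^ b ≤ M
  digits : K ≤ 2 * n
  base : 0 < B
  base_eq : mode = 1 → B = n
  codes : L ≤ M

theorem Fits.room {n N a b s M K B L mode : ℕ} (hf : Fits n N a b s M K B L mode) (NP : ℕ) :
    Room (subEnv H NP a b s M) n N := ⟨hf.width, hf.space, hf.rounds⟩

theorem codeCmd_spec (hH : H.Additive) (hp : Pre n d nx) {N NP a b s M K B L mode : ℕ}
    (hf : Fits n N a b s M K B L mode) {h : Store} (hb : Base n N d nx h)
    (hq : Params (a * N ^ b) K B L mode h) {x w : ℕ} (hx : x < n) (h10 : h.n 10 = x)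
    (h16 : h.n 16 = w) (hw : w ≤ M) {fam : ℕ → Set (List ℕ)}
    (hD : DeletedOk H n d nx fam N (h.W 1) (x + 1)) {lo hi : ℕ → Set ℝ}
    (hrow : RowBetween n N (h.W 0) x lo hi) {R : List ℕ} (hR : R = codeList d nx mode K B x w) :
    wp (subEnv H NP a b s M) (codeCmd NP) (fun h' => RowBetween n N (h'.W 0) x
      (fun j => lo j ∪ {v | ∃ u ∈ valV H d nx fam False x R 1 (x + 1) j, v = valList H R + u})
      (fun j => hi j ∪ {v | ∃ u ∈ valV H d nx fam True x R 1 (x + 1) j, v = valList H R + u}) ∧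
      EqOff N x (h.W 0) (h'.W 0)) h := by
  have hr : Room (subEnv H NP a b s M) n N := hf.room NP
  have hwid := hf.width
  have hlt := hp.lt x hx
  have hsp : N * N ≤ s := (Nat.le_mul_of_pos_right _ (by omega)).trans hf.space
  have hT : TreeList R := hR ▸ treeList_codeList hp hx
  have hlen : R.length < N := by
    have := codeList_length hp (mode := mode) (B := B) (w := w) hx hf.digits
    rw [← hR] at this
    omega
  unfold codeCmd
  refine wp_seq_of (decodeCmd_spec hp hr hb hx h10 hq.K hq.B hq.mode h16 hf.digits hf.base
    hf.base_eq hw) fun h1 hR1 hk1 => ?_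
  rw [← hR] at hR1
  have hb1 := hb.kept hk1 rfl rfl rfl rfl
  have hq1 := hq.kept hk1 rfl rfl rfl rfl rfl
  have e10 : h1.n 10 = x := (hk1.n 10 rfl).trans h10
  refine wp_seq_of (alignCmd_spec hH hp hr hb1 (fam := fam) hx e10 hR1 hlen ?_) fun h2 hV hk2 => ?_
  · rw [hk1.W 1 rfl]; exact hD
  have hb2 := hb1.kept hk2 rfl rfl rfl rfl
  have hq2 := hq1.kept hk2 rfl rfl rfl rfl rfl
  have hR2 : Stored R h2 := hR1.congr (hk2.n 17 rfl) (hk2.A 6 rfl)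
  refine wp_seq_of (evalCmd_spec (H := H) (NP := NP) hR2 hT hlen hsp hf.rounds hq2.c hf.sub_space
    hf.sub_rounds) fun h3 hv hk3 => ?_
  have hb3 := hb2.kept hk3 (evalCmd_mn _ (by decide)) (evalCmd_mn _ (by decide)) (evalCmd_mA _ _)
    (evalCmd_mA _ _)
  have f10 : h3.n 10 = x :=
    ((hk3.n 10 (evalCmd_mn _ (by decide))).trans (hk2.n 10 rfl)).trans e10
  have fW0 : h3.W 0 = h.W 0 :=
    ((hk3.W 0 (evalCmd_mW _ _)).trans (hk2.W 0 rfl)).trans (hk1.W 0 rfl)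
  have fW3 : h3.W 3 = h2.W 3 := hk3.W 3 (evalCmd_mW _ _)
  rw [wp_seq, wp_setN, wp_seq, wp_setN]
  refine ⟨trivial, ⟨⟨⟨trivial, trivial⟩, trivial⟩, trivial⟩, ?_⟩
  refine wp_mono _ (minCmd_spec hr (r0 := x) (r1 := (x + 1) * N + 1) (u := valList H R)
    (lo := lo) (hi := hi) ?_ ?_ ?_ ?_ (lt_sq (by omega)) (mul_add_lt_sq (by omega) (by omega))
    (Or.inr (by decide)) ?_ ?_ (lo' := fun j => valV H d nx fam False x R 1 (x + 1) j)
    (hi' := fun j => valV H d nx fam True x R 1 (x + 1) j) ?_) ?_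
  · simp [Store.setN, hb3.n]
  · simp [Store.setN, hb3.N]
  · simp [Store.setN, NExp.eval, f10]
  · simp [Store.setN, NExp.eval, f10, hb3.N]
  · exact hv
  · show RowBetween n N (h3.W 0) x lo hi
    rw [fW0]; exact hrow
  · show RowBetween n N (h3.W 3) _ _ _
    rw [fW3]
    exact hV (x + 1) (by omega) (by omega) 1 hT.pos
  · rintro h4 ⟨g1, g2⟩
    refine ⟨g1, ?_⟩
    rw [← fW0]; exact g2

/-- The rows of `x = n 10` in all tables. -/
def vertexCmd (NP : ℕ) : Cmd := .seq forestCmd <| .seq deletedCmd <| .loop 16 (.v 6) (codeCmd NP)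

theorem vertexCmd_mn (NP : ℕ) {y : ℕ} (hy : y < 12) : (vertexCmd NP).mn y = false := by
  have h := codeCmd_mn NP hy
  refine or_false_of ?_ (or_false_of ?_ (or_false_of ?_ h)) <;>
    interval_cases y <;> rfl

theorem vertexCmd_mA (NP : ℕ) {y : ℕ} (hy : y < 5) : (vertexCmd NP).mA y = false := by
  have h := codeCmd_mA NP hy
  refine or_false_of ?_ (or_false_of ?_ h) <;> interval_cases y <;> rfl

theorem vertexCmd_mw (NP : ℕ) {y : ℕ} (hy : y < 2) : (vertexCmd NP).mw y = false := by
  have h := codeCmd_mw NP hy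
  refine or_false_of ?_ (or_false_of ?_ h) <;> interval_cases y <;> rfl

/-- The row of `x` starts with the values for deleted `x` and is lowered by one code after the
other. At the end, `valM_of_comp` shows that entries are attained, and `valM_cases` that every
component in the family has been tried. -/
theorem vertexCmd_spec (hH : H.Additive) (hp : Pre n d nx) {N NP a b s M K B L mode : ℕ}
    (hf : Fits n N a b s M K B L mode) {h : Store} (hb : Base n N d nx h)
    (hq : Params (a * N ^ b) K B L mode h) {x : ℕ} (hx : x < n) (h10 : h.n 10 = x)
    (hM : SubtreesOk H n d nx (codeFam d nx K B L mode) N (h.W 0) (x + 1))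
    (hD : DeletedOk H n d nx (codeFam d nx K B L mode) N (h.W 1) (x + 1)) :
    wp (subEnv H NP a b s M) (vertexCmd NP) (fun h' =>
      SubtreesOk H n d nx (codeFam d nx K B L mode) N (h'.W 0) x ∧
      DeletedOk H n d nx (codeFam d nx K B L mode) N (h'.W 1) x) h := by
  have hr : Room (subEnv H NP a b s M) n N := hf.room NP
  have hwid := hf.width
  have hlt := hp.lt x hx
  set fam := codeFam d nx K B L mode with hfam
  refine wp_seq_of (forestCmd_spec hH hp hr hb hx h10 hM) fun h1 hF hk1 => ?_
  have hb1 := hb.kept hk1 rfl rfl rfl rfl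
  have hq1 := hq.kept hk1 rfl rfl rfl rfl rfl
  have e10 : h1.n 10 = x := (hk1.n 10 rfl).trans h10
  refine wp_seq_of (deletedCmd_spec hp hr hb1 hx e10 (hF _ (by omega) (by omega)))
    fun h2 ⟨⟨hD1, hD2⟩, hS1, hS2⟩ hk2 => ?_
  have hb2 := hb1.kept hk2 rfl rfl rfl rfl
  have hq2 := hq1.kept hk2 rfl rfl rfl rfl rfl
  have f10 : h2.n 10 = x := (hk2.n 10 rfl).trans e10
  rw [hk1.W 1 rfl] at hD2
  rw [hk1.W 0 rfl] at hS2
  have hDx : DeletedOk H n d nx fam N (h2.W 1) x := by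
    intro i hi hin
    rcases hi.eq_or_lt with rfl | hi
    · exact hD1
    · exact hD2.row (by omega) (by omega) (hD i hi hin)
  refine wp_loop (m := L) (fun w h' => RowBetween n N (h'.W 0) x
    (fun j => valD H d nx fam False x j ∪ {v | ∃ w' < w,
      ∃ u ∈ valV H d nx fam False x (codeList d nx mode K B x w') 1 (x + 1) j,
      v = valList H (codeList d nx mode K B x w') + u})
    (fun j => valD H d nx fam True x j ∪ {v | ∃ w' < w,
      ∃ u ∈ valV H d nx fam True x (codeList d nx mode K B x w') 1 (x + 1) j,
      v = valList H (codeList d nx mode K B x w') + u}) ∧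
    EqOff N x (h.W 0) (h'.W 0)) trivial hq2.L hf.codes ?_ ?_ ?_
  · refine ⟨fun j hj => (hS1 j hj).congr (fun v hv => Or.inl hv) ?_, hS2⟩
    rintro v (hv | ⟨w, hw, -⟩)
    · exact hv
    · omega
  · rintro w hw h3 hk3 ⟨hI1, hI2⟩
    have hmn : ∀ y < 12, (Cmd.loop 16 (.v 6) (codeCmd NP)).mn y = false := fun y hy =>
      or_false_of (by rw [beq_eq_false_iff_ne]; omega) (codeCmd_mn NP hy)
    have hb3 := hb2.kept hk3 (hmn 0 (by decide)) (hmn 2 (by decide)) (codeCmd_mA NP (by decide))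
      (codeCmd_mA NP (by decide))
    have hq3 := hq2.kept hk3 (hmn 3 (by decide)) (hmn 4 (by decide)) (hmn 5 (by decide))
      (hmn 6 (by decide)) (hmn 7 (by decide))
    have g10 : h3.n 10 = x := (hk3.n 10 (hmn 10 (by decide))).trans f10
    have gW : h3.W 1 = h2.W 1 := hk3.W 1 (codeCmd_mW NP (Or.inl rfl))
    refine wp_mono _ (codeCmd_spec hH hp hf (hb3.setN 16 w (by decide) (by decide))
      (hq3.setN (by decide) w) hx (w := w) ?_ ?_ (hw.le.trans hf.codes) (fam := fam) ?_ hI1 rfl) ?_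
    · simp [Store.setN, g10]
    · simp [Store.setN]
    · show DeletedOk H n d nx fam N (h3.W 1) _
      rw [gW]
      exact fun i hi => hDx i (by omega)
    · rintro h4 ⟨hJ1, hJ2⟩
      refine ⟨fun j hj => (hJ1 j hj).congr ?_ ?_, hI2.trans hJ2⟩
      · rintro v ((hv | ⟨w', hw', hv⟩) | hv)
        · exact Or.inl hv
        · exact Or.inr ⟨w', by omega, hv⟩
        · exact Or.inr ⟨w, by omega, hv⟩
      · rintro v (hv | ⟨w', hw', hv⟩)
        · exact Or.inl (Or.inl hv)
        · rcases Nat.lt_succ_iff_lt_or_eq.1 hw' with hw' | rfl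
          · exact Or.inl (Or.inr ⟨w', hw', hv⟩)
          · exact Or.inr hv
  · rintro h3 hk3 ⟨hI1, hI2⟩
    refine ⟨fun i hi hin => ?_, ?_⟩
    · rcases hi.eq_or_lt with rfl | hi
      · refine fun j hj => (hI1 j hj).congr ?_ ?_
        · rintro v (hv | ⟨w, hw, u, hu, rfl⟩)
          · exact valM_of_valD hv
          · exact valM_of_comp hH hp hx (treeList_codeList hp hx).head hu
        · intro v hv
          rcases valM_cases hH hp hx hv with hv | ⟨R, hR, u, hu, rfl⟩
          · exact Or.inl hv
          · obtain ⟨w, hw, rfl⟩ := hR trivial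
            exact Or.inr ⟨w, hw, u, hu, rfl⟩
      · exact hI2.row (by omega) (by omega) (hM i hi hin)
    · rw [hk3.W 1 (codeCmd_mW NP (Or.inl rfl))]
      exact hDx

def tablesCmd (NP : ℕ) : Cmd :=
  .loop 11 (.v 0) (.seq (.setN 10 (.sub (.sub (.v 0) (.c 1)) (.v 11))) (vertexCmd NP))

theorem tablesCmd_mn (NP : ℕ) {y : ℕ} (hy : y < 10) : (tablesCmd NP).mn y = false := by
  have h := vertexCmd_mn NP (y := y) (by omega)
  refine or_false_of ?_ (or_false_of ?_ h) <;> interval_cases y <;> rfl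

theorem tablesCmd_mw (NP : ℕ) {y : ℕ} (hy : y < 2) : (tablesCmd NP).mw y = false :=
  vertexCmd_mw NP hy

theorem tablesCmd_mA (NP : ℕ) {y : ℕ} (hy : y < 5) : (tablesCmd NP).mA y = false :=
  vertexCmd_mA NP hy

theorem tablesCmd_spec (hH : H.Additive) (hp : Pre n d nx) {N NP a b s M K B L mode : ℕ}
    (hf : Fits n N a b s M K B L mode) {h : Store} (hb : Base n N d nx h)
    (hq : Params (a * N ^ b) K B L mode h) :
    wp (subEnv H NP a b s M) (tablesCmd NP) (fun h' =>
      SubtreesOk H n d nx (codeFam d nx K B L mode) N (h'.W 0) 0) h := by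
  have hwid := hf.width
  have hrounds := hf.rounds
  refine wp_loop (m := n) (fun t h' =>
      SubtreesOk H n d nx (codeFam d nx K B L mode) N (h'.W 0) (n - t) ∧
      DeletedOk H n d nx (codeFam d nx K B L mode) N (h'.W 1) (n - t)) trivial hb.n
    (show n ≤ M by omega) ⟨fun i hi => by omega, fun i hi => by omega⟩ ?_ ?_
  · rintro t ht h1 hk1 ⟨hI1, hI2⟩
    have hb1 := hb.kept hk1 (tablesCmd_mn NP (by decide)) (tablesCmd_mn NP (by decide))
      (tablesCmd_mA NP (by decide)) (tablesCmd_mA NP (by decide))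
    have hq1 := hq.kept hk1 (tablesCmd_mn NP (by decide)) (tablesCmd_mn NP (by decide))
      (tablesCmd_mn NP (by decide)) (tablesCmd_mn NP (by decide)) (tablesCmd_mn NP (by decide))
    rw [wp_seq, wp_setN]
    refine ⟨⟨⟨trivial, trivial⟩, trivial⟩, ?_⟩
    have e : NExp.eval (h1.setN 11 t) (.sub (.sub (.v 0) (.c 1)) (.v 11)) = n - (t + 1) := by
      simp [NExp.eval, Store.setN, hb1.n]; omega
    rw [e]
    have ht1 : n - (t + 1) + 1 = n - t := by omega
    refine vertexCmd_spec hH hp hf ((hb1.setN 11 t (by decide) (by decide)).setN 10 _ (by decide)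
      (by decide)) ((hq1.setN (by decide) t).setN (by decide) _) (by omega) ?_ ?_ ?_
    · simp [Store.setN]
    · rw [ht1]; exact hI1
    · rw [ht1]; exact hI2
  · rintro h1 - ⟨hI1, -⟩
    rw [Nat.sub_self] at hI1
    exact hI1

end TreeDP


/-! ### Correctness of the values -/

namespace TreeDP

variable {H : GraphMeasure} {n : ℕ} {d nx : ℕ → ℕ} {G : SimpleGraph (Fin n)}

/-- The vertices with numbers in `S`. -/
def cutOf (φ : preFin d n ≃g G) (S : Finset ℕ) : Set (Fin n) := {v | (φ.symm v).val ∈ S}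

theorem cutOf_ncard (φ : preFin d n ≃g G) {S : Finset ℕ} (hS : S ⊆ Finset.Ico 0 n) :
    (cutOf φ S).ncard = S.card := by
  rw [← Set.ncard_coe_finset, ← Set.ncard_image_of_injective (cutOf φ S)
    (f := fun v => (φ.symm v).val) (Fin.val_injective.comp φ.symm.injective)]
  congr 1
  ext l
  constructor
  · rintro ⟨v, hv, rfl⟩; exact hv
  · intro hl
    have hln := (Finset.mem_Ico.1 (hS hl)).2
    exact ⟨φ ⟨l, hln⟩, by simpa [cutOf] using hl, by simp⟩

theorem exists_cutOf (φ : preFin d n ≃g G) (S₀ : Set (Fin n)) :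
    ∃ S ⊆ Finset.Ico 0 n, cutOf φ S = S₀ := by
  classical
  refine ⟨(Finset.univ.filter (fun l => φ l ∈ S₀)).image Fin.val, fun l hl => ?_, ?_⟩
  · obtain ⟨u, -, rfl⟩ := Finset.mem_image.1 hl
    simp
  · ext v
    simp only [cutOf, Set.mem_ofPred_eq, Finset.mem_image, Finset.mem_filter, Finset.mem_univ,
      true_and]
    constructor
    · rintro ⟨u, hu, he⟩
      rwa [Fin.ext he, RelIso.apply_symm_apply] at hu
    · intro hv
      exact ⟨φ.symm v, by simpa using hv, rfl⟩

theorem valOn_cutOf (φ : preFin d n ≃g G) (S : Finset ℕ) :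
    valOn H d ((Finset.Ico 0 n).filter (· ∉ S)) = H.val (G.induce (cutOf φ S)ᶜ) := by
  refine valOn_eq H _ (fun v => (φ.symm v.1).val) (fun u v h => ?_) (fun l => ?_) fun u v => ?_
  · exact Subtype.ext (φ.symm.injective (Fin.ext h))
  · rw [Finset.mem_filter, Finset.mem_Ico]
    constructor
    · rintro ⟨⟨-, hl⟩, hS⟩
      exact ⟨⟨φ ⟨l, hl⟩, by simpa [cutOf] using hS⟩, by simp⟩
    · rintro ⟨v, rfl⟩
      exact ⟨⟨Nat.zero_le _, Fin.is_lt _⟩, v.2⟩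
  · exact φ.symm.map_rel_iff

theorem isYes_of_mem_valI (φ : preFin d n ≃g G) {fam : ℕ → Set (List ℕ)} {k : ℕ} {τ v : ℝ}
    (hv : v ∈ valI H d nx fam False 0 n k) (hτ : v ≤ τ) : H.IsYes G k τ := by
  obtain ⟨S, hS, hc, -, rfl⟩ := hv
  exact ⟨cutOf φ S, (cutOf_ncard φ hS).trans hc, by rwa [← valOn_cutOf]⟩

/-- A witness whose components are in `fam` is taken into account. -/
theorem exists_mem_valI (φ : preFin d n ≃g G) {fam : ℕ → Set (List ℕ)} {k : ℕ} {τ : ℝ}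
    {S : Finset ℕ} (hS : S ⊆ Finset.Ico 0 n) (hw : H.IsWitness G k τ (cutOf φ S))
    (hfam : ∀ y < n, y ∉ S → dlist d nx y S y ∈ fam y) :
    ∃ v ∈ valI H d nx fam True 0 n k, v ≤ τ :=
  ⟨_, ⟨S, hS, (cutOf_ncard φ hS).symm.trans hw.1, fun _ y _ h2 h3 => hfam y h2 h3, rfl⟩,
    by rw [valOn_cutOf φ]; exact hw.2⟩

/-- Every set of `K` vertices is given by digits. -/
theorem dlist_mem_codeFam_cut {K : ℕ} {S : Finset ℕ} (hS : S ⊆ Finset.Ico 0 n)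
    (hK : S.card = K) {y : ℕ} (hyS : y ∉ S) :
    dlist d nx y S y ∈ codeFam d nx K n (n ^ K) 1 y := by
  set e := S.equivFinOfCardEq hK
  have hmem : ∀ b ∈ S, b < n := fun b hb => (Finset.mem_Ico.1 (hS hb)).2
  obtain ⟨w, hw, h⟩ := exists_digits (B := n) K
    (fun l => if hl : l < K then (e.symm ⟨l, hl⟩).1 else 0) fun l hl => by
      rw [dif_pos hl]; exact hmem _ (e.symm _).2
  refine ⟨w, hw, ?_⟩
  rw [codeList, if_pos rfl]
  refine dlist_congr _ fun b h1 h2 => ?_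
  rw [cutSet, Finset.mem_filter, Finset.mem_image]
  constructor
  · intro hb
    refine ⟨⟨e ⟨b, hb⟩, Finset.mem_range.2 (e ⟨b, hb⟩).2, ?_⟩, ?_⟩
    · rw [h _ (e ⟨b, hb⟩).2, dif_pos (e ⟨b, hb⟩).2]
      simp
    · exact lt_of_le_of_ne h1 fun hc => hyS (hc ▸ hb)
  · rintro ⟨⟨l, hl, rfl⟩, -⟩
    rw [h l (Finset.mem_range.1 hl), dif_pos (Finset.mem_range.1 hl)]
    exact (e.symm _).2

/-! ### Small components have short walks -/

/-- Lists of depths of trees in preorder, with the last element. -/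
inductive WalkList : List ℕ → ℕ → Prop
  | root : WalkList [0] 0
  | step {R : List ℕ} {v v' : ℕ} (h : WalkList R v) (h1 : 1 ≤ v') (h2 : v' ≤ v + 1) :
      WalkList (R ++ [v']) v'

theorem walk_congr {f g : ℕ → ℕ} {K : ℕ} (h : ∀ l < K, f l = g l) : walk f K = walk g K := by
  induction K with
  | zero => rfl
  | succ K ih => rw [walk, walk, ih fun l hl => h l (by omega), h K (by omega)]

/-- Serves for the climb between two consecutive entries and for the padding at the end of a code.
-/
theorem walk_up {f : ℕ → ℕ} {K g : ℕ} (h : ∀ l, K ≤ l → l < K + g → f l ≠ 1) :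
    walk f (K + g) = ((walk f K).1, max 1 ((walk f K).2 - g)) := by
  induction g with
  | zero =>
    have := walk_pos f K
    rw [add_zero, Nat.sub_zero, max_eq_right this]
  | succ g ih =>
    rw [← add_assoc, walk, if_neg (h _ (by omega) (by omega)), ih fun l h1 h2 => h l h1 (by omega)]
    simp only [Prod.mk.injEq, true_and]
    split_ifs <;> omega

/-- To append depth `v'` after `v`, climb `v + 1 - v'` times and then descend once. Each climb
undoes an earlier descent, so the length of the walk plus the current depth is less than twice the
number of vertices. -/
theorem WalkList.exists_walk {R : List ℕ} {v : ℕ} (h : WalkList R v) :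
    ∃ (f : ℕ → ℕ) (K : ℕ), (∀ l, f l < 2) ∧ (∀ l, K ≤ l → f l = 0) ∧ walk f K = (R, v + 1) ∧
      K + v + 1 ≤ 2 * R.length := by
  induction h with
  | root => exact ⟨fun _ => 0, 0, fun _ => by simp, fun _ _ => rfl, rfl, by simp⟩
  | @step R v v' h h1 h2 ih =>
    obtain ⟨f, K, hf, h0, hw, hK⟩ := ih
    refine ⟨Function.update f (K + (v + 1 - v')) 1, K + (v + 1 - v') + 1, fun l => ?_,
      fun l hl => ?_, ?_, ?_⟩
    · rw [Function.update_apply]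
      split_ifs
      · omega
      · exact hf l
    · rw [Function.update_of_ne (by omega)]
      exact h0 l (by omega)
    · rw [walk, Function.update_self, if_pos rfl, walk_congr (g := f)
        (fun l hl => Function.update_of_ne (by omega) _ _),
        walk_up fun l h3 h4 => by rw [h0 l h3]; omega, hw]
      simp only [Prod.mk.injEq]
      rw [show max 1 (v + 1 - (v + 1 - v')) = v' by omega]
      exact ⟨rfl, rfl⟩
    · rw [List.length_append, List.length_singleton]
      omega

theorem WalkList.mem_codeFam {R : List ℕ} {v : ℕ} (h : WalkList R v) {L : ℕ} (hL : R.length ≤ L)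
    {mode : ℕ} (hm : mode ≠ 1) (y : ℕ) : R ∈ codeFam d nx (2 * L) 2 (2 ^ (2 * L)) mode y := by
  obtain ⟨f, K, hf, h0, hw, hK⟩ := h.exists_walk
  obtain ⟨w, hw', hd⟩ := exists_digits (B := 2) (2 * L) f fun l _ => hf l
  refine ⟨w, hw', ?_⟩
  rw [codeList, if_neg hm, walk_congr hd, show 2 * L = K + (2 * L - K) by omega,
    walk_up fun l h1 _ => by rw [h0 l h1]; omega, hw]

/-- The parents of vertices of a component belong to it, except for the root. -/
theorem not_hid_par (hp : Pre n d nx) {y p l : ℕ} {S : Finset ℕ} (hy : y < n) (hl : l < nx y)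
    (hpl : Par d p l) (hh : ¬ Hid nx S y l) : ¬ Hid nx S y p := by
  rintro ⟨b, hb, h1, h2, h3⟩
  have hle := hp.le y hy
  have hpl' := hpl.1
  have := hp.par_lt (by omega) hpl
  have := hp.laminar (i := b) (by omega) h2 h3
  exact hh ⟨b, hb, h1, by omega, by omega⟩

theorem exists_par_above (hp : Pre n d nx) {y l : ℕ} (hy : y < n) (hyl : y < l) (hl : l < nx y) :
    ∃ p, y ≤ p ∧ Par d p l :=
  exists_par hyl (hp.inside y hy l hyl hl)

/-- Let `l` be the last vertex of the list so far. The parent of the next one is in the component,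
hence at or before `l`. If it is `l`, the depth grows by one; otherwise `l` lies between parent and
child, and so is at least as deep as the child. -/
theorem walkList_dlist (hp : Pre n d nx) (hd : ∀ i q, q < n → Par d i q → d q = d i + 1) {y : ℕ}
    (hy : y < n) {S : Finset ℕ} (hyS : y ∉ S) : ∃ v, WalkList (dlist d nx y S y) v := by
  have hlt := hp.lt y hy
  have hle := hp.le y hy
  have key : ∀ t, y + t < nx y → ∃ l, y ≤ l ∧ l ≤ y + t ∧
      (∀ l', l < l' → l' ≤ y + t → Hid nx S y l') ∧
      WalkList (((List.range' y (t + 1)).filter (fun l => ¬ Hid nx S y l)).map (fun l => d l - d y))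
        (d l - d y) := by
    intro t
    induction t with
    | zero =>
      intro _
      have hh : ¬ Hid nx S y y := by
        rintro ⟨b, hb, h1, h2, -⟩
        exact hyS (le_antisymm h1 h2 ▸ hb)
      refine ⟨y, le_rfl, le_rfl, fun l' h1 h2 => by omega, ?_⟩
      rw [Nat.sub_self]
      simpa [hh] using WalkList.root
    | succ t ih =>
      intro ht
      obtain ⟨l, h1, h2, h3, h4⟩ := ih (by omega)
      rw [List.range'_1_concat, List.filter_append, List.map_append]
      by_cases hh : Hid nx S y (y + (t + 1))
      · refine ⟨l, h1, by omega, fun l' h5 h6 => ?_, by simpa [hh] using h4⟩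
        rcases Nat.lt_succ_iff_lt_or_eq.1 (show l' < y + t + 1 + 1 by omega) with h7 | rfl
        · exact h3 l' h5 (by omega)
        · exact hh
      · refine ⟨y + (t + 1), by omega, le_rfl, fun l' h5 h6 => by omega, ?_⟩
        obtain ⟨p, hp1, hp2⟩ := exists_par_above hp hy (l := y + (t + 1)) (by omega) ht
        have hpn := not_hid_par hp hy ht hp2 hh
        have hpl : p ≤ l := by
          by_contra hc
          exact hpn (h3 p (by omega) (by have := hp2.1; omega))
        have hin := hp.inside y hy (y + (t + 1)) (by omega) ht
        have hdp := hd p _ (by omega) hp2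
        have hdl : d y ≤ d l := by
          rcases h1.eq_or_lt with rfl | h1
          · exact le_rfl
          · exact (hp.inside y hy l h1 (by omega)).le
        have hstep : d (y + (t + 1)) ≤ d l + 1 := by
          rcases hpl.eq_or_lt with rfl | hpl
          · omega
          · have := hp2.2.2 l hpl (by omega)
            omega
        have := h4.step (v' := d (y + (t + 1)) - d y) (by omega) (by omega)
        simpa [hh] using this
  obtain ⟨l, -, -, -, h⟩ := key (nx y - y - 1) (by omega)
  rw [show nx y - y - 1 + 1 = nx y - y by omega] at h
  exact ⟨_, h⟩

/-- The components after the deletion of a trimming set are small. -/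
theorem dlist_length_le (hp : Pre n d nx) (φ : preFin d n ≃g G) {S : Finset ℕ} {b : ℝ}
    (hS : IsTrimming G b (cutOf φ S)) {y : ℕ} (hy : y < n) (hyS : y ∉ S) :
    ((dlist d nx y S y).length : ℝ) ≤ b := by
  have hlt := hp.lt y hy
  have hle := hp.le y hy
  have hnot : ∀ l, y ≤ l → l < nx y → ¬ Hid nx S y l → l ∉ S := fun l h1 h2 hh hl =>
    hh ⟨l, hl, h1, le_rfl, hp.lt l (by omega)⟩
  have hyn : ¬ Hid nx S y y := by
    rintro ⟨b, hb, h1, h2, -⟩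
    exact hyS (le_antisymm h1 h2 ▸ hb)
  let f : ∀ l, y ≤ l → l < nx y → ¬ Hid nx S y l → ((cutOf φ S)ᶜ : Set (Fin n)) :=
    fun l h1 h2 hh => ⟨φ ⟨l, by omega⟩, by simpa [cutOf] using hnot l h1 h2 hh⟩
  -- Climbing to parents never meets a deleted vertex before `y`. So the whole list lies in the
  -- connected component of `y`, whose size the trimming bounds.
  have hreach : ∀ l h1 h2 hh, (G.induce (cutOf φ S)ᶜ).Reachable (f l h1 h2 hh)
      (f y le_rfl hlt hyn) := by
    intro l
    induction l using Nat.strong_induction_on with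
    | _ l ih =>
      intro h1 h2 hh
      rcases h1.eq_or_lt with rfl | h1'
      · exact .refl _
      · obtain ⟨p, hp1, hp2⟩ := exists_par_above hp hy h1' h2
        have hpl := hp2.1
        have hpn := not_hid_par hp hy h2 hp2 hh
        refine (SimpleGraph.Adj.reachable ?_).trans (ih p hpl hp1 (by omega) hpn)
        exact φ.map_rel_iff.2 (Or.inr hp2)
  refine le_trans ?_ (hS ((G.induce (cutOf φ S)ᶜ).connectedComponentMk (f y le_rfl hlt hyn)))
  rw [Nat.cast_le, dlist, List.length_map,
    ← List.toFinset_card_of_nodup ((List.nodup_range' (s := y) (n := nx y - y)).filter _),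
    ← Set.ncard_image_of_injective _
      (f := fun v : ((cutOf φ S)ᶜ : Set (Fin n)) => (φ.symm v.1).val)
      (fun u v h => Subtype.ext (φ.symm.injective (Fin.ext h))), ← Set.ncard_coe_finset]
  refine Set.ncard_le_ncard (fun l hl => ?_) (Set.toFinite _)
  rw [List.coe_toFinset, Set.mem_ofPred_eq, List.mem_filter, List.mem_range'_1] at hl
  have hh : ¬ Hid nx S y l := by simpa using hl.2
  refine ⟨f l (by omega) (by omega) hh, ?_, by simp [f]⟩
  rw [SimpleGraph.ConnectedComponent.mem_supp_iff, SimpleGraph.ConnectedComponent.eq]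
  exact hreach l (by omega) (by omega) hh

end TreeDP


/-! ### The choice of the codes -/

namespace TreeDP

variable {H : GraphMeasure} {n : ℕ} {d nx : ℕ → ℕ} {G : SimpleGraph (Fin n)}

/-- `q` is a bound for the sizes of components, up to a constant factor. -/
structure SizeBound (n k : ℕ) (c t q : ℝ) (i : ℕ) : Prop where
  eq : q = c * (2 ^ t) ^ i
  le : 1 ≤ k → n ≤ 2 ^ i * k
  lt : i = 0 ∨ 2 ^ i * k < 2 * n

/-- `K`-digit codes in base `B`, `E` of them, describe deleted sets or components, whichever needs
fewer bits. -/
structure Choice (n k : ℕ) (c t : ℝ) (K B E mode : ℕ) (q : ℝ) (i l : ℕ) : Prop where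
  size : SizeBound n k c t q i
  log_le : n ≤ 2 ^ l
  log_lt : l = 0 ∨ 2 ^ l < 2 * n
  count : E = B ^ K
  cases : (mode = 1 ∧ B = n ∧ K = k ∧ ((k * l : ℕ) : ℝ) ≤ q) ∨
    (mode = 0 ∧ B = 2 ∧ q < ((k * l : ℕ) : ℝ) ∧ ∃ L ≤ n, K = 2 * L ∧ (L : ℝ) ≤ q ∧
      ∀ m ≤ n, (m : ℝ) ≤ q → m ≤ L)

/-- The bound for the sizes of components. -/
noncomputable def boundCmd (c t : ℝ) : Cmd :=
  .seq (.setN 12 (.c 1)) <| .seq (.setW 1 (.real c)) <| .loop 13 (.v 0) <|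
    .ite (.lt (.mul (.v 12) (.v 1)) (.v 0)) (.seq (.setN 12 (.mul (.c 2) (.v 12)))
      (.setW 1 (.scale (2 ^ t) (.v 1)))) .skip

/-- The machine has no real powers. The constant `2 ^ t` is part of the program, and `n / k` is
replaced by a power `2 ^ i` found by repeated doubling, which costs only a constant factor. For `1 ≤
k`, `n` rounds suffice because `n < 2 ^ n`; for `k = 0` no lower bound on `2 ^ i` is claimed. -/
theorem boundCmd_spec {E : Env} {h : Store} {k : ℕ} (hn : h.n 0 = n) (hk : h.n 1 = k)
    (hM : n ≤ E.M) (c t : ℝ) :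
    wp E (boundCmd c t) (fun h' => ∃ (q : ℝ) (i : ℕ), h'.w 1 = q ∧ SizeBound n k c t q i) h := by
  unfold boundCmd
  rw [wp_seq, wp_setN, wp_seq, wp_setW]
  refine ⟨trivial, trivial, wp_loop (m := n) (fun r h' => ∃ i, i ≤ r ∧ h'.n 12 = 2 ^ i ∧
    h'.w 1 = ((c * (2 ^ t) ^ i : ℝ) : WithTop ℝ) ∧ (i = r ∨ n ≤ 2 ^ i * k) ∧
    (i = 0 ∨ 2 ^ i * k < 2 * n)) trivial ?_ hM ?_ ?_ ?_⟩
  · simp [NExp.eval, Store.setN, Store.setW, hn]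
  · exact ⟨0, le_rfl, by simp [Store.setN, Store.setW, NExp.eval],
      by simp [Store.setN, Store.setW, WExp.eval], Or.inl rfl, Or.inl rfl⟩
  · rintro r hr h1 hk1 ⟨i, hi, h2, h3, h4, h5⟩
    have e0 : h1.n 0 = n := (hk1.n 0 rfl).trans (by simp [Store.setN, Store.setW, hn])
    have e1 : h1.n 1 = k := (hk1.n 1 rfl).trans (by simp [Store.setN, Store.setW, hk])
    simp only [wp_ite, wp_skip, wp_seq, wp_setN, wp_setW, BExp.ok, BExp.eval, WExp.ok, WExp.eval,
      NExp.ok, NExp.eval, Store.setN, Store.setW, Function.update_apply, e0, e1, h2, h3,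
      Nat.reduceEqDiff, if_true, if_false, true_and, and_true]
    refine ⟨fun hc => ⟨i + 1, by omega, by ring, ?_, Or.inl ?_, Or.inr ?_⟩,
      fun hc => ⟨i, by omega, rfl, rfl, Or.inr (by omega), h5⟩⟩
    · rw [WithTop.map_coe]
      congr 1
      ring
    · omega
    · rw [pow_succ, mul_right_comm]; omega
  · rintro h1 - ⟨i, hi, h2, h3, h4, h5⟩
    refine ⟨_, i, h3, rfl, fun hk => ?_, h5⟩
    rcases h4 with rfl | h4
    · exact Nat.lt_two_pow_self.le.trans (Nat.le_mul_of_pos_right _ hk)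
    · exact h4

/-- The number of bits of `n 0`. -/
def logCmd : Cmd :=
  .seq (.setN 14 (.c 1)) <| .seq (.setN 9 (.c 0)) <| .loop 13 (.v 0) <|
    .ite (.lt (.v 14) (.v 0)) (.seq (.setN 14 (.mul (.c 2) (.v 14)))
      (.setN 9 (.add (.v 9) (.c 1)))) .skip

theorem logCmd_spec {E : Env} {h : Store} (hn : h.n 0 = n) (hM : n ≤ E.M) :
    wp E logCmd (fun h' => n ≤ 2 ^ h'.n 9 ∧ (h'.n 9 = 0 ∨ 2 ^ h'.n 9 < 2 * n)) h := by
  unfold logCmd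
  rw [wp_seq, wp_setN, wp_seq, wp_setN]
  refine ⟨trivial, trivial, wp_loop (m := n) (fun r h' => h'.n 14 = 2 ^ h'.n 9 ∧
    (h'.n 9 = r ∨ n ≤ 2 ^ h'.n 9) ∧ (h'.n 9 = 0 ∨ 2 ^ h'.n 9 < 2 * n)) trivial ?_ hM ?_ ?_ ?_⟩
  · simp [NExp.eval, Store.setN, hn]
  · simp [Store.setN, NExp.eval]
  · rintro r hr h1 hk1 ⟨h2, h3, h4⟩
    have e0 : h1.n 0 = n := (hk1.n 0 rfl).trans (by simp [Store.setN, hn])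
    simp only [wp_ite, wp_skip, wp_seq, wp_setN, BExp.ok, BExp.eval, NExp.ok, NExp.eval,
      Store.setN, Function.update_apply, e0, h2, Nat.reduceEqDiff, if_true, if_false, true_and,
      and_true]
    refine ⟨fun hc => ⟨by ring, Or.inl (by omega), Or.inr ?_⟩, fun hc => ⟨Or.inr (by omega), h4⟩⟩
    rw [pow_succ]; omega
  · rintro h1 - ⟨h2, h3, h4⟩
    refine ⟨?_, h4⟩
    rcases h3 with h3 | h3
    · rw [h3]; exact Nat.lt_two_pow_self.le
    · exact h3

/-- The largest number of vertices that is at most `w 1`. -/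
def floorCmd : Cmd :=
  .seq (.setN 8 (.c 0)) <| .loop 13 (.v 0) <|
    .ite (.wle (.ofN (.add (.v 13) (.c 1))) (.v 1)) (.setN 8 (.add (.v 13) (.c 1))) .skip

/-- Rounding down is not an instruction, so every number up to `n` is compared with `q`. Larger ones
are not needed, since no component has more than `n` vertices. -/
theorem floorCmd_spec {E : Env} {h : Store} {q : ℝ} (hn : h.n 0 = n) (hq : h.w 1 = q)
    (hq0 : 0 ≤ q) (hM : n ≤ E.M) :
    wp E floorCmd (fun h' => h'.n 8 ≤ n ∧ (h'.n 8 : ℝ) ≤ q ∧ ∀ m ≤ n, (m : ℝ) ≤ q → m ≤ h'.n 8)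
      h := by
  unfold floorCmd
  rw [wp_seq, wp_setN]
  refine ⟨trivial, wp_loop (m := n) (fun r h' => h'.n 8 ≤ r ∧ (h'.n 8 : ℝ) ≤ q ∧
    ∀ m ≤ r, (m : ℝ) ≤ q → m ≤ h'.n 8) trivial ?_ hM ?_ ?_ fun h' _ hI => hI⟩
  · simp [NExp.eval, Store.setN, hn]
  · refine ⟨by simp [Store.setN, NExp.eval], by simpa [Store.setN, NExp.eval] using hq0,
      fun m hm _ => by omega⟩
  · rintro r hr h1 hk1 ⟨h2, h3, h4⟩
    have e1 : h1.w 1 = q := (hk1.w 1 rfl).trans hq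
    simp only [wp_ite, wp_skip, wp_setN, BExp.ok, BExp.eval, WExp.ok, WExp.eval, NExp.ok, NExp.eval,
      Store.setN, Function.update_apply, e1, Nat.reduceEqDiff, if_true, if_false, true_and,
      and_true, WithTop.coe_le_coe]
    refine ⟨fun hc => ⟨le_rfl, hc, fun m hm _ => hm⟩, fun hc => ⟨by omega, h3, fun m hm hmq => ?_⟩⟩
    rcases Nat.lt_succ_iff_lt_or_eq.1 (show m < r + 1 + 1 by omega) with hm | rfl
    · exact h4 m (by omega) hmq
    · exact absurd hmq hc

/-- The number and the kind of the codes. -/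
noncomputable def choiceCmd (c t : ℝ) : Cmd :=
  .seq (boundCmd c t) <| .seq logCmd <| .seq floorCmd <|
  .seq (.ite (.wle (.ofN (.mul (.v 1) (.v 9))) (.v 1))
    (.seq (.setN 7 (.c 1)) (.seq (.setN 5 (.v 0)) (.setN 4 (.v 1))))
    (.seq (.setN 7 (.c 0)) (.seq (.setN 5 (.c 2)) (.setN 4 (.mul (.c 2) (.v 8)))))) <|
  .seq (.setN 6 (.c 1)) (.loop 13 (.v 4) (.setN 6 (.mul (.v 6) (.v 5))))

theorem choiceCmd_spec {E : Env} {h : Store} {k : ℕ} (hn : h.n 0 = n) (hk : h.n 1 = k)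
    (hkn : k ≤ n) (hM : 2 * n ≤ E.M) {c t : ℝ} (hc : 0 < c) :
    wp E (choiceCmd c t) (fun h' => ∃ K B L mode q i l, Choice n k c t K B L mode q i l ∧
      h'.n 4 = K ∧ h'.n 5 = B ∧ h'.n 6 = L ∧ h'.n 7 = mode) h := by
  refine wp_seq_of (boundCmd_spec hn hk (by omega) c t) fun h1 ⟨q, i, hq, hs⟩ hk1 => ?_
  have hq0 : 0 ≤ q := by rw [hs.eq]; positivity
  refine wp_seq_of (logCmd_spec ((hk1.n 0 rfl).trans hn) (by omega)) fun h2 ⟨hl1, hl2⟩ hk2 => ?_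
  refine wp_seq_of (floorCmd_spec (q := q) (((hk2.n 0 rfl).trans (hk1.n 0 rfl)).trans hn)
    ((hk2.w 1 rfl).trans hq) hq0 (by omega)) fun h3 ⟨hL1, hL2, hL3⟩ hk3 => ?_
  have e0 : h3.n 0 = n := ((hk3.n 0 rfl).trans ((hk2.n 0 rfl).trans (hk1.n 0 rfl))).trans hn
  have e1 : h3.n 1 = k := ((hk3.n 1 rfl).trans ((hk2.n 1 rfl).trans (hk1.n 1 rfl))).trans hk
  have e9 : h3.n 9 = h2.n 9 := hk3.n 9 rfl
  have eq : h3.w 1 = q := ((hk3.w 1 rfl).trans (hk2.w 1 rfl)).trans hq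
  have key : ∀ (h4 : Store) (K B mode : ℕ), h4.n 4 = K → h4.n 5 = B → h4.n 7 = mode → K ≤ 2 * n →
      Choice n k c t K B (B ^ K) mode q i (h2.n 9) →
      wp E (.seq (.setN 6 (.c 1)) (.loop 13 (.v 4) (.setN 6 (.mul (.v 6) (.v 5)))))
        (fun h' => ∃ K B L mode q i l, Choice n k c t K B L mode q i l ∧
          h'.n 4 = K ∧ h'.n 5 = B ∧ h'.n 6 = L ∧ h'.n 7 = mode) h4 := by
    intro h4 K B mode f4 f5 f7 hK hch
    rw [wp_seq, wp_setN]
    refine ⟨trivial, wp_loop (m := K) (fun r h' => h'.n 6 = B ^ r) trivial ?_ (by omega) ?_ ?_ ?_⟩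
    · simp [NExp.eval, Store.setN, f4]
    · simp [NExp.eval, Store.setN]
    · intro r hr h5 hk5 h6
      have f5' : h5.n 5 = B := (hk5.n 5 rfl).trans (by simp [Store.setN, f5])
      simp only [wp_setN, NExp.ok, NExp.eval, Store.setN, Function.update_apply, f5', h6,
        Nat.reduceEqDiff, if_true, if_false, true_and]
      ring
    · intro h5 hk5 h6
      exact ⟨K, B, _, mode, q, i, _, hch, (hk5.n 4 rfl).trans (by simp [Store.setN, f4]),
        (hk5.n 5 rfl).trans (by simp [Store.setN, f5]), h6,
        (hk5.n 7 rfl).trans (by simp [Store.setN, f7])⟩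
  rw [wp_seq, wp_ite]
  refine ⟨⟨⟨trivial, trivial⟩, trivial⟩, fun hb => ?_, fun hb => ?_⟩ <;>
    simp only [BExp.eval, WExp.eval, NExp.eval, e1, e9, eq, WithTop.coe_le_coe, not_le] at hb
  · refine ⟨trivial, trivial, trivial, ?_⟩
    refine key _ k n 1 ?_ ?_ ?_ (by omega) ⟨hs, hl1, hl2, rfl, Or.inl ⟨rfl, rfl, rfl, hb⟩⟩
    · simp [Store.setN, NExp.eval, e1]
    · simp [Store.setN, NExp.eval, e0]
    · simp [Store.setN, NExp.eval]
  · refine ⟨trivial, trivial, ⟨trivial, trivial⟩, ?_⟩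
    refine key _ (2 * h3.n 8) 2 0 ?_ ?_ ?_ (by omega) ⟨hs, hl1, hl2, rfl,
      Or.inr ⟨rfl, rfl, hb, _, hL1, rfl, hL2, hL3⟩⟩ <;>
      simp [Store.setN, NExp.eval]

theorem SizeBound.ge {k : ℕ} {c t q : ℝ} {i : ℕ} (h : SizeBound n k c t q i) (hc : 0 < c)
    (ht : 0 < t) (hk : 1 ≤ k) : c * ((n : ℝ) / k) ^ t ≤ q := by
  have hk' : (0 : ℝ) < k := by exact_mod_cast hk
  have h1 : (n : ℝ) / k ≤ 2 ^ i := by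
    rw [div_le_iff₀ hk']
    exact_mod_cast h.le hk
  rw [h.eq]
  refine mul_le_mul_of_nonneg_left ?_ hc.le
  calc ((n : ℝ) / k) ^ t ≤ ((2 : ℝ) ^ i) ^ t := Real.rpow_le_rpow (by positivity) h1 ht.le
    _ = (2 ^ t) ^ i := by
      rw [← Real.rpow_natCast, ← Real.rpow_natCast, ← Real.rpow_mul (by norm_num),
        ← Real.rpow_mul (by norm_num), mul_comm]

/-- The codes reach an optimal witness. -/
theorem Choice.exists_mem (hp : Pre n d nx) (hd : ∀ i q, q < n → Par d i q → d q = d i + 1)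
    (φ : preFin d n ≃g G) (hG : G.IsTree) {c t : ℝ} (hbal : H.BalancedOnTrees c t)
    {k K B E mode i l : ℕ} {q τ : ℝ} (hch : Choice n k c t K B E mode q i l)
    (hY : H.IsYes G k τ) :
    ∃ v ∈ valI H d nx (codeFam d nx K B E mode) True 0 n k, v ≤ τ := by
  obtain ⟨hc, ht, hbal⟩ := hbal
  obtain rfl := hch.count
  rcases hch.cases with ⟨rfl, rfl, rfl, -⟩ | ⟨rfl, rfl, hlt, L, -, rfl, -, hL⟩
  · obtain ⟨S₀, hS₀⟩ := hY
    obtain ⟨S, hS, rfl⟩ := exists_cutOf φ S₀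
    exact exists_mem_valI φ hS hS₀ fun y _ hyS =>
      dlist_mem_codeFam_cut hS ((cutOf_ncard φ hS).symm.trans hS₀.1) hyS
  -- With `k = 0` the cut codes need no bits and are preferred. So here balancedness, which requires
  -- `1 ≤ k`, applies.
  · have hk : 1 ≤ k := by
      by_contra hk
      obtain rfl : k = 0 := by omega
      have hq : 0 ≤ q := by rw [hch.size.eq]; positivity
      simp only [zero_mul, Nat.cast_zero] at hlt
      linarith
    obtain ⟨S₀, hS₀, htr⟩ := hbal G hG k τ hk hY
    obtain ⟨S, hS, rfl⟩ := exists_cutOf φ S₀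
    refine exists_mem_valI φ hS hS₀ fun y hy hyS => ?_
    obtain ⟨v, hv⟩ := walkList_dlist hp hd hy hyS
    refine hv.mem_codeFam (hL _ ?_ ?_) (by decide) y
    · have := hp.le y hy
      refine (List.length_map _).le.trans ((List.length_filter_le _ _).trans ?_)
      rw [List.length_range']; omega
    · refine (dlist_length_le hp φ htr hy hyS).trans ?_
      rw [Nat.card_eq_fintype_card, Fintype.card_fin]
      exact hch.size.ge hc ht hk

/-! ### The whole program -/

noncomputable def solveCmd (c t : ℝ) (NP : ℕ) : Cmd :=
  .seq dfsCmd <| .seq nextCmd <| .seq (choiceCmd c t) <| .seq (tablesCmd NP) <|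
  .ite (.wle (.ld 0 (.v 1)) (.v 0)) (.setN 0 (.c 1)) (.setN 0 (.c 0))

theorem solveCmd_spec (hH : H.Additive) (hG : G.IsTree) {c t : ℝ} (hbal : H.BalancedOnTrees c t)
    {N NP a b s M k : ℕ} {τ : ℝ} {h : Store} (hn : h.n 0 = n) (hk : h.n 1 = k) (hkn : k ≤ n)
    (hN : h.n 2 = N) (h3 : h.n 3 = a * N ^ b) (hτ : h.w 0 = τ)
    (hA : ∀ u v : Fin n, MatAdj n (h.A 0) u v ↔ G.Adj u v) (hA1 : h.A 1 = 0) (hA2 : h.A 2 = 0)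
    (hA3 : h.A 3 = 0) (hwid : 2 * n + 2 ≤ N) (hs : N * N * N ≤ s) (hM : N ≤ M)
    (hs' : a * N ^ b ≤ s) (hM' : a * N ^ b ≤ M)
    (hE : ∀ K B L mode q i l, Choice n k c t K B L mode q i l → L ≤ M) :
    wp (subEnv H NP a b s M) (solveCmd c t NP) (fun h' => (h'.n 0 : ℝ) = H.answer G k τ) h := by
  have hn0 : 0 < n := by
    obtain ⟨v⟩ := hG.connected.nonempty
    have := v.2
    omega
  have hNs : N * N ≤ s := (Nat.le_mul_of_pos_right _ (by omega)).trans hs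
  have hns : n * n ≤ s := (Nat.mul_le_mul (by omega) (by omega)).trans hNs
  have hns' : n ≤ s := (Nat.le_mul_self n).trans hns
  refine wp_seq_of (dfsCmd_spec G hG hn hns (show n ≤ M by omega) hA hA1 hA2 hA3)
    fun h1 hdfs hk1 => ?_
  obtain ⟨⟨φ⟩, hroot⟩ := hdfs.exists_iso hG hA
  refine wp_seq_of (nextCmd_spec ((hk1.n 0 rfl).trans hn) hns' (show n ≤ M by omega) hroot)
    fun h2 hp hk2 => ?_
  have e0 : h2.n 0 = n := ((hk2.n 0 rfl).trans (hk1.n 0 rfl)).trans hn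
  have e1 : h2.n 1 = k := ((hk2.n 1 rfl).trans (hk1.n 1 rfl)).trans hk
  have e2 : h2.n 2 = N := ((hk2.n 2 rfl).trans (hk1.n 2 rfl)).trans hN
  have e3 : h2.n 3 = a * N ^ b := ((hk2.n 3 rfl).trans (hk1.n 3 rfl)).trans h3
  have ed : h2.A 3 = h1.A 3 := hk2.A 3 rfl
  have eτ : h2.w 0 = τ := ((hk2.w 0 rfl).trans (hk1.w 0 rfl)).trans hτ
  refine wp_seq_of (choiceCmd_spec e0 e1 hkn (show 2 * n ≤ M by omega) hbal.1)
    fun h3 ⟨K, B, L, mode, q, i, l, hch, f4, f5, f6, f7⟩ hk3 => ?_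
  have hb3 : Base n N (h1.A 3) (h2.A 4) h3 := ⟨(hk3.n 0 rfl).trans e0, (hk3.n 2 rfl).trans e2,
    (hk3.A 3 rfl).trans ed, hk3.A 4 rfl⟩
  have hq3 : Params (a * N ^ b) K B L mode h3 := ⟨(hk3.n 3 rfl).trans e3, f4, f5, f6, f7⟩
  have hf : Fits n N a b s M K B L mode := by
    refine ⟨hwid, hs, hM, hs', hM', ?_, ?_, ?_, hE K B L mode q i l hch⟩ <;>
      rcases hch.cases with ⟨rfl, rfl, rfl, -⟩ | ⟨rfl, rfl, -, L', hL', rfl, -⟩ <;> omega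
  refine wp_seq_of (tablesCmd_spec hH hp hf hb3 hq3) fun h4 hT hk4 => ?_
  have g1 : h4.n 1 = k := ((hk4.n 1 (tablesCmd_mn NP (by decide))).trans (hk3.n 1 rfl)).trans e1
  have gτ : h4.w 0 = τ := ((hk4.w 0 (tablesCmd_mw NP (by decide))).trans (hk3.w 0 rfl)).trans eτ
  have hrow := hT 0 le_rfl hn0 k hkn
  rw [hp.nx_zero hn0, zero_mul, zero_add] at hrow
  rw [wp_ite]
  -- An entry that is at most `τ` is finite, hence attained by a deletion set; conversely a witness
  -- within reach of the codes bounds the entry.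
  have hcond : BExp.eval h4 (.wle (.ld 0 (.v 1)) (.v 0)) ↔ H.IsYes G k τ := by
    simp only [BExp.eval, WExp.eval, NExp.eval, g1, gτ]
    constructor
    · intro hle
      obtain ⟨v, hv⟩ := WithTop.ne_top_iff_exists.1 (ne_top_of_le_ne_top WithTop.coe_ne_top hle)
      rw [← hv, WithTop.coe_le_coe] at hle
      exact isYes_of_mem_valI φ (hrow.1 v hv.symm) hle
    · intro hY
      obtain ⟨v, hv, hvτ⟩ := hch.exists_mem hp (fun i q hq hi => hdfs.depth hq hi) φ hG hbal hY
      exact (hrow.2 v hv).trans (WithTop.coe_le_coe.2 hvτ)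
  refine ⟨⟨⟨trivial, ?_⟩, trivial⟩, fun hc => ⟨trivial, ?_⟩, fun hc => ⟨trivial, ?_⟩⟩
  · show NExp.eval h4 (.v 1) < s
    have : k < N * N := lt_sq (by omega)
    simp only [NExp.eval, g1]; omega
  · rw [hcond] at hc
    simp [Store.setN, NExp.eval, GraphMeasure.answer, hc]
  · rw [hcond] at hc
    simp [Store.setN, NExp.eval, GraphMeasure.answer, hc]

/-- The row length goes to `n 2` and the number of cells to clear for the subroutine to `n 3`. The
case of more deletions than vertices is settled first, as the tables only have entries for up to `n`
deletions. -/
noncomputable def mainCmd (c t : ℝ) (a b NP : ℕ) : Cmd :=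
  .seq (.setN 2 (.add (.mul (.c 2) (.v 0)) (.c 2))) <| .seq (.setN 3 (.c a)) <|
  .seq (.loop 12 (.c b) (.setN 3 (.mul (.v 3) (.v 2)))) <|
  .ite (.lt (.v 0) (.v 1)) (.setN 0 (.c 0)) (solveCmd c t NP)

theorem not_isYes {k : ℕ} (hk : n < k) (τ : ℝ) : ¬ H.IsYes G k τ := by
  rintro ⟨S, hS, -⟩
  have := Set.ncard_le_card S
  simp only [Nat.card_eq_fintype_card, Fintype.card_fin] at this
  omega

theorem mainCmd_spec (hH : H.Additive) (hG : G.IsTree) {c t : ℝ} (hbal : H.BalancedOnTrees c t)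
    {N NP a b s M k : ℕ} {τ : ℝ} {h : Store} (hn : h.n 0 = n) (hk : h.n 1 = k) (hτ : h.w 0 = τ)
    (hA : ∀ u v : Fin n, MatAdj n (h.A 0) u v ↔ G.Adj u v) (hA1 : h.A 1 = 0) (hA2 : h.A 2 = 0)
    (hA3 : h.A 3 = 0) (hN : N = 2 * n + 2) (hs : N * N * N ≤ s) (hM : N ≤ M) (hb : b ≤ M)
    (hs' : a * N ^ b ≤ s) (hM' : a * N ^ b ≤ M)
    (hE : k ≤ n → ∀ K B L mode q i l, Choice n k c t K B L mode q i l → L ≤ M) :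
    wp (subEnv H NP a b s M) (mainCmd c t a b NP)
      (fun h' => (h'.n 0 : ℝ) = H.answer G k τ) h := by
  unfold mainCmd
  rw [wp_seq, wp_setN, wp_seq, wp_setN, wp_seq]
  refine ⟨⟨⟨trivial, trivial⟩, trivial⟩, trivial, ?_⟩
  refine wp_loop (m := b) (fun r h' => h'.n 3 = a * N ^ r) trivial rfl hb ?_ ?_ ?_
  · simp [Store.setN, NExp.eval]
  · intro r hr h1 hk1 h2
    have e2 : h1.n 2 = N := (hk1.n 2 rfl).trans (by simp [Store.setN, NExp.eval, hn, hN])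
    simp only [wp_setN, NExp.ok, NExp.eval, Store.setN, Function.update_apply, e2, h2,
      Nat.reduceEqDiff, if_true, if_false, true_and]
    ring
  · intro h1 hk1 h2
    have e0 : h1.n 0 = n := (hk1.n 0 rfl).trans (by simp [Store.setN, hn])
    have e1 : h1.n 1 = k := (hk1.n 1 rfl).trans (by simp [Store.setN, hk])
    have e2 : h1.n 2 = N := (hk1.n 2 rfl).trans (by simp [Store.setN, NExp.eval, hn, hN])
    have eA : ∀ x, h1.A x = h.A x := fun x => hk1.A x rfl
    rw [wp_ite]
    refine ⟨⟨trivial, trivial⟩, fun hc => ⟨trivial, ?_⟩, fun hc => ?_⟩ <;>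
      simp only [BExp.eval, NExp.eval, e0, e1] at hc
    · simp [Store.setN, NExp.eval, GraphMeasure.answer, not_isYes hc]
    · exact solveCmd_spec hH hG hbal e0 e1 (by omega) e2 h2 ((hk1.w 0 rfl).trans hτ)
        (by rw [eA]; exact hA) ((eA 1).trans hA1) ((eA 2).trans hA2) ((eA 3).trans hA3)
        (by omega) hs hM hs' hM' (hE (by omega))

end TreeDP


/-! ### Running time -/

namespace TreeDP

open RealRAM

variable {H : GraphMeasure}

theorem SizeBound.le_rpow {n k : ℕ} {c t q : ℝ} {i : ℕ} (h : SizeBound n k c t q i) (hc : 0 < c)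
    (ht : 0 < t) (hk : 1 ≤ k) (hkn : k ≤ n) : q ≤ c * (2 * n / k : ℝ) ^ t := by
  have hk' : (0 : ℝ) < k := by exact_mod_cast hk
  have h1 : (2 : ℝ) ^ i ≤ 2 * n / k := by
    rw [le_div_iff₀ hk']
    rcases h.lt with rfl | h
    · rw [pow_zero, one_mul]
      exact_mod_cast (by omega : k ≤ 2 * n)
    · exact_mod_cast h.le
  rw [h.eq]
  refine mul_le_mul_of_nonneg_left ?_ hc.le
  calc ((2 : ℝ) ^ t) ^ i = ((2 : ℝ) ^ i) ^ t := by
        rw [← Real.rpow_natCast, ← Real.rpow_natCast, ← Real.rpow_mul (by norm_num),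
          ← Real.rpow_mul (by norm_num), mul_comm]
    _ ≤ _ := Real.rpow_le_rpow (by positivity) h1 ht.le

/-- Here `y` is `k * l` for cut codes and `L` for walk codes. As the mode was chosen by comparing `k
* l` with `q`, it lies below both in either case. -/
theorem Choice.exists_bits {n k : ℕ} {c t : ℝ} {K B E mode i l : ℕ} {q : ℝ}
    (hch : Choice n k c t K B E mode q i l) :
    ∃ y : ℝ, 0 ≤ y ∧ y ≤ q ∧ y ≤ ((k * l : ℕ) : ℝ) ∧ (E : ℝ) ≤ 2 ^ (2 * y) := by
  obtain rfl := hch.count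
  rcases hch.cases with ⟨rfl, rfl, rfl, hq⟩ | ⟨rfl, rfl, hq, L, -, rfl, hL, -⟩
  · refine ⟨((K * l : ℕ) : ℝ), by positivity, hq, le_rfl, ?_⟩
    have h1 : B ^ K ≤ 2 ^ (2 * (K * l)) :=
      calc B ^ K ≤ (2 ^ l) ^ K := Nat.pow_le_pow_left hch.log_le _
        _ = 2 ^ (K * l) := by rw [← pow_mul, mul_comm]
        _ ≤ _ := Nat.pow_le_pow_right (by norm_num) (by omega)
    have h2 : ((2 : ℝ) ^ (2 * (K * l)) : ℝ) = 2 ^ (2 * ((K * l : ℕ) : ℝ)) := by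
      rw [← Real.rpow_natCast]; push_cast; rfl
    rw [← h2]
    exact_mod_cast h1
  · refine ⟨L, by positivity, hL, by linarith, le_of_eq ?_⟩
    rw [show (2 * (L : ℝ)) = ((2 * L : ℕ) : ℝ) by push_cast; rfl, Real.rpow_natCast]
    push_cast; rfl

/-- The exponent in the running time. -/
noncomputable def expo (t : ℝ) (n : ℕ) : ℝ := ((n : ℝ) * Real.log n) ^ (t / (t + 1))

theorem expo_nonneg (t : ℝ) (n : ℕ) : 0 ≤ expo t n :=
  Real.rpow_nonneg (mul_nonneg n.cast_nonneg (Real.log_natCast_nonneg n)) _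

/-- From `1 ≤ l` follows `2 ≤ n`, so `l` is at most the binary logarithm of `2 * n`, thus at most
twice that of `n`; and `2 / Real.log 2 < 4`. -/
theorem log_bits_le {n l : ℕ} (hl : 1 ≤ l) (h : l = 0 ∨ 2 ^ l < 2 * n) :
    (l : ℝ) ≤ 4 * Real.log n := by
  replace h : 2 ^ l < 2 * n := h.resolve_left (by omega)
  have h2 : 2 ≤ n := by
    have : 2 ^ 1 ≤ 2 ^ l := Nat.pow_le_pow_right (by norm_num) hl
    omega
  have hn : (2 : ℝ) ≤ n := by exact_mod_cast h2
  have h3 : (2 : ℝ) ^ l < 2 * n := by exact_mod_cast h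
  have h4 := Real.log_lt_log (by positivity) h3
  rw [Real.log_pow, Real.log_mul (by norm_num) (by positivity)] at h4
  have h5 := Real.log_le_log (by norm_num) hn
  have h6 := Real.log_two_gt_d9
  nlinarith

theorem Choice.count_le {n k : ℕ} {c t : ℝ} (hc : 0 < c) (ht : 0 < t) {K B E mode i l : ℕ} {q : ℝ}
    (hkn : k ≤ n) (hch : Choice n k c t K B E mode q i l) :
    (E : ℝ) ≤ 2 ^ (2 * (c ^ (1 / (t + 1)) * 8 ^ (t / (t + 1))) * expo t n) := by
  obtain ⟨y, hy0, hyq, hyl, hE⟩ := hch.exists_bits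
  refine hE.trans (Real.rpow_le_rpow_of_exponent_le (by norm_num) ?_)
  rw [mul_assoc]
  refine mul_le_mul_of_nonneg_left ?_ (by norm_num)
  have hX := expo_nonneg t n
  by_cases h0 : k = 0 ∨ l = 0
  · have : k * l = 0 := by simpa using h0
    rw [this, Nat.cast_zero] at hyl
    exact hyl.trans (by positivity)
  have hk : 1 ≤ k := by omega
  have hl : 1 ≤ l := by omega
  have hk' : (0 : ℝ) < k := by exact_mod_cast hk
  have hlog := log_bits_le hl hch.log_lt
  have hlog0 : 0 ≤ Real.log n := Real.log_natCast_nonneg n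
  have h1 : y ≤ c * (2 * n / k : ℝ) ^ t := hyq.trans (hch.size.le_rpow hc ht hk hkn)
  have h2 : y ≤ k * (4 * Real.log n) := by
    refine hyl.trans ?_
    push_cast
    exact mul_le_mul_of_nonneg_left hlog hk'.le
  have ht1 : t + 1 ≠ 0 := by positivity
  have hs : 0 ≤ t / (t + 1) := by positivity
  -- The weights are chosen such that `k` cancels: the first bound contributes `k` with exponent `-t
  -- / (t + 1)`, the second with `t / (t + 1)`. The 8 collects the factors 2 and 4 of the two
  -- bounds.
  calc y = y ^ (1 / (t + 1)) * y ^ (t / (t + 1)) := by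
        rw [← Real.rpow_add_of_nonneg hy0 (by positivity) hs,
          show 1 / (t + 1) + t / (t + 1) = 1 by field_simp; ring, Real.rpow_one]
    _ ≤ (c * (2 * n / k : ℝ) ^ t) ^ (1 / (t + 1)) * (k * (4 * Real.log n)) ^ (t / (t + 1)) := by
        gcongr
    _ = c ^ (1 / (t + 1)) * ((2 * n / k : ℝ) ^ (t / (t + 1)) *
        (k * (4 * Real.log n)) ^ (t / (t + 1))) := by
        rw [Real.mul_rpow hc.le (by positivity), ← Real.rpow_mul (by positivity), mul_one_div,
          mul_assoc]
    _ = c ^ (1 / (t + 1)) * 8 ^ (t / (t + 1)) * expo t n := by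
        rw [expo, ← Real.mul_rpow (by positivity) (by positivity), mul_assoc,
          ← Real.mul_rpow (by norm_num) (by positivity)]
        congr 2
        field_simp
        ring

/-- Absorbs polynomial factors into the exponential. The logarithm is at most `n ^ s / s`, and for
`2 ≤ n` the factor `log n` in the exponent is at least `log 2`; for `n = 1` the logarithm vanishes.
-/
theorem exists_log_le {t : ℝ} (ht : 0 < t) : ∃ C : ℝ, 0 ≤ C ∧ ∀ n : ℕ, 1 ≤ n →
    (n : ℝ) ≤ 2 ^ (C * expo t n) := by
  have h2 : 0 < Real.log 2 := Real.log_pos (by norm_num)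
  set s := t / (t + 1) with hs
  have hs0 : 0 < s := by positivity
  refine ⟨1 / (s * Real.log 2 ^ s) / Real.log 2, by positivity, fun n hn => ?_⟩
  have hn' : (0 : ℝ) < n := by exact_mod_cast hn
  have key : Real.log n ≤ 1 / (s * Real.log 2 ^ s) * expo t n := by
    rcases hn.eq_or_lt with rfl | hn2
    · rw [Nat.cast_one, Real.log_one]
      exact mul_nonneg (by positivity) (expo_nonneg _ _)
    · have h3 : Real.log 2 ≤ Real.log n :=
        Real.log_le_log (by norm_num) (by exact_mod_cast hn2)
      have h4 : (n : ℝ) ^ s * Real.log 2 ^ s ≤ expo t n := by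
        rw [expo, ← hs, Real.mul_rpow hn'.le (h2.le.trans h3)]
        gcongr
      calc Real.log n ≤ (n : ℝ) ^ s / s := Real.log_le_rpow_div hn'.le hs0
        _ = 1 / (s * Real.log 2 ^ s) * ((n : ℝ) ^ s * Real.log 2 ^ s) := by
          field_simp
        _ ≤ _ := mul_le_mul_of_nonneg_left h4 (by positivity)
  rw [← Real.log_le_log_iff hn' (by positivity), Real.log_rpow (by norm_num)]
  refine key.trans (le_of_eq ?_)
  field_simp

/-- The number of rounds and the running time. -/
theorem exists_time {c t : ℝ} (hc : 0 < c) (ht : 0 < t) (a b C D : ℕ) :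
    ∃ A : ℝ, ∀ n : ℕ, 1 ≤ n → ∃ M : ℕ, 2 * n + 2 ≤ M ∧ b ≤ M ∧ a * (2 * n + 2) ^ b ≤ M ∧
      (∀ k ≤ n, ∀ K B E mode q i l, Choice n k c t K B E mode q i l → E ≤ M) ∧
      ((2 + C * M ^ D : ℕ) : ℝ) ≤ A * 2 ^ (A * expo t n) := by
  obtain ⟨C₂, hC₂, hlog⟩ := exists_log_le ht
  set C₁ := 2 * (c ^ (1 / (t + 1)) * 8 ^ (t / (t + 1))) with hC₁
  have hC₁0 : 0 ≤ C₁ := by positivity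
  -- The 6 accounts for the terms `2 * n + 2`, the number of codes and the final 1, each bounded by
  -- a multiple of `Z`.
  set F : ℝ := 6 + a * 4 ^ b + b with hF
  have hF0 : 0 ≤ F := by positivity
  -- One constant has to serve both as the factor and in the exponent.
  refine ⟨max (2 + C * F ^ D) ((C₁ + C₂) * ((b + 1) * D : ℕ)), fun n hn => ?_⟩
  set X := expo t n with hX
  have hX0 : 0 ≤ X := expo_nonneg t n
  set Z : ℝ := 2 ^ ((C₁ + C₂) * X) with hZ
  have hZ1 : 1 ≤ Z := Real.one_le_rpow (by norm_num) (by positivity)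
  have hZn : (n : ℝ) ≤ Z := (hlog n hn).trans
    (Real.rpow_le_rpow_of_exponent_le (by norm_num) (by gcongr; linarith))
  have hZE : (2 : ℝ) ^ (C₁ * X) ≤ Z :=
    Real.rpow_le_rpow_of_exponent_le (by norm_num) (by gcongr; linarith)
  have hn' : (1 : ℝ) ≤ n := by exact_mod_cast hn
  refine ⟨2 * n + 2 + b + a * (2 * n + 2) ^ b + ⌊(2 : ℝ) ^ (C₁ * X)⌋₊ + 1, by omega, by omega,
    by omega, ?_, ?_⟩
  · intro k hk K B E mode q i l hch
    have : E ≤ ⌊(2 : ℝ) ^ (C₁ * X)⌋₊ := Nat.le_floor (hch.count_le hc ht hk)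
    omega
  · set M := 2 * n + 2 + b + a * (2 * n + 2) ^ b + ⌊(2 : ℝ) ^ (C₁ * X)⌋₊ + 1 with hM
    have hfl := Nat.floor_le (a := (2 : ℝ) ^ (C₁ * X)) (by positivity)
    have hZb : Z ^ b ≤ Z ^ (b + 1) := pow_le_pow_right₀ hZ1 (by omega)
    have hZ' : Z ≤ Z ^ (b + 1) := le_self_pow₀ hZ1 (by omega)
    have h1 : (1 : ℝ) ≤ Z ^ (b + 1) := one_le_pow₀ hZ1
    have hMle : (M : ℝ) ≤ F * Z ^ (b + 1) := by
      rw [hM]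
      push_cast
      have hb : (b : ℝ) ≤ b * Z ^ (b + 1) := le_mul_of_one_le_right (by positivity) h1
      have hp : (a : ℝ) * (2 * n + 2) ^ b ≤ a * 4 ^ b * Z ^ (b + 1) := by
        rw [mul_assoc]
        refine mul_le_mul_of_nonneg_left ?_ (by positivity)
        calc (2 * (n : ℝ) + 2) ^ b ≤ (4 * Z) ^ b := by gcongr; linarith
          _ = 4 ^ b * Z ^ b := mul_pow _ _ _
          _ ≤ _ := by gcongr
      rw [hF]
      linarith
    have hpow : Z ^ ((b + 1) * D) = 2 ^ ((C₁ + C₂) * ((b + 1) * D : ℕ) * X) := by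
      rw [hZ, ← Real.rpow_natCast, ← Real.rpow_mul (by norm_num)]
      congr 1
      ring
    calc ((2 + C * M ^ D : ℕ) : ℝ) = 2 + C * (M : ℝ) ^ D := by push_cast; rfl
      _ ≤ 2 * Z ^ ((b + 1) * D) + C * (F * Z ^ (b + 1)) ^ D := by
        have : (1 : ℝ) ≤ Z ^ ((b + 1) * D) := one_le_pow₀ hZ1
        gcongr
        linarith
      _ = (2 + C * F ^ D) * 2 ^ ((C₁ + C₂) * ((b + 1) * D : ℕ) * X) := by
        rw [← hpow, mul_pow, ← pow_mul]; ring
      _ ≤ _ := by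
        gcongr
        · exact le_max_left _ _
        · norm_num
        · exact le_max_right _ _

/-! ### The main theorem -/

open Classical in
/-- The store that represents the input. -/
noncomputable def initStore {n : ℕ} (G : SimpleGraph (Fin n)) (k : ℕ) (τ : ℝ) : Store where
  n x := if x = 0 then n else if x = 1 then k else 0
  w x := if x = 0 then τ else ⊤
  A c i := if c = 0 then if ∃ u v : Fin n, i = (u : ℕ) * n + (v : ℕ) ∧ G.Adj u v then 1 else 0 else 0
  W _ _ := ⊤
  p _ := 0
  pa _ _ := 0

theorem initStore_matAdj {n : ℕ} (G : SimpleGraph (Fin n)) (k : ℕ) (τ : ℝ) (u v : Fin n) :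
    MatAdj n ((initStore G k τ).A 0) u v ↔ G.Adj u v := by
  simp only [MatAdj, initStore, if_true]
  constructor
  · intro h
    split_ifs at h with h'
    · obtain ⟨u', v', he, ha⟩ := h'
      obtain ⟨e1, e2⟩ := row_inj v.2 v'.2 he
      rwa [Fin.ext e1, Fin.ext e2]
  · intro h
    rw [if_pos ⟨u, v, rfl, h⟩]

/-- In the typed layout, `n` (scalar 0), the value of `τ` (scalar 2) and the matrix (array 0) are
already in place. Only `k` has to move from scalar 1 to scalar 5, and scalar 1 becomes the flag of
`τ`. -/
theorem initStore_rel {n : ℕ} (G : SimpleGraph (Fin n)) (k : ℕ) (τ : ℝ) :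
    Rel (initStore G k τ)
      (((input G k τ).setScalar 5 ((input G k τ).scalar 1)).setScalar 1 1) := by
  refine ⟨fun x => ?_, fun x => ?_, fun x => ?_, fun c i => ?_, fun c i => ?_, fun c i => ?_⟩
  · simp only [State.setScalar, input, Function.update_apply, initStore]
    rcases x with _ | _ | x
    · simp
    · simp
    · simp only [show 5 * (x + 1 + 1) ≠ 0 by omega, show 5 * (x + 1 + 1) ≠ 1 by omega,
        show 5 * (x + 1 + 1) ≠ 2 by omega, show 5 * (x + 1 + 1) ≠ 5 by omega, if_false]
      simp
  · simp only [State.setScalar, input, Function.update_apply, initStore]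
    rcases x with _ | x
    · exact Or.inr ⟨by simp, by simp⟩
    · refine Or.inl ⟨?_, by simp⟩
      simp only [show 5 * (x + 1) + 1 ≠ 0 by omega, show 5 * (x + 1) + 1 ≠ 1 by omega,
        show 5 * (x + 1) + 1 ≠ 2 by omega, show 5 * (x + 1) + 1 ≠ 5 by omega, if_false]
  · simp only [State.setScalar, input, Function.update_apply, initStore]
    simp only [show 5 * x + 4 ≠ 0 by omega, show 5 * x + 4 ≠ 1 by omega,
      show 5 * x + 4 ≠ 2 by omega, show 5 * x + 4 ≠ 5 by omega, if_false]
  · simp only [setScalar_array, input, initStore]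
    rcases c with _ | c
    · simp only [mul_zero, if_true, adjCells]
      split_ifs <;> simp
    · simp
  · refine Or.inl ⟨?_, rfl⟩
    simp [input]
  · simp only [setScalar_array, input, initStore]
    rw [if_neg (by omega)]

end TreeDP

theorem mainTheorem8 (H : GraphMeasure) (c t : ℝ)
    (hadd : H.Additive) (hbal : H.BalancedOnTrees c t) (hpoly : H.PolyComputableOnTrees) :
    ∃ (P : RealRAM.Program) (A B : ℝ) (d : ℕ),
      H.DecidesOnTrees P
        (fun n => A * (2 : ℝ) ^ (A * ((n : ℝ) * Real.log n) ^ (t / (t + 1))))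
        (fun n => B * (n : ℝ) ^ d) := by
  obtain ⟨P₀, a, b, hP₀⟩ := hpoly
  set Q := TreeDP.mainCmd c t a b (P₀.width + 1) with hQ
  obtain ⟨C, D, hCD⟩ := Q.bound_le
  obtain ⟨A, hA⟩ := TreeDP.exists_time hbal.1 hbal.2.1 a b C D
  -- Two instructions bring the input into the typed layout. The space is `N ^ 3 + a * N ^ b` with
  -- `N = 2 * n + 2 ≤ 4 * n`, whence the constants.
  refine ⟨.seq (.copy 5 1) (.seq (.const 1 1) (Q.comp P₀ 0)), A, 64 + a * 4 ^ b, 3 + b,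
    fun n G hG k τ => ?_⟩
  have hn : 1 ≤ n := by
    obtain ⟨v⟩ := hG.connected.nonempty
    have := v.2
    omega
  obtain ⟨M, hM1, hM2, hM3, hM4, hM5⟩ := hA n hn
  set N := 2 * n + 2 with hN
  have hwp := TreeDP.mainCmd_spec (H := H) hadd hG hbal (N := N) (NP := P₀.width + 1) (a := a) (b := b)
    (s := N * N * N + a * N ^ b) (M := M) (k := k) (τ := τ) (h := TreeDP.initStore G k τ) rfl rfl rfl
    (TreeDP.initStore_matAdj G k τ) rfl rfl rfl hN (by omega) hM1 hM2 (by omega) hM3 (hM4 k)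
  obtain ⟨T, σ', hT, hTle, ⟨h', hrel, hout⟩, -⟩ :=
    TreeDP.Cmd.run (TreeDP.subEnv_sound hP₀ _ _) Q 0 (TreeDP.initStore_rel G k τ) hwp
  refine ⟨1 + (1 + T), N * N * N + a * N ^ b, σ',
    .seq (.copy _ 5 1) (.seq (.const _ 1 1) hT), ?_, ?_, ?_⟩
  · rw [← hout]
    exact hrel.n 0
  · refine le_trans ?_ hM5
    have h1 : T ≤ C * M ^ D := hTle.trans (hCD M (by omega))
    exact_mod_cast (by omega : 1 + (1 + T) ≤ 2 + C * M ^ D)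
  · have hn' : (1 : ℝ) ≤ n := by exact_mod_cast hn
    have hN4 : (N : ℝ) ≤ 4 * n := by rw [hN]; push_cast; linarith
    push_cast
    calc (N : ℝ) * N * N + a * (N : ℝ) ^ b ≤ (4 * n) * (4 * n) * (4 * n) + a * (4 * n : ℝ) ^ b := by
          gcongr
      _ = 64 * (n : ℝ) ^ 3 * 1 + a * 4 ^ b * (1 * (n : ℝ) ^ b) := by rw [mul_pow]; ring
      _ ≤ 64 * (n : ℝ) ^ 3 * (n : ℝ) ^ b + a * 4 ^ b * ((n : ℝ) ^ 3 * (n : ℝ) ^ b) := by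
          gcongr
          · exact one_le_pow₀ hn'
          · exact one_le_pow₀ hn'
      _ = _ := by rw [pow_add]; ring
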